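/- A directionally reinforced random walk on $\mathbb{Z}^2$ with waiting-time law $\mu$ (a probability distribution on $\{0,1,2,\dots\}$ with $\mu(\{0\})<1$) is the following process $(R_m)_{m\ge 0}$. A particle starts at the origin in an initial direction $D_0\in\{\pm e_1,\pm e_2\}$ with an arbitrary law, and moves in unit steps, one per unit of time. It makes $T_0$ steps in direction $D_0$, then $T_1$ steps in direction $D_1$, and so on (a leg may have length $0$); $R_m$ is its position at time $m$. Here $T_0$ has law $\mu$ and is independent of $D_0$, and for every $n\ge 0$, given $D_0,T_0,\dots,D_n,T_n$, the direction $D_{n+1}$ is uniformly distributed on the three directions different from $D_n$ and $T_{n+1}$ has law $\mu$ and is independent of $D_{n+1}$. The $(i+1)$-st change of direction, $i \ge 0$, takes place at time $T_0+\dots+T_i$, at the lattice point $R_{T_0+\dots+T_i}$. Theorem. There is a probability distribution $\mu$ on $\{0,1,2,\dots\}$ with $\mu(\{0\})<1$ such that every directionally reinforced random walk $(R_m)$ on $\mathbb{Z}^2$ with waiting-time law $\mu$ has the following two properties: it is recurrent, i.e. almost surely $R_m=0$ for infinitely many $m$; and for every lattice point $x\in\mathbb{Z}^2$, almost surely only finitely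 many of its changes of direction take place at $x$. -/

import Mathlib

open MeasureTheory
open scoped ENNReal

namespace DirWalk

/-- The `2 * d` directions of motion in `ℤ^d`: the pair `(k, true)` stands for `+e_k` and
`(k, false)` for `-e_k`. -/
abbrev Direction (d : ℕ) : Type := Fin d × Bool

/-- The unit vector `± e_k` of a direction. -/
def Direction.vec {d : ℕ} (e : Direction d) : Fin d → ℤ :=
  Pi.single e.1 (if e.2 then 1 else -1)

/-- The legs `0, 1, 2, …` of the motion have lengths `T 0, T 1, T 2, …` (possibly zero).
`startTime T i` is the time at which leg `i` starts; for `i ≥ 1` it is the time of the `i`-th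
change of direction. -/
def startTime (T : ℕ → ℕ) (i : ℕ) : ℕ := ∑ j ∈ Finset.range i, T j

/-- The leg in which the unit step from time `s` to time `s + 1` is made, i.e. the `i` with
`startTime T i ≤ s < startTime T (i + 1)`. (It exists whenever the total waiting time is
infinite.) -/
noncomputable def legAt (T : ℕ → ℕ) (s : ℕ) : ℕ := sInf {i | s < startTime T (i + 1)}

/-- The position at time `m` of the particle which starts at the origin and runs, in unit steps,
in direction `D 0` for time `T 0`, then in direction `D 1` for time `T 1`, and so on. -/
noncomputable def walk {d : ℕ} (D : ℕ → Direction d) (T : ℕ → ℕ) : ℕ → (Fin d → ℤ)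
  | 0 => 0
  | m + 1 => walk D T m + (D (legAt T m)).vec

/-- The location at which the change from direction `D i` to direction `D (i + 1)` takes place. -/
noncomputable def turnLocation {d : ℕ} (D : ℕ → Direction d) (T : ℕ → ℕ) (i : ℕ) : Fin d → ℤ :=
  walk D T (startTime T (i + 1))

/-- The random directions `D i` and waiting times `T i` drive a directionally reinforced random
walk on `ℤ^d` with waiting time law `μ`: the first waiting time has law `μ` and is independent of
the first direction (whose law is arbitrary), and, given the whole past, the next direction is
uniform among the `2 * d - 1` directions different from the current one and the next waiting time
has law `μ`, independently of that choice. -/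
structure IsDirReinforced {d : ℕ} {Ω : Type*} [MeasurableSpace Ω] (μ : PMF ℕ) (P : Measure Ω)
    (D : ℕ → Ω → Direction d) (T : ℕ → Ω → ℕ) : Prop where
  measurable_dir : ∀ i, Measurable (D i)
  measurable_wait : ∀ i, Measurable (T i)
  law_zero : ∀ (e : Direction d) (t : ℕ),
    P {ω | D 0 ω = e ∧ T 0 ω = t} = P {ω | D 0 ω = e} * μ t
  law_succ : ∀ (n : ℕ) (e : ℕ → Direction d) (t : ℕ → ℕ),
    P {ω | ∀ i ≤ n + 1, D i ω = e i ∧ T i ω = t i} =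
      P {ω | ∀ i ≤ n, D i ω = e i ∧ T i ω = t i} *
        ((if e (n + 1) = e n then 0 else ((2 * d - 1 : ℕ) : ℝ≥0∞)⁻¹) * μ (t (n + 1)))

end DirWalk

/-! The law puts mass at least 1/2 on length 0 and the rest on groups: group `k` is uniform on `4 *
size k` consecutive lengths and has total mass `1 / rarity k`. Write a = `size k` and b = `rarity
k`. Passing through the origin is a one-dimensional event, turning at a given point a
two-dimensional one. From distance of order a, one leg of a prescribed length reaches a coordinate
axis and one long leg along this axis then sweeps over the origin; the chance is of order 1/(a b²)
(`le_hit_crosses`), so that about a b² legs started in the box of radius a suffice. To turn at x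
both coordinates must be right: after a leg of group `k` along each axis the position is spread over
about a² points, so the expected number of turns at x is of the order of the occupation of a box
divided by a² (`free_pow_hit_le`). An occupation of order a b² thus makes crossing likely and turns
at x unlikely, provided that a is large compared to b².

It remains to produce this occupation. With only the groups up to `k`, the waiting times are
bounded; the return probabilities after 2n legs are then at least of order 1/n, by reversibility,
Cauchy-Schwarz and a second moment bound, and the expected occupation diverges (`exists_le_green`).
`span k` is the first number of legs at which it reaches `goal k`. The later groups are too rare to
destroy it (`le_green_law`) and too spread out to increase it much (`green_law_le`).

Recurrence: up to leg `time k` the walk has probably used no group from `k` on and lies in the box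
of radius a (`escape_le`); from there it crosses the origin during phase `k` with probability at
least 1/1536 (`le_hit_law`), and `avoid_phases_le` iterates this over the phases. Turns: between
legs `turnTime k` and `turnTime (k + 1)` a turn at x has probability at most of order 2^(-k)
(`free_pow_hit_startsAt_le`), and Borel-Cantelli applies.

Expectations are handled as powers of the operators `leg` on functions with values in [0, ∞], so
that no summability is at issue; `lintegral_legs` connects them with the process. -/

namespace DirWalk

/-! ### The transition operators of the walk -/

/-- Nonnegative functions of the position and the direction of the leg to come. -/
abbrev Obs : Type := (Fin 2 → ℤ) → Direction 2 → ℝ≥0∞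

/-- Average over the next direction, uniform among those different from the current one. -/
noncomputable def turn : Module.End ℝ≥0∞ Obs where
  toFun f s e := 3⁻¹ * ∑ e', if e' = e then 0 else f s e'
  map_add' f g := by
    funext s e
    simp only [Pi.add_apply]
    rw [← mul_add, ← Finset.sum_add_distrib]
    congr 1
    refine Finset.sum_congr rfl fun e' _ => ?_
    split_ifs <;> simp
  map_smul' c f := by
    funext s e
    simp only [Pi.smul_apply, smul_eq_mul, RingHom.id_apply]
    rw [mul_left_comm, Finset.mul_sum _ _ c]
    simp only [mul_ite, mul_zero]

theorem turn_apply (f : Obs) (s : Fin 2 → ℤ) (e : Direction 2) :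
    turn f s e = 3⁻¹ * ∑ e', if e' = e then 0 else f s e' := rfl

open scoped Classical in
/-- One leg with waiting time weights `w`, restricted to the legs which satisfy `A`, followed by
a change of direction. -/
noncomputable def leg (w : ℕ → ℝ≥0∞) (A : (Fin 2 → ℤ) → Direction 2 → ℕ → Prop) :
    Module.End ℝ≥0∞ Obs where
  toFun f s e := ∑' t : ℕ, (if A s e t then w t else 0) * turn f (s + t • e.vec) e
  map_add' f g := by
    funext s e
    simp only [Pi.add_apply, map_add]
    rw [← ENNReal.tsum_add]
    simp only [mul_add]
  map_smul' c f := by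
    funext s e
    simp only [Pi.smul_apply, smul_eq_mul, RingHom.id_apply, map_smul]
    rw [← ENNReal.tsum_mul_left]
    simp only [mul_left_comm]

open scoped Classical in
theorem leg_apply (w : ℕ → ℝ≥0∞) (A : (Fin 2 → ℤ) → Direction 2 → ℕ → Prop) (f : Obs)
    (s : Fin 2 → ℤ) (e : Direction 2) :
    leg w A f s e = ∑' t : ℕ, (if A s e t then w t else 0) * turn f (s + t • e.vec) e := rfl

/-- One unrestricted leg. -/
noncomputable abbrev free (w : ℕ → ℝ≥0∞) : Module.End ℝ≥0∞ Obs := leg w fun _ _ _ => True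

theorem free_apply (w : ℕ → ℝ≥0∞) (f : Obs) (s : Fin 2 → ℤ) (e : Direction 2) :
    free w f s e = ∑' t : ℕ, w t * turn f (s + t • e.vec) e := by
  simp [leg_apply]

/-- The indicator function of a set of positions. -/
noncomputable def ind (A : Set (Fin 2 → ℤ)) : Obs := fun s _ => A.indicator 1 s

theorem ind_of_mem {A : Set (Fin 2 → ℤ)} {s : Fin 2 → ℤ} (h : s ∈ A) (e : Direction 2) :
    ind A s e = 1 := by simp [ind, h]

theorem ind_of_notMem {A : Set (Fin 2 → ℤ)} {s : Fin 2 → ℤ} (h : s ∉ A) (e : Direction 2) :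
    ind A s e = 0 := by simp [ind, h]

theorem ind_le_one (A : Set (Fin 2 → ℤ)) : ind A ≤ 1 := fun s e => by
  by_cases h : s ∈ A <;> simp [ind, h]

theorem ind_mono {A B : Set (Fin 2 → ℤ)} (h : A ⊆ B) : ind A ≤ ind B := fun s e => by
  by_cases hA : s ∈ A
  · simp [ind, hA, h hA]
  · simp [ind, hA]

theorem turn_mono {f g : Obs} (h : f ≤ g) : turn f ≤ turn g := fun s e => by
  simp only [turn_apply]
  gcongr with e'
  split_ifs
  · exact le_rfl
  · exact h s e'

theorem turn_const (c : ℝ≥0∞) (s : Fin 2 → ℤ) (e : Direction 2) :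
    turn (fun _ _ => c) s e = c := by
  rw [turn_apply, Finset.sum_ite, Finset.sum_const_zero, zero_add, Finset.sum_const,
    Finset.filter_ne', Finset.card_erase_of_mem (Finset.mem_univ _)]
  simp only [Finset.card_univ, Fintype.card_prod, Fintype.card_fin, Fintype.card_bool, nsmul_eq_mul]
  norm_num
  rw [← mul_assoc, ENNReal.inv_mul_cancel (by norm_num) (by norm_num), one_mul]

theorem turn_one : turn (1 : Obs) = 1 := by
  funext s e
  exact turn_const 1 s e

theorem third_mul_le_turn (f : Obs) (s : Fin 2 → ℤ) {e e' : Direction 2} (h : e' ≠ e) :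
    3⁻¹ * f s e' ≤ turn f s e := by
  rw [turn_apply]
  gcongr
  refine le_trans ?_ (Finset.single_le_sum (f := fun e' => if e' = e then 0 else f s e')
    (fun _ _ => zero_le) (Finset.mem_univ e'))
  simp [h]

theorem leg_mono' {w w' : ℕ → ℝ≥0∞} {A A' : (Fin 2 → ℤ) → Direction 2 → ℕ → Prop}
    (h : ∀ s e t, A s e t → A' s e t ∧ w t ≤ w' t) {f g : Obs} (hfg : f ≤ g) :
    leg w A f ≤ leg w' A' g := fun s e => by
  simp only [leg_apply]
  refine ENNReal.tsum_le_tsum fun t => ?_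
  by_cases hA : A s e t
  · rw [if_pos hA, if_pos (h s e t hA).1]
    exact mul_le_mul' (h s e t hA).2 (turn_mono hfg _ _)
  · simp [hA]

theorem leg_mono {w : ℕ → ℝ≥0∞} {A : (Fin 2 → ℤ) → Direction 2 → ℕ → Prop} {f g : Obs}
    (hfg : f ≤ g) : leg w A f ≤ leg w A g :=
  leg_mono' (fun _ _ _ h => ⟨h, le_rfl⟩) hfg

theorem leg_le_free (w : ℕ → ℝ≥0∞) (A : (Fin 2 → ℤ) → Direction 2 → ℕ → Prop) (f : Obs) :
    leg w A f ≤ free w f :=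
  leg_mono' (fun _ _ _ _ => ⟨trivial, le_rfl⟩) le_rfl

theorem leg_pow_mono {w : ℕ → ℝ≥0∞} {A : (Fin 2 → ℤ) → Direction 2 → ℕ → Prop} (n : ℕ)
    {f g : Obs} (hfg : f ≤ g) : (leg w A ^ n) f ≤ (leg w A ^ n) g := by
  induction n with
  | zero => simpa using hfg
  | succ n ih =>
    rw [pow_succ', Module.End.mul_apply, Module.End.mul_apply]
    exact leg_mono ih

theorem leg_split {w : ℕ → ℝ≥0∞} {A B C : (Fin 2 → ℤ) → Direction 2 → ℕ → Prop}
    (h : ∀ s e t, A s e t ↔ B s e t ∨ C s e t) (h' : ∀ s e t, B s e t → ¬ C s e t) :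
    leg w A = leg w B + leg w C := by
  refine LinearMap.ext fun f => ?_
  funext s e
  simp only [leg_apply, LinearMap.add_apply, Pi.add_apply]
  rw [← ENNReal.tsum_add]
  refine tsum_congr fun t => ?_
  rw [← add_mul]
  congr 1
  have h1 := h s e t
  have h2 := h' s e t
  by_cases hB : B s e t <;> by_cases hC : C s e t <;> simp_all

theorem leg_one (w : ℕ → ℝ≥0∞) (A : (Fin 2 → ℤ) → Direction 2 → ℕ → Prop) (s : Fin 2 → ℤ)
    (e : Direction 2) [DecidablePred (A s e)] :
    leg w A 1 s e = ∑' t, if A s e t then w t else 0 := by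
  rw [leg_apply, turn_one]
  refine tsum_congr fun t => ?_
  simp

theorem free_const {w : ℕ → ℝ≥0∞} (hw : ∑' t, w t = 1) (c : ℝ≥0∞) :
    free w (fun _ _ => c) = fun _ _ => c := by
  funext s e
  rw [free_apply]
  simp only [turn_const]
  rw [ENNReal.tsum_mul_right, hw, one_mul]

theorem free_one {w : ℕ → ℝ≥0∞} (hw : ∑' t, w t = 1) : free w 1 = 1 := free_const hw 1

theorem leg_le_const {w : ℕ → ℝ≥0∞} (hw : ∑' t, w t = 1)
    (A : (Fin 2 → ℤ) → Direction 2 → ℕ → Prop) {f : Obs} {c : ℝ≥0∞} (hf : ∀ s e, f s e ≤ c)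
    (s : Fin 2 → ℤ) (e : Direction 2) : leg w A f s e ≤ c := by
  refine (leg_mono (g := fun _ _ => c) hf s e).trans ((leg_le_free w A _ s e).trans ?_)
  rw [free_const hw]

theorem leg_pow_le_const {w : ℕ → ℝ≥0∞} (hw : ∑' t, w t = 1)
    (A : (Fin 2 → ℤ) → Direction 2 → ℕ → Prop) {f : Obs} {c : ℝ≥0∞} (hf : ∀ s e, f s e ≤ c)
    (n : ℕ) (s : Fin 2 → ℤ) (e : Direction 2) : (leg w A ^ n) f s e ≤ c := by
  induction n generalizing s e with
  | zero => simpa using hf s e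
  | succ n ih =>
    rw [pow_succ', Module.End.mul_apply]
    exact leg_le_const hw A ih s e

/-- A lower bound for one leg, through a single waiting time and a single next direction. -/
theorem mul_third_le_free (w : ℕ → ℝ≥0∞) (f : Obs) (s : Fin 2 → ℤ) {e e' : Direction 2}
    (h : e' ≠ e) (t : ℕ) : w t * (3⁻¹ * f (s + t • e.vec) e') ≤ free w f s e := by
  rw [free_apply]
  exact (mul_le_mul_right (third_mul_le_turn f _ h) _).trans
    (ENNReal.le_tsum (f := fun t => w t * turn f (s + t • e.vec) e) t)

/-! ### Translations -/

/-- Translation by `u`. -/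
def shift (u : Fin 2 → ℤ) : Module.End ℝ≥0∞ Obs where
  toFun f s e := f (s + u) e
  map_add' _ _ := rfl
  map_smul' _ _ := rfl

theorem shift_apply (u : Fin 2 → ℤ) (f : Obs) (s : Fin 2 → ℤ) (e : Direction 2) :
    shift u f s e = f (s + u) e := rfl

/-- The hypothesis `hA` expresses that the restriction does not depend on the position; the legs are
then translation invariant. -/
theorem leg_shift {w : ℕ → ℝ≥0∞} {A : (Fin 2 → ℤ) → Direction 2 → ℕ → Prop}
    (hA : ∀ s s' e t, A s e t → A s' e t) (u : Fin 2 → ℤ) :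
    Commute (leg w A) (shift u) := by
  refine LinearMap.ext fun f => ?_
  funext s e
  simp only [Module.End.mul_apply, leg_apply, shift_apply]
  refine tsum_congr fun t => ?_
  have h : A s e t ↔ A (s + u) e t := ⟨hA _ _ _ _, hA _ _ _ _⟩
  by_cases hB : A s e t
  · simp only [if_pos hB, if_pos (h.1 hB), turn_apply, shift_apply, add_right_comm]
  · simp only [if_neg hB, if_neg (mt h.2 hB), zero_mul]

theorem shift_mono (u : Fin 2 → ℤ) {f g : Obs} (h : f ≤ g) : shift u f ≤ shift u g :=
  fun s e => h (s + u) e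

/-! ### Occupation functionals -/

/-- Expected value of `∑ n < N, f (S n, D n)`, as a function of the initial state, where the legs
are weighted and restricted as in `leg w A`. -/
noncomputable def occ (w : ℕ → ℝ≥0∞) (A : (Fin 2 → ℤ) → Direction 2 → ℕ → Prop) (N : ℕ) :
    Module.End ℝ≥0∞ Obs :=
  ∑ n ∈ Finset.range N, leg w A ^ n

section Legs

variable {w : ℕ → ℝ≥0∞} {A : (Fin 2 → ℤ) → Direction 2 → ℕ → Prop}

theorem occ_zero : occ w A 0 = 0 := by simp [occ]

theorem occ_succ (N : ℕ) : occ w A (N + 1) = 1 + leg w A * occ w A N := by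
  rw [occ, Finset.sum_range_succ', add_comm, pow_zero, occ, Finset.mul_sum]
  simp only [pow_succ']

theorem occ_succ_apply (N : ℕ) (f : Obs) :
    occ w A (N + 1) f = f + leg w A (occ w A N f) := by
  rw [occ_succ]; rfl

theorem occ_free_succ (N : ℕ) (f : Obs) : occ w (fun _ _ _ => True) (N + 1) f =
    f + free w (occ w (fun _ _ _ => True) N f) := occ_succ_apply N f

theorem occ_add (M N : ℕ) : occ w A (M + N) = occ w A M + leg w A ^ M * occ w A N := by
  rw [occ, Finset.sum_range_add, occ, occ, Finset.mul_sum]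
  simp only [pow_add]

theorem occ_apply (N : ℕ) (f : Obs) (s : Fin 2 → ℤ) (e : Direction 2) :
    occ w A N f s e = ∑ n ∈ Finset.range N, (leg w A ^ n) f s e := by
  simp only [occ, LinearMap.sum_apply, Finset.sum_apply]

theorem occ_mono_right (N : ℕ) {f g : Obs} (h : f ≤ g) : occ w A N f ≤ occ w A N g :=
  fun s e => by
    simp only [occ_apply]
    exact Finset.sum_le_sum fun n _ => leg_pow_mono n h s e

theorem occ_mono_left {M N : ℕ} (h : M ≤ N) (f : Obs) : occ w A M f ≤ occ w A N f :=
  fun s e => by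
    simp only [occ_apply]
    exact Finset.sum_le_sum_of_subset (Finset.range_mono h)

theorem commute_occ {T : Module.End ℝ≥0∞ Obs} (h : Commute (leg w A) T) (N : ℕ) :
    Commute (occ w A N) T :=
  Commute.sum_left _ _ _ fun n _ => h.pow_left n

theorem occ_ind_le (hw : ∑' t, w t = 1) (B : Set (Fin 2 → ℤ)) (N : ℕ) (s : Fin 2 → ℤ)
    (e : Direction 2) : occ w A N (ind B) s e ≤ N := by
  rw [occ_apply]
  refine (Finset.sum_le_card_nsmul _ _ 1 fun n _ =>
    leg_pow_le_const hw A (fun s e => ind_le_one B s e) n s e).trans ?_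
  simp

/-- The occupation of a long time interval, cut into blocks. -/
theorem occ_mul_le (hw : ∑' t, w t = 1) {N : ℕ} {f : Obs} {c : ℝ≥0∞}
    (h : ∀ s e, occ w A N f s e ≤ c) (M : ℕ) (s : Fin 2 → ℤ) (e : Direction 2) :
    occ w A (M * N) f s e ≤ M * c := by
  induction M with
  | zero => simp [occ_zero]
  | succ M ih =>
    rw [Nat.succ_mul, occ_add, LinearMap.add_apply, Module.End.mul_apply, Nat.cast_succ, add_mul,
      one_mul]
    exact add_le_add ih (leg_pow_le_const hw A h _ s e)

/-! ### Boxes -/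

/-- The closed ball of radius `r` around the origin in the maximum norm. -/
def box (r : ℤ) : Set (Fin 2 → ℤ) := {s | |s 0| ≤ r ∧ |s 1| ≤ r}

/-- The square with lower left corner `u` and side length `r`. -/
def cell (u : Fin 2 → ℤ) (r : ℤ) : Set (Fin 2 → ℤ) :=
  {s | (u 0 ≤ s 0 ∧ s 0 ≤ u 0 + r) ∧ (u 1 ≤ s 1 ∧ s 1 ≤ u 1 + r)}

/-- Expected occupation of the box of radius `r` by the walk with `N` legs which starts at the
origin, summed over the initial directions. -/
noncomputable def green (w : ℕ → ℝ≥0∞) (r : ℤ) (N : ℕ) : ℝ≥0∞ :=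
  ∑ e, occ w (fun _ _ _ => True) N (ind (box r)) 0 e

theorem green_mono (w : ℕ → ℝ≥0∞) (r : ℤ) {M N : ℕ} (h : M ≤ N) : green w r M ≤ green w r N :=
  Finset.sum_le_sum fun e _ => occ_mono_left h _ 0 e

theorem green_succ_le (hw : ∑' t, w t = 1) (r : ℤ) (N : ℕ) :
    green w r (N + 1) ≤ green w r N + 4 := by
  have h : ∀ e : Direction 2, occ w (fun _ _ _ => True) (N + 1) (ind (box r)) 0 e ≤
      occ w (fun _ _ _ => True) N (ind (box r)) 0 e + 1 := fun e => by
    rw [occ_apply, Finset.sum_range_succ, ← occ_apply]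
    gcongr
    exact leg_pow_le_const hw _ (fun s e => ind_le_one _ s e) N 0 e
  refine (Finset.sum_le_sum fun e _ => h e).trans ?_
  rw [Finset.sum_add_distrib, green]
  simp only [Finset.sum_const, Finset.card_univ, Fintype.card_prod, Fintype.card_fin,
    Fintype.card_bool, nsmul_eq_mul, mul_one]
  norm_num

theorem free_shift (w : ℕ → ℝ≥0∞) (u : Fin 2 → ℤ) : Commute (free w) (shift u) :=
  leg_shift (fun _ _ _ _ h => h) u

/-- The occupation of a cell, from any initial state, is at most that of a box around the start. -/
theorem occ_cell_le_green (hw : ∑' t, w t = 1) (u : Fin 2 → ℤ) (r : ℤ) (N : ℕ) (s : Fin 2 → ℤ)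
    (e : Direction 2) :
    occ w (fun _ _ _ => True) N (ind (cell u r)) s e ≤ green w r N := by
  induction N generalizing s e with
  | zero => simp [occ_zero]
  | succ N ih =>
    -- First entrance: until the walk is in the cell nothing is counted, and a shorter horizon only
    -- lowers the bound. From a point of the cell, the whole cell lies in the box of radius `r`
    -- around that point.
    by_cases hs : s ∈ cell u r
    · have h1 : ind (cell u r) ≤ shift (-s) (ind (box r)) := by
        intro y e'
        by_cases hy : y ∈ cell u r
        · rw [shift_apply, ind_of_mem hy, ind_of_mem]
          simp only [cell, box, Set.mem_ofPred_eq, abs_le, Pi.add_apply, Pi.neg_apply] at *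
          omega
        · rw [ind_of_notMem hy]; exact zero_le
      refine (occ_mono_right _ h1 s e).trans ?_
      have h2 := LinearMap.congr_fun (commute_occ (free_shift w (-s)) (N + 1)).eq (ind (box r))
      rw [Module.End.mul_apply, Module.End.mul_apply] at h2
      rw [h2, shift_apply, add_neg_cancel]
      exact Finset.single_le_sum
        (f := fun e => occ w (fun _ _ _ => True) (N + 1) (ind (box r)) 0 e)
        (fun _ _ => zero_le) (Finset.mem_univ e)
    · rw [occ_succ_apply, Pi.add_apply, Pi.add_apply, ind_of_notMem hs, zero_add]
      exact (leg_le_const hw _ ih s e).trans (green_mono w r N.le_succ)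

/-- A box of radius `m * r` is covered by `(2 * m) ^ 2` cells of side length `r`. -/
theorem occ_box_le_green (hw : ∑' t, w t = 1) (x : Fin 2 → ℤ) {r : ℤ} (hr : 0 < r) (m : ℕ)
    (hm : 0 < m) (N : ℕ) (s : Fin 2 → ℤ) (e : Direction 2) :
    occ w (fun _ _ _ => True) N (shift x (ind (box (m * r)))) s e ≤
      ((2 * m) ^ 2 : ℕ) * green w r N := by
  set I : Finset ℤ := Finset.Ico (-(m : ℤ)) m
  have hI : I.card = 2 * m := by simp [I]; omega
  have hcov : ∀ z : ℤ, |z| ≤ m * r → ∃ i ∈ I, i * r ≤ z ∧ z ≤ i * r + r := by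
    intro z hz
    rw [abs_le] at hz
    -- The right end point `m * r` would have index `m`, outside the half-open range of indices; it
    -- is assigned to the last cell.
    by_cases hz' : z = m * r
    · refine ⟨m - 1, by simp [I]; omega, ?_, ?_⟩ <;> rw [hz'] <;> nlinarith
    · refine ⟨z / r, ?_, Int.ediv_mul_le z hr.ne', (Int.lt_ediv_add_one_mul_self z hr).le.trans
        (by rw [add_mul, one_mul])⟩
      simp only [I, Finset.mem_Ico]
      exact ⟨(Int.le_ediv_iff_mul_le hr).2 (by linarith [hz.1]),
        (Int.ediv_lt_iff_lt_mul hr).2 (lt_of_le_of_ne hz.2 hz')⟩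
  have h1 : shift x (ind (box (m * r))) ≤
      ∑ p ∈ I ×ˢ I, ind (cell (![p.1 * r, p.2 * r] - x) r) := by
    intro y e'
    rw [shift_apply]
    by_cases hy : y + x ∈ box (m * r)
    · obtain ⟨i, hi, hi1, hi2⟩ := hcov _ hy.1
      obtain ⟨j, hj, hj1, hj2⟩ := hcov _ hy.2
      rw [Finset.sum_apply, Finset.sum_apply, ind_of_mem hy]
      refine le_trans ?_ (Finset.single_le_sum
        (f := fun p : ℤ × ℤ => ind (cell (![p.1 * r, p.2 * r] - x) r) y e')
        (fun _ _ => zero_le) (Finset.mk_mem_product hi hj))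
      rw [ind_of_mem]
      simp only [Pi.add_apply] at hi1 hi2 hj1 hj2
      simp only [cell, Set.mem_ofPred_eq, Pi.sub_apply, Matrix.cons_val_zero, Matrix.cons_val_one]
      refine ⟨⟨?_, ?_⟩, ?_, ?_⟩ <;> linarith
    · rw [ind_of_notMem hy]; exact zero_le
  refine (occ_mono_right N h1 s e).trans ?_
  rw [map_sum, Finset.sum_apply, Finset.sum_apply]
  refine (Finset.sum_le_card_nsmul _ _ _ fun p _ => occ_cell_le_green hw _ r N s e).trans ?_
  rw [Finset.card_product, hI, nsmul_eq_mul, sq]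

end Legs

/-! ### Hitting probabilities -/

section Hitting

variable {w : ℕ → ℝ≥0∞} {A : (Fin 2 → ℤ) → Direction 2 → ℕ → Prop}

/-- The probability that one of the first `N` legs satisfies `A`. -/
noncomputable def hit (w : ℕ → ℝ≥0∞) (A : (Fin 2 → ℤ) → Direction 2 → ℕ → Prop) (N : ℕ) : Obs :=
  occ w (fun s e t => ¬ A s e t) N (leg w A 1)

theorem free_eq_add (w : ℕ → ℝ≥0∞) (A : (Fin 2 → ℤ) → Direction 2 → ℕ → Prop) :
    free w = leg w A + leg w (fun s e t => ¬ A s e t) :=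
  leg_split (fun _ _ _ => by tauto) (fun _ _ _ => by tauto)

theorem hit_zero : hit w A 0 = 0 := by simp [hit, occ_zero]

theorem hit_succ (N : ℕ) :
    hit w A (N + 1) = leg w A 1 + leg w (fun s e t => ¬ A s e t) (hit w A N) := by
  rw [hit, occ_succ_apply, hit]

theorem hit_add_avoid (hw : ∑' t, w t = 1) (N : ℕ) :
    hit w A N + (leg w (fun s e t => ¬ A s e t) ^ N) 1 = 1 := by
  induction N with
  | zero => simp [hit_zero]
  | succ N ih =>
    rw [hit_succ, pow_succ', Module.End.mul_apply, add_assoc, ← map_add, ih, ← LinearMap.add_apply,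
      ← free_eq_add, free_one hw]

theorem hit_le_one (hw : ∑' t, w t = 1) (N : ℕ) : hit w A N ≤ 1 := by
  rw [← hit_add_avoid (A := A) hw N]
  exact le_self_add

/-- On a first leg which satisfies `A` the hitting has already occurred; on any other leg both sides
continue alike. -/
theorem free_hit_le (hw : ∑' t, w t = 1) (N : ℕ) : free w (hit w A N) ≤ hit w A (N + 1) := by
  rw [hit_succ, free_eq_add w A, LinearMap.add_apply]
  gcongr
  exact leg_mono (hit_le_one hw N)

/-- If from every point of `B` the next `m` legs hit with probability at least `η`, then the
expected number of legs which start in `B` before the hitting is at most `m / η`. -/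
theorem mul_occ_avoid_le (hw : ∑' t, w t = 1) {B : Set (Fin 2 → ℤ)} {η : ℝ≥0∞} {m : ℕ}
    (hB : ∀ s ∈ B, ∀ e, η ≤ hit w A m s e) (N : ℕ) (s : Fin 2 → ℤ) (e : Direction 2) :
    η * occ w (fun s e t => ¬ A s e t) N (ind B) s e ≤ m := by
  have h1 : η • ind B ≤ hit w A m := fun s e => by
    by_cases hs : s ∈ B
    · rw [Pi.smul_apply, Pi.smul_apply, ind_of_mem hs, smul_eq_mul, mul_one]
      exact hB s hs e
    · simp [ind_of_notMem hs]
  have h2 := occ_mono_right (w := w) (A := fun s e t => ¬ A s e t) N h1 s e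
  rw [map_smul, Pi.smul_apply, Pi.smul_apply, smul_eq_mul] at h2
  refine h2.trans ?_
  -- Both occupation operators are polynomials in the same operator. Exchanging them turns the
  -- occupation of N legs by `hit w A m` into that of m legs by `hit w A N`, which is at most 1.
  have h3 : Commute (occ w (fun s e t => ¬ A s e t) N) (occ w (fun s e t => ¬ A s e t) m) :=
    commute_occ (commute_occ (Commute.refl _) m).symm N
  have h4 := LinearMap.congr_fun h3.eq (leg w A 1)
  rw [Module.End.mul_apply, Module.End.mul_apply] at h4
  rw [hit, h4, occ_apply]
  refine (Finset.sum_le_card_nsmul _ _ 1 fun n _ =>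
    leg_pow_le_const hw _ (fun s e => hit_le_one (A := A) hw N s e) n s e).trans ?_
  simp

/-- Decomposition at the first leg which satisfies `A`: what is collected after it is at most `c`,
by the bound valid from every state. -/
theorem occ_free_le {f : Obs} {N : ℕ} {c : ℝ≥0∞}
    (hc : ∀ s e, occ w (fun _ _ _ => True) N f s e ≤ c) :
    occ w (fun _ _ _ => True) N f ≤ occ w (fun s e t => ¬ A s e t) N f + c • hit w A N := by
  suffices h : ∀ n ≤ N, occ w (fun _ _ _ => True) n f ≤
      occ w (fun s e t => ¬ A s e t) n f + c • hit w A n from h N le_rfl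
  intro n hn
  induction n with
  | zero => simp [occ_zero]
  | succ n ih =>
    have h1 : occ w (fun _ _ _ => True) n f ≤ c • (1 : Obs) := fun s e => by
      rw [Pi.smul_apply, Pi.smul_apply, Pi.one_apply, Pi.one_apply, smul_eq_mul, mul_one]
      exact (occ_mono_left (by omega) f s e).trans (hc s e)
    rw [occ_free_succ, occ_succ_apply, hit_succ, free_eq_add w A, LinearMap.add_apply]
    calc f + (leg w A (occ w (fun _ _ _ => True) n f) +
          leg w (fun s e t => ¬ A s e t) (occ w (fun _ _ _ => True) n f))
        ≤ f + (leg w A (c • (1 : Obs)) + leg w (fun s e t => ¬ A s e t)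
          (occ w (fun s e t => ¬ A s e t) n f + c • hit w A n)) :=
          add_le_add le_rfl (add_le_add (leg_mono h1) (leg_mono (ih (by omega))))
      _ = _ := by
        rw [map_smul, map_add, map_smul, smul_add]
        abel

/-- A probability is at most the expected number of occurrences, here of legs which start in `B`. -/
theorem hit_le_occ (hw : ∑' t, w t = 1) {B : Set (Fin 2 → ℤ)} (hA : ∀ s e t, A s e t → s ∈ B)
    (N : ℕ) : hit w A N ≤ occ w (fun _ _ _ => True) N (ind B) := by
  induction N with
  | zero => simp [hit_zero]
  | succ N ih =>
    rw [hit_succ, occ_succ_apply]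
    refine add_le_add (fun s e => ?_) ((leg_le_free _ _ _).trans (leg_mono ih))
    by_cases hs : s ∈ B
    · rw [ind_of_mem hs]
      exact leg_le_const hw A (fun _ _ => le_rfl) s e
    · rw [leg_apply, ENNReal.tsum_eq_zero.2]
      · exact zero_le
      · intro t
        rw [if_neg fun h => hs (hA s e t h), zero_mul]

end Hitting

/-! ### Comparison of waiting time laws -/

theorem pow_mul_free_pow_le {w w' : ℕ → ℝ≥0∞} {ρ : ℝ≥0∞} (h : ∀ t, ρ * w' t ≤ w t) (f : Obs)
    (n : ℕ) : ρ ^ n • (free w' ^ n) f ≤ (free w ^ n) f := by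
  induction n with
  | zero => simp
  | succ n ih =>
    rw [pow_succ' (free w), pow_succ' (free w'), Module.End.mul_apply, Module.End.mul_apply]
    refine le_trans ?_ (leg_mono ih)
    rw [map_smul, pow_succ, mul_smul]
    gcongr
    intro s e
    rw [Pi.smul_apply, Pi.smul_apply, smul_eq_mul, free_apply, free_apply, ← ENNReal.tsum_mul_left]
    simp only [← mul_assoc]
    exact ENNReal.tsum_le_tsum fun t => mul_le_mul_left (h t) _

theorem pow_mul_green_le {w w' : ℕ → ℝ≥0∞} {ρ : ℝ≥0∞} (hρ : ρ ≤ 1) (h : ∀ t, ρ * w' t ≤ w t)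
    (r : ℤ) (N : ℕ) : ρ ^ N * green w' r N ≤ green w r N := by
  rw [green, Finset.mul_sum]
  refine Finset.sum_le_sum fun e _ => ?_
  rw [occ_apply, occ_apply, Finset.mul_sum]
  refine Finset.sum_le_sum fun n hn => ?_
  refine le_trans ?_ (pow_mul_free_pow_le h _ n 0 e)
  rw [Pi.smul_apply, Pi.smul_apply, smul_eq_mul]
  gcongr ?_ * _
  exact pow_le_pow_right_of_le_one' hρ (Finset.mem_range.1 hn).le

/-- Sum over a half line in direction `v`. -/
noncomputable def lineSum (v : Fin 2 → ℤ) (f : Obs) : Obs := fun s e => ∑' t : ℕ, f (s + t • v) e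

theorem turn_lineSum (v : Fin 2 → ℤ) (f : Obs) : turn (lineSum v f) = lineSum v (turn f) := by
  funext s e
  simp only [turn_apply, lineSum]
  rw [ENNReal.tsum_mul_left, Summable.tsum_finsetSum fun _ _ => ENNReal.summable]
  congr 1
  refine Finset.sum_congr rfl fun e' _ => ?_
  split_ifs <;> simp

theorem free_lineSum (w : ℕ → ℝ≥0∞) (v : Fin 2 → ℤ) (f : Obs) :
    free w (lineSum v f) = lineSum v (free w f) := by
  funext s e
  rw [free_apply, turn_lineSum]
  simp only [lineSum, free_apply, ← ENNReal.tsum_mul_left]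
  rw [ENNReal.tsum_comm]
  simp only [add_right_comm]

theorem free_pow_lineSum (w : ℕ → ℝ≥0∞) (v : Fin 2 → ℤ) (f : Obs) (n : ℕ) :
    (free w ^ n) (lineSum v f) = lineSum v ((free w ^ n) f) := by
  induction n with
  | zero => rfl
  | succ n ih =>
    rw [pow_succ', Module.End.mul_apply, Module.End.mul_apply, ih, free_lineSum]

/-- Along the half line the coordinate on the axis of `e` is injective, and in the box it takes at
most `2 * r + 1` values. -/
theorem lineSum_box_le (e : Direction 2) (r : ℕ) (s : Fin 2 → ℤ) (e' : Direction 2) :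
    lineSum e.vec (ind (box r)) s e' ≤ (2 * r + 1 : ℕ) := by
  obtain ⟨i, b⟩ := e
  set σ : ℤ := if b then 1 else -1
  have hσ : σ ≠ 0 := by simp only [σ]; split_ifs <;> norm_num
  have hinj : Function.Injective fun t : ℕ => s i + t * σ := fun t t' h => by
    have := mul_right_cancel₀ hσ (add_left_cancel h)
    exact_mod_cast this
  have h1 : ∀ t : ℕ, ind (box r) (s + t • (Direction.vec (i, b))) e' ≤
      ((Finset.Icc (-(r : ℤ)) r : Finset ℤ) : Set ℤ).indicator (1 : ℤ → ℝ≥0∞) (s i + t * σ) := by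
    intro t
    by_cases ht : s + t • (Direction.vec (i, b)) ∈ box r
    · rw [ind_of_mem ht, Set.indicator_of_mem, Pi.one_apply]
      have h2 : (s + t • (Direction.vec (i, b))) i = s i + t * σ := by
        simp [Direction.vec, σ]
      have h3 : |(s + t • (Direction.vec (i, b))) i| ≤ r := by
        fin_cases i
        · exact ht.1
        · exact ht.2
      rw [h2, abs_le] at h3
      simpa using h3
    · rw [ind_of_notMem ht]; exact zero_le
  calc lineSum (Direction.vec (i, b)) (ind (box r)) s e'
      ≤ ∑' t : ℕ, ((Finset.Icc (-(r : ℤ)) r : Finset ℤ) : Set ℤ).indicator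
          (1 : ℤ → ℝ≥0∞) (s i + t * σ) := ENNReal.tsum_le_tsum h1
    _ ≤ ∑' z : ℤ, ((Finset.Icc (-(r : ℤ)) r : Finset ℤ) : Set ℤ).indicator (1 : ℤ → ℝ≥0∞) z :=
        ENNReal.tsum_comp_le_tsum_of_injective hinj _
    _ = (2 * r + 1 : ℕ) := by
        rw [tsum_eq_sum (s := Finset.Icc (-(r : ℤ)) r), Finset.sum_congr rfl (g := fun _ => 1)]
        · simp only [Finset.sum_const, Int.card_Icc, nsmul_eq_mul, mul_one]
          congr 1
          omega
        · intro z hz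
          rw [Set.indicator_of_mem (by exact_mod_cast hz), Pi.one_apply]
        · intro z hz
          exact Set.indicator_of_notMem (by exact_mod_cast hz) _

/-- Summation over a half line commutes with the transition operator, so each of the `N` legs
contributes at most what the half line has in the box. -/
theorem lineSum_occ_box_le {w : ℕ → ℝ≥0∞} (hw : ∑' t, w t = 1) (e : Direction 2) (r N : ℕ)
    (s : Fin 2 → ℤ) (e' : Direction 2) :
    lineSum e.vec (occ w (fun _ _ _ => True) N (ind (box r))) s e' ≤ N * (2 * r + 1 : ℕ) := by
  have h : lineSum e.vec (occ w (fun _ _ _ => True) N (ind (box r))) s e' =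
      ∑ n ∈ Finset.range N, (free w ^ n) (lineSum e.vec (ind (box r))) s e' := by
    simp only [free_pow_lineSum]
    simp only [lineSum, occ_apply]
    rw [Summable.tsum_finsetSum fun _ _ => ENNReal.summable]
  rw [h]
  refine (Finset.sum_le_card_nsmul _ _ _ fun n _ =>
    leg_pow_le_const hw _ (lineSum_box_le e r) n s e').trans ?_
  rw [Finset.card_range, nsmul_eq_mul]

/-- Rare long legs with spread out lengths hardly increase the occupation of a box. -/
theorem occ_box_le_add {w w' : ℕ → ℝ≥0∞} (hw : ∑' t, w t = 1) (hw' : ∑' t, w' t = 1) {L : ℕ}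
    {d : ℝ≥0∞} (hL : ∀ t ≤ L, w t ≤ w' t) (hd : ∀ t, L < t → w t ≤ d) (r N : ℕ)
    (s : Fin 2 → ℤ) (e : Direction 2) :
    occ w (fun _ _ _ => True) N (ind (box r)) s e ≤
      occ w' (fun _ _ _ => True) N (ind (box r)) s e + N * (d * (N * (2 * r + 1 : ℕ))) := by
  set f := ind (box r)
  set c : ℝ≥0∞ := d * (N * (2 * r + 1 : ℕ)) with hc
  -- After a long first leg, each end point carries weight at most `d`; replacing the weights by `d`
  -- leaves a half-line sum of the remaining occupation.
  have hbig : ∀ n ≤ N, ∀ s e,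
      leg w (fun _ _ t => L < t) (occ w (fun _ _ _ => True) n f) s e ≤ c := by
    intro n hn s e
    rw [leg_apply]
    refine (ENNReal.tsum_le_tsum (g := fun t : ℕ => d * turn (occ w (fun _ _ _ => True) n f)
      (s + t • e.vec) e) fun t => mul_le_mul_left ?_ _).trans ?_
    · split_ifs with h
      · exact hd t h
      · exact zero_le
    calc ∑' t : ℕ, d * turn (occ w (fun _ _ _ => True) n f) (s + t • e.vec) e
        = d * turn (lineSum e.vec (occ w (fun _ _ _ => True) n f)) s e := by
          rw [turn_lineSum, ENNReal.tsum_mul_left]; rfl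
      _ ≤ d * turn (fun _ _ => (N * (2 * r + 1 : ℕ) : ℝ≥0∞)) s e := by
          gcongr
          refine turn_mono (fun s e' => (lineSum_occ_box_le hw e r n s e').trans ?_) s e
          gcongr
      _ = c := by rw [turn_const]
  -- Each leg adds an error of at most `c`: the short first legs are dominated by `w'`, the long
  -- ones by `hbig`.
  suffices h : ∀ n ≤ N, ∀ s e, occ w (fun _ _ _ => True) n f s e ≤
      occ w' (fun _ _ _ => True) n f s e + n * c from h N le_rfl s e
  intro n hn
  induction n with
  | zero => simp [occ_zero]
  | succ n ih =>
    intro s e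
    have h1 : free w = leg w (fun _ _ t => t ≤ L) + leg w (fun _ _ t => L < t) :=
      leg_split (fun _ _ t => by simp [le_or_gt]) (fun _ _ t h => by simpa using h)
    have h2 : leg w (fun _ _ t => t ≤ L) (occ w (fun _ _ _ => True) n f) s e ≤
        free w' (occ w' (fun _ _ _ => True) n f) s e + n * c := by
      refine (leg_mono' (w' := w') (A' := fun _ _ _ => True)
        (g := occ w' (fun _ _ _ => True) n f + fun _ _ => n * c) (fun _ _ t h => ⟨trivial, hL t h⟩)
        (fun s e => ih (by omega) s e) s e).trans ?_
      rw [map_add, Pi.add_apply, Pi.add_apply, free_const hw']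
    rw [occ_free_succ, occ_free_succ, h1, LinearMap.add_apply]
    simp only [Pi.add_apply]
    rw [Nat.cast_succ, add_mul, one_mul, add_assoc, ← add_assoc _ _ c]
    exact add_le_add le_rfl (add_le_add h2 (hbig n (by omega) s e))

/-- The walk stays in a box unless it makes a long leg. -/
theorem free_pow_compl_box_le {w : ℕ → ℝ≥0∞} (hw : ∑' t, w t = 1) {L : ℕ} {q : ℝ≥0∞}
    (hq : ∑' t, (if L < t then w t else 0) ≤ q) (n : ℕ) (r : ℤ) (s : Fin 2 → ℤ) (hs : s ∈ box r)
    (e : Direction 2) : (free w ^ n) (ind (box (r + n * L))ᶜ) s e ≤ n * q := by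
  induction n generalizing r s e with
  | zero =>
    rw [pow_zero, Module.End.one_apply, ind_of_notMem]
    · exact zero_le
    · simpa using hs
  | succ n ih =>
    rw [pow_succ', Module.End.mul_apply, free_apply]
    have hr : r + ((n + 1 : ℕ) : ℤ) * L = (r + L) + n * L := by push_cast; ring
    rw [hr]
    set g := (free w ^ n) (ind (box ((r + L) + n * L))ᶜ)
    have hg : ∀ s e, g s e ≤ 1 := leg_pow_le_const hw _ (fun s e => ind_le_one _ s e) n
    -- A long first leg costs its own weight. A short one stays in the box enlarged by `L`, where
    -- the induction hypothesis applies.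
    have h1 : ∀ t : ℕ, w t * turn g (s + t • e.vec) e ≤
        w t * (n * q) + (if L < t then w t else 0) := by
      intro t
      by_cases ht : L < t
      · rw [if_pos ht]
        refine le_add_left ?_
        calc w t * turn g (s + t • e.vec) e ≤ w t * turn 1 (s + t • e.vec) e := by
              gcongr
              exact turn_mono (fun s e => hg s e) _ _
          _ = w t := by rw [turn_one]; simp
      · rw [if_neg ht, add_zero]
        gcongr
        have hmem : s + t • e.vec ∈ box (r + L) := by
          have htL : (t : ℤ) ≤ L := by exact_mod_cast not_lt.1 ht
          have h0 : ∀ i, |(t • e.vec) i| ≤ L := by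
            intro i
            have ht0 : |(t : ℤ)| ≤ L := by rwa [abs_of_nonneg (by positivity)]
            obtain ⟨j, b⟩ := e
            rw [Pi.smul_apply, Direction.vec, nsmul_eq_mul]
            by_cases hij : i = j
            · subst hij
              rw [Pi.single_eq_same]
              cases b <;> simpa using htL
            · rw [Pi.single_eq_of_ne hij]; simp
          refine ⟨(abs_add_le _ _).trans (add_le_add hs.1 (h0 0)),
            (abs_add_le _ _).trans (add_le_add hs.2 (h0 1))⟩
        rw [turn_apply]
        have h2 := turn_const (n * q) (s + t • e.vec) e
        rw [turn_apply] at h2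
        rw [← h2]
        gcongr with e' _
        split_ifs
        · exact le_rfl
        · exact ih _ _ hmem e'
    calc ∑' t : ℕ, w t * turn g (s + t • e.vec) e
        ≤ ∑' t : ℕ, (w t * (n * q) + (if L < t then w t else 0)) := ENNReal.tsum_le_tsum h1
      _ ≤ n * q + q := by
        rw [ENNReal.tsum_add, ENNReal.tsum_mul_right, hw, one_mul]
        gcongr
      _ = _ := by push_cast; ring


/-! ### Passing through the origin -/

/-- The leg of length `t` from `s` in direction `e` passes through the origin before its end. -/
def Crosses (s : Fin 2 → ℤ) (e : Direction 2) (t : ℕ) : Prop := ∃ j < t, s + j • e.vec = 0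

section Crossing

variable {w : ℕ → ℝ≥0∞}

theorem mul_third_hit_le {A : (Fin 2 → ℤ) → Direction 2 → ℕ → Prop} (hw : ∑' t, w t = 1)
    (s : Fin 2 → ℤ) {e e' : Direction 2} (h : e' ≠ e) (t n : ℕ) {x y : ℝ≥0∞} (hx : x ≤ w t)
    (hy : y ≤ hit w A n (s + t • e.vec) e') : x * (3⁻¹ * y) ≤ hit w A (n + 1) s e :=
  (mul_le_mul' hx (mul_le_mul_right hy _)).trans
    ((mul_third_le_free w _ s h t).trans (free_hit_le hw n s e))

/-- One explicit route: two legs of length 0 to adjust the direction, a leg of length |s 1| onto the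
line through the origin, and a leg longer than `R` towards the origin. The factors are the weights
of these legs and 1/3 for each of the three turns. -/
theorem le_hit_crosses (hw : ∑' t, w t = 1) (hw0 : 2⁻¹ ≤ w 0) {R : ℕ} {d q : ℝ≥0∞}
    (hd : ∀ t ≤ R, d ≤ w t) (hq : q ≤ ∑' t, if R < t then w t else 0) {s : Fin 2 → ℤ}
    (hs : s ∈ box R) (e : Direction 2) :
    2⁻¹ * (3⁻¹ * (2⁻¹ * (3⁻¹ * (d * (3⁻¹ * q))))) ≤ hit w Crosses 4 s e := by
  set v : Direction 2 := (1, decide (s 1 < 0)) with hv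
  set u : Direction 2 := (0, decide (s 0 < 0)) with hu
  -- A turn always changes the direction, so `v` cannot be reached in one turn if `e = v`. The
  -- detour through `f` works in every case.
  obtain ⟨f, hfe, hfv⟩ : ∃ f : Direction 2, f ≠ e ∧ f ≠ v :=
    (by decide : ∀ e v : Direction 2, ∃ f, f ≠ e ∧ f ≠ v) e v
  have huv : u ≠ v := by simp [hu, hv]
  set z : Fin 2 → ℤ := s + (s 1).natAbs • v.vec with hz
  have hz0 : z 0 = s 0 := by simp [hz, hv, Direction.vec]
  have hz1 : z 1 = 0 := by
    rw [hz, hv, Pi.add_apply, Pi.smul_apply, Direction.vec, Pi.single_eq_same, nsmul_eq_mul]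
    simp only [decide_eq_true_eq]
    split_ifs <;> omega
  have h1 : q ≤ hit w Crosses 1 z u := by
    classical
    rw [hit_succ, hit_zero, map_zero, add_zero, leg_one]
    refine hq.trans (ENNReal.tsum_le_tsum fun t => ?_)
    by_cases ht : R < t
    · rw [if_pos ht, if_pos]
      have hs0 := hs.1
      rw [Int.abs_eq_natAbs] at hs0
      refine ⟨(s 0).natAbs, by omega, ?_⟩
      ext i
      fin_cases i
      · rw [hu, Fin.zero_eta, Pi.add_apply, Pi.smul_apply, Direction.vec, Pi.single_eq_same,
          nsmul_eq_mul, hz0, Pi.zero_apply]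
        simp only [decide_eq_true_eq]
        split_ifs <;> omega
      · simp [hu, Direction.vec, hz1]
    · rw [if_neg ht]; exact zero_le
  have h2 : d * (3⁻¹ * q) ≤ hit w Crosses 2 s v :=
    mul_third_hit_le hw s huv (s 1).natAbs 1
      (hd _ (by have := hs.2; rw [Int.abs_eq_natAbs] at this; omega)) h1
  have h3 : 2⁻¹ * (3⁻¹ * (d * (3⁻¹ * q))) ≤ hit w Crosses 3 s f :=
    mul_third_hit_le hw s hfv.symm 0 2 hw0 (by simpa using h2)
  exact mul_third_hit_le hw s hfe 0 3 hw0 (by simpa using h3)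

/-- A leg of length 0 and a turn change `e` into any other direction at the cost of a factor 6 and
of one more leg; the sum over four directions gives 24. The box of radius `r` around `s` lies in the
box of radius `R`. -/
theorem green_le_occ (hw0 : 2⁻¹ ≤ w 0) {r R : ℤ} (hR : 2 * r ≤ R) (N : ℕ)
    {s : Fin 2 → ℤ} (hs : s ∈ box r) (e : Direction 2) :
    green w r N ≤ 24 * occ w (fun _ _ _ => True) (N + 1) (ind (box R)) s e := by
  set f := ind (box R)
  have h0 : ∀ e', occ w (fun _ _ _ => True) N (ind (box r)) 0 e' ≤
      occ w (fun _ _ _ => True) N f s e' := fun e' => by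
    have h1 : shift (-s) (ind (box r)) ≤ f := by
      intro y e'
      by_cases hy : y + -s ∈ box r
      · rw [shift_apply, ind_of_mem hy]
        refine (ind_of_mem ?_ e').ge
        simp only [box, Set.mem_ofPred_eq, abs_le, Pi.add_apply, Pi.neg_apply] at *
        omega
      · rw [shift_apply, ind_of_notMem hy]; exact zero_le
    have h2 := LinearMap.congr_fun (commute_occ (free_shift w (-s)) N).eq (ind (box r))
    rw [Module.End.mul_apply, Module.End.mul_apply] at h2
    have h3 := occ_mono_right (w := w) (A := fun _ _ _ => True) N h1 s e'
    rwa [h2, shift_apply, add_neg_cancel] at h3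
  have h1 : ∀ e', occ w (fun _ _ _ => True) N (ind (box r)) 0 e' ≤
      6 * occ w (fun _ _ _ => True) (N + 1) f s e := fun e' => by
    refine (h0 e').trans ?_
    by_cases he : e' = e
    · subst he
      refine (occ_mono_left N.le_succ f s e').trans ?_
      exact le_mul_of_one_le_left' (by norm_num)
    · have h2 := (mul_le_mul_left hw0 _).trans
        (mul_third_le_free w (occ w (fun _ _ _ => True) N f) s he 0)
      rw [zero_smul, add_zero] at h2
      have h3 : free w (occ w (fun _ _ _ => True) N f) s e ≤
          occ w (fun _ _ _ => True) (N + 1) f s e := by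
        rw [occ_free_succ]
        exact le_add_self
      have h4 := mul_le_mul_right (h2.trans h3) 6
      refine le_trans (le_of_eq ?_) h4
      rw [← mul_assoc, ← mul_assoc, mul_assoc 6, ← ENNReal.mul_inv (by simp) (by simp)]
      norm_num
      rw [ENNReal.mul_inv_cancel (by norm_num) (by norm_num), one_mul]
  refine (Finset.sum_le_card_nsmul _ _ _ fun e' _ => h1 e').trans (le_of_eq ?_)
  simp only [Finset.card_univ, Fintype.card_prod, Fintype.card_fin, Fintype.card_bool, nsmul_eq_mul]
  rw [← mul_assoc]
  norm_num

/-- If the expected occupation of a box is large compared to the inverse of the probability to pass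
through the origin from there, then the walk passes through the origin with a probability bounded
from below. -/
theorem le_hit_of_le_green (hw : ∑' t, w t = 1) (hw0 : 2⁻¹ ≤ w 0) {r : ℕ} (hr : 0 < r) {η : ℝ≥0∞}
    {A : (Fin 2 → ℤ) → Direction 2 → ℕ → Prop}
    (hη : ∀ s ∈ box (2 * r), ∀ e, η ≤ hit w A 4 s e) {N : ℕ} (hN : 192 ≤ η * green w r N)
    {s : Fin 2 → ℤ} (hs : s ∈ box r) (e : Direction 2) :
    1536⁻¹ ≤ hit w A (N + 1) s e := by
  set g := green w r N with hg
  set h := hit w A (N + 1) s e with hh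
  set O := occ w (fun _ _ _ => True) (N + 1) (ind (box (2 * r))) s e
  have hη1 : η ≤ 1 := (hη 0 (by simp [box]) e).trans (hit_le_one hw 4 _ _)
  have hg192 : 192 ≤ g := hN.trans (mul_le_of_le_one_left' hη1)
  have hgtop : g ≠ ∞ := by
    refine (lt_of_le_of_lt (Finset.sum_le_card_nsmul _ _ (N : ℝ≥0∞) fun e _ =>
      occ_ind_le hw _ N 0 e) ?_).ne
    rw [nsmul_eq_mul]
    exact ENNReal.mul_lt_top (ENNReal.natCast_lt_top _) (ENNReal.natCast_lt_top _)
  have hgreen : green w r (N + 1) ≤ 2 * g := by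
    refine (green_succ_le hw r N).trans ?_
    rw [two_mul]
    gcongr
    exact le_trans (by norm_num) hg192
  -- The box of radius `2 * r` consists of 16 cells of side `r`, and the additional leg at most
  -- doubles `g`.
  have hmax : ∀ s e, occ w (fun _ _ _ => True) (N + 1) (ind (box (2 * r))) s e ≤ 32 * g := by
    intro s e
    have h1 := occ_box_le_green hw 0 (r := r) (by exact_mod_cast hr) 2 (by norm_num) (N + 1) s e
    have h2 : shift 0 (ind (box ((2 : ℕ) * r))) = ind (box (2 * r)) := by
      funext y e'; simp [shift_apply]
    rw [h2] at h1
    refine h1.trans ((mul_le_mul_right hgreen _).trans (le_of_eq ?_))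
    rw [← mul_assoc]
    norm_num
  have h1 : g ≤ 24 * O := green_le_occ hw0 le_rfl N hs e
  have h2 := occ_free_le (A := A) hmax s e
  simp only [Pi.add_apply, Pi.smul_apply, smul_eq_mul] at h2
  have h3 := mul_occ_avoid_le hw hη (N + 1) s e
  -- Occupation before the hitting is at most 4/η, and occupation after it at most `32 * g` times
  -- the probability `h`. As `η * g` is at least 192, the term 96 is at most half of it, which
  -- leaves `h ≥ 1/(2 * 768)`.
  have h4 : η * g ≤ 96 + 768 * (η * g) * h := by
    calc η * g ≤ η * (24 * O) := by gcongr
      _ ≤ η * (24 * (occ w (fun s e t => ¬ A s e t) (N + 1) (ind (box (2 * r))) s e +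
          32 * g * h)) := by gcongr
      _ = 24 * (η * occ w (fun s e t => ¬ A s e t) (N + 1) (ind (box (2 * r))) s e) +
          768 * (η * g) * h := by ring
      _ ≤ 24 * (4 : ℕ) + 768 * (η * g) * h := by gcongr
      _ = _ := by norm_num
  have hhtop : h ≠ ∞ := ((hit_le_one hw (N + 1) s e).trans_lt ENNReal.one_lt_top).ne
  have hXtop : η * g ≠ ∞ := ENNReal.mul_ne_top (hη1.trans_lt ENNReal.one_lt_top).ne hgtop
  lift h to NNReal using hhtop with h'
  generalize η * g = X at *
  lift X to NNReal using hXtop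
  have h5 : (X : ℝ) ≤ 96 + 768 * X * h' := by exact_mod_cast h4
  have h6 : (192 : ℝ) ≤ X := by exact_mod_cast hN
  have h7 : (1536 : ℝ)⁻¹ ≤ h' := by
    by_contra hlt
    push Not at hlt
    have : 768 * (X : ℝ) * h' < 768 * X * 1536⁻¹ := by
      apply mul_lt_mul_of_pos_left hlt
      linarith
    norm_num at this
    linarith
  have h8 : (1536 : NNReal)⁻¹ ≤ h' := by exact_mod_cast h7
  calc (1536 : ℝ≥0∞)⁻¹ = ((1536⁻¹ : NNReal) : ℝ≥0∞) := by
        rw [ENNReal.coe_inv (by norm_num)]; norm_num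
    _ ≤ h' := by exact_mod_cast h8

end Crossing


/-! ### Smoothing by uniformly distributed legs in both coordinates -/

section Algebra

variable {R : Type*} [Semiring R]

/-- For a transition operator `X + Y`: the part of `n` transitions with at least one `X`. -/
def oneOf (X Y : R) : ℕ → R
  | 0 => 0
  | n + 1 => X * (X + Y) ^ n + Y * oneOf X Y n

/-- For a transition operator `H + V + O`: the part of `n` transitions with at least one `H` and
at least one `V`. -/
def bothOf (H V O : R) : ℕ → R
  | 0 => 0
  | n + 1 => H * oneOf V (H + O) n + V * oneOf H (V + O) n + O * bothOf H V O n

theorem oneOf_add (X Y : R) (n : ℕ) : oneOf X Y n + Y ^ n = (X + Y) ^ n := by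
  induction n with
  | zero => simp [oneOf]
  | succ n ih => rw [oneOf, pow_succ', pow_succ', add_assoc, ← mul_add, ih, add_mul]

/-- Inclusion-exclusion for words without `H` or without `V`, written with sums only because a
semiring has no subtraction. -/
theorem bothOf_add (H V O : R) (n : ℕ) :
    bothOf H V O n + (V + O) ^ n + (H + O) ^ n = (H + V + O) ^ n + O ^ n := by
  induction n with
  | zero => simp [bothOf]
  | succ n ih =>
    have hV : H + V + O = V + (H + O) := by abel
    have hH : H + V + O = H + (V + O) := by abel
    have h1 := oneOf_add V (H + O) n
    have h2 := oneOf_add H (V + O) n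
    rw [← hV] at h1
    rw [← hH] at h2
    calc bothOf H V O (n + 1) + (V + O) ^ (n + 1) + (H + O) ^ (n + 1)
        = H * (oneOf V (H + O) n + (H + O) ^ n) + V * (oneOf H (V + O) n + (V + O) ^ n) +
          O * (bothOf H V O n + (V + O) ^ n + (H + O) ^ n) := by
          rw [bothOf, pow_succ', pow_succ']
          simp only [mul_add, add_mul]
          abel
      _ = (H + V + O) ^ (n + 1) + O ^ (n + 1) := by
          rw [h1, h2, ih, pow_succ' (H + V + O), pow_succ' O]
          simp only [mul_add, add_mul]
          abel

theorem commute_oneOf {X Y S : R} (hX : Commute X S) (hY : Commute Y S) (n : ℕ) :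
    Commute (oneOf X Y n) S := by
  induction n with
  | zero => exact Commute.zero_left S
  | succ n ih =>
    exact (hX.mul_left ((hX.add_left hY).pow_left n)).add_left (hY.mul_left ih)

end Algebra

/-- The legs along the axis `i` with length in the interval `(L₀, L₁]`. -/
def GoodLeg (i : Fin 2) (L₀ L₁ : ℕ) (_ : Fin 2 → ℤ) (e : Direction 2) (t : ℕ) : Prop :=
  e.1 = i ∧ L₀ < t ∧ t ≤ L₁

/-- Sum of the translates by at most `R` along the axis `i`. -/
noncomputable def smear (i : Fin 2) (R : ℕ) : Module.End ℝ≥0∞ Obs :=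
  ∑ r ∈ Finset.Icc (-(R : ℤ)) R, shift (Pi.single i r)

theorem smear_apply (i : Fin 2) (R : ℕ) (f : Obs) (s : Fin 2 → ℤ) (e : Direction 2) :
    smear i R f s e = ∑ r ∈ Finset.Icc (-(R : ℤ)) R, f (s + Pi.single i r) e := by
  simp only [smear, LinearMap.sum_apply, Finset.sum_apply, shift_apply]

theorem turn_smear (i : Fin 2) (R : ℕ) (f : Obs) : turn (smear i R f) = smear i R (turn f) := by
  rw [smear, LinearMap.sum_apply, LinearMap.sum_apply, map_sum]
  rfl

theorem leg_smear {w : ℕ → ℝ≥0∞} {A : (Fin 2 → ℤ) → Direction 2 → ℕ → Prop}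
    (hA : ∀ s s' e t, A s e t → A s' e t) (i : Fin 2) (R : ℕ) :
    Commute (leg w A) (smear i R) :=
  Commute.sum_right _ _ _ fun _ _ => leg_shift hA _

theorem smear_comm (i j : Fin 2) (R : ℕ) : Commute (smear i R) (smear j R) :=
  Commute.sum_left _ _ _ fun _ _ => Commute.sum_right _ _ _ fun _ _ => by
    refine LinearMap.ext fun f => ?_
    funext s e
    simp only [Module.End.mul_apply, shift_apply, add_right_comm]

/-- At most one pair of translations carries `s` to `x`, and it is within range only if `s` is in
the box around `x`. -/
theorem smear_smear_singleton_le (R : ℕ) (x : Fin 2 → ℤ) :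
    smear 0 R (smear 1 R (ind {x})) ≤ shift (-x) (ind (box R)) := by
  intro s e
  simp only [smear_apply]
  have h1 : ∀ r ∈ Finset.Icc (-(R : ℤ)) R, ∀ r' ∈ Finset.Icc (-(R : ℤ)) R,
      ¬ (r = x 0 - s 0 ∧ r' = x 1 - s 1) →
      ind {x} (s + Pi.single 0 r + Pi.single 1 r') e = 0 := by
    intro r _ r' _ h
    refine ind_of_notMem (fun hx => h ?_) e
    rw [Set.mem_singleton_iff] at hx
    have h0 := congrFun hx 0
    have h1 := congrFun hx 1
    simp at h0 h1
    constructor <;> linarith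
  by_cases hs : s + -x ∈ box R
  · rw [shift_apply, ind_of_mem hs]
    calc ∑ r ∈ Finset.Icc (-(R : ℤ)) R, ∑ r' ∈ Finset.Icc (-(R : ℤ)) R,
          ind {x} (s + Pi.single 0 r + Pi.single 1 r') e
        ≤ ∑ r ∈ Finset.Icc (-(R : ℤ)) R, if r = x 0 - s 0 then 1 else 0 := by
          refine Finset.sum_le_sum fun r hr => ?_
          split_ifs with h
          · refine (Finset.sum_le_sum (g := fun r' => if r' = x 1 - s 1 then 1 else 0)
              fun r' hr' => ?_).trans ?_
            · split_ifs with h'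
              · exact ind_le_one _ _ _
              · exact (h1 r hr r' hr' fun hh => h' hh.2).le
            · rw [Finset.sum_ite_eq']
              split_ifs <;> simp
          · exact (Finset.sum_eq_zero fun r' hr' => h1 r hr r' hr' fun hh => h hh.1).le
      _ ≤ 1 := by
          rw [Finset.sum_ite_eq']
          split_ifs <;> simp
  · refine le_of_eq_of_le ?_ zero_le
    refine Finset.sum_eq_zero fun r hr => Finset.sum_eq_zero fun r' hr' => h1 r hr r' hr' ?_
    rintro ⟨rfl, rfl⟩
    apply hs
    rw [Finset.mem_Icc] at hr hr'
    simp only [box, Set.mem_ofPred_eq, Pi.add_apply, Pi.neg_apply, abs_le]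
    omega

/-! ### Hitting a point after a uniformly distributed leg along each axis -/

section Smoothing

variable {w : ℕ → ℝ≥0∞} {L₀ L₁ : ℕ} {d : ℝ≥0∞}

/-- Seen from the end point of a good leg of length t, the end points for the other good lengths are
translates by t' - t, of size at most `L₁`. Hence each of the `L₁ - L₀` terms on the right already
dominates the whole sum on the left. -/
theorem goodLeg_smear_le (hd : ∀ t, L₀ < t → t ≤ L₁ → w t = d) (i : Fin 2) (f : Obs) :
    ((L₁ - L₀ : ℕ) : ℝ≥0∞) • leg w (GoodLeg i L₀ L₁) f ≤
      leg w (GoodLeg i L₀ L₁) (smear i L₁ f) := by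
  intro s e
  have hleg : ∀ g : Obs, leg w (GoodLeg i L₀ L₁) g s e =
      if e.1 = i then ∑ t ∈ Finset.Ioc L₀ L₁, d * turn g (s + t • e.vec) e else 0 := by
    intro g
    rw [leg_apply]
    split_ifs with he
    · rw [tsum_eq_sum (s := Finset.Ioc L₀ L₁)]
      · refine Finset.sum_congr rfl fun t ht => ?_
        rw [Finset.mem_Ioc] at ht
        rw [if_pos ⟨he, ht⟩, hd t ht.1 ht.2]
      · intro t ht
        rw [Finset.mem_Ioc] at ht
        rw [if_neg fun h => ht h.2, zero_mul]
    · rw [ENNReal.tsum_eq_zero.2]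
      intro t
      rw [if_neg fun h => he h.1, zero_mul]
  rw [Pi.smul_apply, Pi.smul_apply, hleg, hleg]
  split_ifs with he
  · rw [smul_eq_mul, ← nsmul_eq_mul, ← Nat.card_Ioc]
    refine Finset.card_nsmul_le_sum _ _ _ fun t ht => ?_
    rw [← Finset.mul_sum, turn_smear, smear_apply]
    gcongr
    set σ : ℤ := if e.2 then 1 else -1
    have hσ : σ = 1 ∨ σ = -1 := by simp only [σ]; split_ifs <;> simp
    have hvec : ∀ t' : ℕ, s + t' • e.vec =
        s + t • e.vec + Pi.single i (((t' : ℤ) - t) * σ) := by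
      intro t'
      ext j
      simp only [Pi.add_apply, Pi.smul_apply, Direction.vec, he]
      by_cases hj : j = i
      · subst hj; simp only [Pi.single_eq_same, nsmul_eq_mul, σ]; ring
      · simp [Pi.single_eq_of_ne hj]
    have hinj : Set.InjOn (fun t' : ℕ => ((t' : ℤ) - t) * σ) (Finset.Ioc L₀ L₁) := by
      intro a _ b _ hab
      rcases hσ with h | h <;> simp only [h] at hab <;> omega
    rw [Finset.sum_congr rfl fun t' _ => by rw [hvec t'],
      ← Finset.sum_image (f := fun r => turn f (s + t • e.vec + Pi.single i r) e) hinj]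
    refine Finset.sum_le_sum_of_subset fun r hr => ?_
    obtain ⟨t', ht', rfl⟩ := Finset.mem_image.1 hr
    rw [Finset.mem_Ioc] at ht ht'
    rw [Finset.mem_Icc]
    rcases hσ with h | h <;> simp only [h] <;> omega
  · simp

/-- The legs which are good for neither of the two axes. -/
def BadLeg (L₀ L₁ : ℕ) (_ : Fin 2 → ℤ) (_ : Direction 2) (t : ℕ) : Prop := ¬ (L₀ < t ∧ t ≤ L₁)

theorem fin_two_eq (i j : Fin 2) (h : i ≠ j) (k : Fin 2) : k = i ∨ k = j := by omega

theorem leg_not_goodLeg {i j : Fin 2} (h : i ≠ j) :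
    leg w (fun s e t => ¬ GoodLeg i L₀ L₁ s e t) =
      leg w (GoodLeg j L₀ L₁) + leg w (BadLeg L₀ L₁) := by
  refine leg_split (fun s e t => ?_) (fun s e t => ?_)
  · have := fin_two_eq i j h e.1
    unfold GoodLeg BadLeg
    constructor
    · intro h1
      by_contra h2
      push Not at h2
      rcases this with h3 | h3
      · exact h1 ⟨h3, h2.2⟩
      · exact h2.1 h3 h2.2.1 |>.not_ge h2.2.2
    · rintro (h1 | h1) h2
      · exact h (h2.1.symm.trans h1.1)
      · exact h1 h2.2
  · unfold GoodLeg BadLeg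
    tauto

/-- The smearing commutes with all legs, so it can be moved back to the first good leg, which
absorbs it. -/
theorem oneOf_smear_le (hd : ∀ t, L₀ < t → t ≤ L₁ → w t = d) (i : Fin 2)
    {B : (Fin 2 → ℤ) → Direction 2 → ℕ → Prop} (hB : ∀ s s' e t, B s e t → B s' e t)
    (f : Obs) (n : ℕ) :
    ((L₁ - L₀ : ℕ) : ℝ≥0∞) • oneOf (leg w (GoodLeg i L₀ L₁)) (leg w B) n f ≤
      oneOf (leg w (GoodLeg i L₀ L₁)) (leg w B) n (smear i L₁ f) := by
  have hc : Commute (leg w (GoodLeg i L₀ L₁) + leg w B) (smear i L₁) :=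
    (leg_smear (fun _ _ _ _ h => h) i L₁).add_left (leg_smear hB i L₁)
  induction n with
  | zero => simp [oneOf]
  | succ n ih =>
    simp only [oneOf, LinearMap.add_apply, Module.End.mul_apply, smul_add]
    refine add_le_add ?_ ?_
    · refine (goodLeg_smear_le hd i _).trans (le_of_eq ?_)
      have h := LinearMap.congr_fun (hc.pow_left n).eq f
      simp only [Module.End.mul_apply] at h
      rw [h]
    · rw [← map_smul]
      exact leg_mono ih

theorem oneOf_le {B C : (Fin 2 → ℤ) → Direction 2 → ℕ → Prop}
    (h : leg w B + leg w C = free w) (f : Obs) (n : ℕ) :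
    oneOf (leg w B) (leg w C) n f ≤ (free w ^ n) f := by
  rw [← h, ← oneOf_add]
  exact le_self_add

/-- The part of `n` legs with at least one good leg along each axis. -/
noncomputable abbrev bothGood (w : ℕ → ℝ≥0∞) (L₀ L₁ : ℕ) (n : ℕ) : Module.End ℝ≥0∞ Obs :=
  bothOf (leg w (GoodLeg 0 L₀ L₁)) (leg w (GoodLeg 1 L₀ L₁)) (leg w (BadLeg L₀ L₁)) n

theorem free_eq_good_add : free w =
    leg w (GoodLeg 0 L₀ L₁) + leg w (GoodLeg 1 L₀ L₁) + leg w (BadLeg L₀ L₁) := by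
  rw [add_assoc, ← leg_not_goodLeg (i := 0) (j := 1) (by decide), ← free_eq_add]

theorem free_pow_le_bothGood (f : Obs) (n : ℕ) :
    (free w ^ n) f ≤ bothGood w L₀ L₁ n f +
      (leg w (fun s e t => ¬ GoodLeg 0 L₀ L₁ s e t) ^ n) f +
      (leg w (fun s e t => ¬ GoodLeg 1 L₀ L₁ s e t) ^ n) f := by
  rw [leg_not_goodLeg (i := 0) (j := 1) (by decide), leg_not_goodLeg (i := 1) (j := 0) (by decide)]
  have h := LinearMap.congr_fun (bothOf_add (leg w (GoodLeg 0 L₀ L₁)) (leg w (GoodLeg 1 L₀ L₁))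
    (leg w (BadLeg L₀ L₁)) n) f
  rw [← free_eq_good_add] at h
  simp only [LinearMap.add_apply] at h
  rw [h]
  exact le_self_add

theorem bothGood_le (f : Obs) (n : ℕ) : bothGood w L₀ L₁ n f ≤ (free w ^ n) f := by
  induction n with
  | zero => simp [bothGood, bothOf]
  | succ n ih =>
    have h : (free w ^ (n + 1)) f = leg w (GoodLeg 0 L₀ L₁) ((free w ^ n) f) +
        leg w (GoodLeg 1 L₀ L₁) ((free w ^ n) f) + leg w (BadLeg L₀ L₁) ((free w ^ n) f) := by
      rw [pow_succ', Module.End.mul_apply]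
      nth_rw 1 [free_eq_good_add (L₀ := L₀) (L₁ := L₁)]
      rfl
    rw [h]
    simp only [bothGood, bothOf, LinearMap.add_apply, Module.End.mul_apply]
    refine add_le_add (add_le_add (leg_mono ?_) (leg_mono ?_)) (leg_mono ih)
    · rw [← leg_not_goodLeg (i := 1) (j := 0) (by decide)]
      exact oneOf_le (free_eq_add w _).symm f n
    · rw [← leg_not_goodLeg (i := 0) (j := 1) (by decide)]
      exact oneOf_le (free_eq_add w _).symm f n

/-- The first good leg of all absorbs the smearing along its own axis, and the first later good leg
along the other axis absorbs the other one. -/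
theorem bothGood_smear_le (hd : ∀ t, L₀ < t → t ≤ L₁ → w t = d) (f : Obs) (n : ℕ) :
    ((L₁ - L₀ : ℕ) : ℝ≥0∞) ^ 2 • bothGood w L₀ L₁ n f ≤
      bothGood w L₀ L₁ n (smear 0 L₁ (smear 1 L₁ f)) := by
  have key : ∀ i j : Fin 2, i ≠ j → ∀ n, ((L₁ - L₀ : ℕ) : ℝ≥0∞) ^ 2 •
      leg w (GoodLeg i L₀ L₁) (oneOf (leg w (GoodLeg j L₀ L₁))
        (leg w (GoodLeg i L₀ L₁) + leg w (BadLeg L₀ L₁)) n f) ≤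
      leg w (GoodLeg i L₀ L₁) (oneOf (leg w (GoodLeg j L₀ L₁))
        (leg w (GoodLeg i L₀ L₁) + leg w (BadLeg L₀ L₁)) n (smear i L₁ (smear j L₁ f))) := by
    intro i j hij n
    rw [← leg_not_goodLeg hij.symm, sq, mul_smul, ← map_smul]
    refine (smul_le_smul_of_nonneg_left (leg_mono (oneOf_smear_le hd j
      (fun _ _ _ _ h => h) f n)) zero_le).trans ?_
    refine (goodLeg_smear_le hd i _).trans (le_of_eq ?_)
    have hc : Commute (oneOf (leg w (GoodLeg j L₀ L₁))
        (leg w (fun s e t => ¬ GoodLeg j L₀ L₁ s e t)) n) (smear i L₁) :=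
      commute_oneOf (leg_smear (fun _ _ _ _ h => h) i L₁) (leg_smear (fun _ _ _ _ h => h) i L₁) n
    have h := LinearMap.congr_fun hc.eq (smear j L₁ f)
    simp only [Module.End.mul_apply] at h
    rw [h]
  have hcomm := LinearMap.congr_fun (smear_comm 0 1 L₁).eq f
  simp only [Module.End.mul_apply] at hcomm
  induction n with
  | zero => simp [bothGood, bothOf]
  | succ n ih =>
    simp only [bothGood, bothOf, LinearMap.add_apply, Module.End.mul_apply, smul_add]
    refine add_le_add (add_le_add (key 0 1 (by decide) n) ?_) ?_
    · rw [hcomm]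
      exact key 1 0 (by decide) n
    · rw [← map_smul]
      exact leg_mono ih

/-- The legs which start at `x`. -/
def StartsAt (x s : Fin 2 → ℤ) (_ : Direction 2) (_ : ℕ) : Prop := s = x

/-- The good legs average the expected number of visits to `x` over at least `(L₁ - L₀) ^ 2`
translates, and the visits to all translates together are bounded by the occupation of a box. The
two terms `δ` pay for the absence of a good leg along one of the axes. -/
theorem free_pow_hit_le (hw : ∑' t, w t = 1) (hL : L₀ < L₁)
    (hd : ∀ t, L₀ < t → t ≤ L₁ → w t = d) {x : Fin 2 → ℤ} {m : ℕ} {c δ : ℝ≥0∞}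
    (hc : ∀ s e, occ w (fun _ _ _ => True) m (shift (-x) (ind (box L₁))) s e ≤ c) {n : ℕ}
    (hδ : ∀ i s e, (leg w (fun s e t => ¬ GoodLeg i L₀ L₁ s e t) ^ n) 1 s e ≤ δ)
    (s : Fin 2 → ℤ) (e : Direction 2) :
    (free w ^ n) (hit w (StartsAt x) m) s e ≤ c / ((L₁ - L₀ : ℕ) : ℝ≥0∞) ^ 2 + δ + δ := by
  refine (free_pow_le_bothGood (L₀ := L₀) (L₁ := L₁) _ n s e).trans
    (add_le_add (add_le_add ?_ ?_) ?_)
  · have hl : ((L₁ - L₀ : ℕ) : ℝ≥0∞) ^ 2 ≠ 0 := by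
      have : L₁ - L₀ ≠ 0 := by omega
      exact pow_ne_zero _ (by exact_mod_cast this)
    rw [ENNReal.le_div_iff_mul_le (Or.inl hl) (Or.inl (by finiteness)), mul_comm]
    -- The order of [0, ∞] is the canonical one, so additive operators are monotone.
    have hmono : ∀ f g : Obs, f ≤ g → bothGood w L₀ L₁ n f ≤ bothGood w L₀ L₁ n g := by
      intro f g hfg
      obtain ⟨k, rfl⟩ := exists_add_of_le hfg
      rw [map_add]
      exact le_self_add
    have h1 : hit w (StartsAt x) m ≤ occ w (fun _ _ _ => True) m (ind {x}) :=
      hit_le_occ hw (fun s e t h => h) m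
    have h2 := bothGood_smear_le hd (occ w (fun _ _ _ => True) m (ind {x})) n s e
    refine (mul_le_mul_right (hmono _ _ h1 s e) _).trans (h2.trans ?_)
    refine (bothGood_le _ n s e).trans ?_
    refine leg_pow_le_const hw _ (fun s e => ?_) n s e
    have h3 := LinearMap.congr_fun (commute_occ (leg_smear (w := w) (A := fun _ _ _ => True)
      (fun _ _ _ _ h => h) 1 L₁) m).eq (ind {x})
    have h4 := LinearMap.congr_fun (commute_occ (leg_smear (w := w) (A := fun _ _ _ => True)
      (fun _ _ _ _ h => h) 0 L₁) m).eq (smear 1 L₁ (ind {x}))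
    simp only [Module.End.mul_apply] at h3 h4
    rw [← h3, ← h4]
    exact (occ_mono_right m (smear_smear_singleton_le L₁ x) s e).trans (hc s e)
  · exact (leg_pow_mono n (hit_le_one hw m) s e).trans (hδ 0 s e)
  · exact (leg_pow_mono n (hit_le_one hw m) s e).trans (hδ 1 s e)

/-- Among the three directions other than `e`, at least one lies on the axis `i`. -/
theorem sum_axis_le {x : ℝ≥0∞} (hx : x ≤ 1) (i : Fin 2) (e : Direction 2) :
    (∑ e' : Direction 2, if e' = e then 0 else if e'.1 = i then x else 1) ≤ x + 2 := by
  lift x to NNReal using (hx.trans_lt ENNReal.one_lt_top).ne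
  have hx' : (x : ℝ) ≤ 1 := by exact_mod_cast hx
  rw [Fintype.sum_prod_type]
  obtain ⟨j, b⟩ := e
  simp only [Fin.sum_univ_two, Fintype.sum_bool]
  have h1 : (x : ℝ≥0∞) + x + 1 ≤ x + 2 := by
    have : (x : ℝ) + x + 1 ≤ x + 2 := by linarith
    exact_mod_cast this
  have h2 : (x : ℝ≥0∞) + 1 + 1 ≤ x + 2 := by
    rw [add_assoc, one_add_one_eq_two]
  fin_cases i <;> fin_cases j <;> cases b <;> simp only [Fin.zero_eta, Fin.mk_one, Prod.mk.injEq,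
    reduceCtorEq, and_false, and_true, and_self, if_true, if_false, zero_ne_one, one_ne_zero,
    zero_add, add_zero] <;>
  first
  | exact h1
  | exact h2
  | (rw [← add_assoc] ; first | exact h1 | exact h2)
  | (rw [add_comm, ← add_assoc] ; first | exact h1 | exact h2)
  | (rw [add_comm] ; exact h1)

/-- The current leg may be along the wrong axis, hence two legs: the second has axis `i` with
probability at least 1/3 and then is not good with probability `ρ`. -/
theorem leg_not_goodLeg_sq_le (hw : ∑' t, w t = 1) (i : Fin 2) (s : Fin 2 → ℤ) (e : Direction 2) :
    (leg w (fun s e t => ¬ GoodLeg i L₀ L₁ s e t) ^ 2) 1 s e ≤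
      3⁻¹ * ((∑' t, if L₀ < t ∧ t ≤ L₁ then 0 else w t) + 2) := by
  set ρ := ∑' t, if L₀ < t ∧ t ≤ L₁ then 0 else w t with hρ
  have hρ1 : ρ ≤ 1 := by
    rw [← hw]
    refine ENNReal.tsum_le_tsum fun t => ?_
    split_ifs
    · exact zero_le
    · exact le_rfl
  classical
  have h1 : ∀ s e, leg w (fun s e t => ¬ GoodLeg i L₀ L₁ s e t) 1 s e ≤
      if e.1 = i then ρ else 1 := by
    intro s e
    split_ifs with he
    · rw [leg_one]
      refine le_of_eq (tsum_congr fun t => ?_)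
      unfold GoodLeg
      simp only [he, true_and, ite_not]
    · exact leg_le_const hw _ (fun _ _ => le_rfl) s e
  have h2 : ∀ s e, turn (leg w (fun s e t => ¬ GoodLeg i L₀ L₁ s e t) 1) s e ≤ 3⁻¹ * (ρ + 2) := by
    intro s e
    refine (turn_mono h1 s e).trans ?_
    rw [turn_apply]
    gcongr
    exact sum_axis_le hρ1 i e
  rw [sq, Module.End.mul_apply, leg_apply]
  calc _ ≤ ∑' t, w t * (3⁻¹ * (ρ + 2)) := by
        refine ENNReal.tsum_le_tsum fun t => mul_le_mul' ?_ (h2 _ _)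
        split_ifs <;> simp
    _ = _ := by rw [ENNReal.tsum_mul_right, hw, one_mul]

theorem leg_not_goodLeg_pow_le (hw : ∑' t, w t = 1) (i : Fin 2) (n : ℕ) (s : Fin 2 → ℤ)
    (e : Direction 2) :
    (leg w (fun s e t => ¬ GoodLeg i L₀ L₁ s e t) ^ (2 * n)) 1 s e ≤
      (3⁻¹ * ((∑' t, if L₀ < t ∧ t ≤ L₁ then 0 else w t) + 2)) ^ n := by
  set c := 3⁻¹ * ((∑' t, if L₀ < t ∧ t ≤ L₁ then 0 else w t) + 2)
  rw [pow_mul]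
  set X := leg w (fun s e t => ¬ GoodLeg i L₀ L₁ s e t) ^ 2
  induction n generalizing s e with
  | zero => simp
  | succ n ih =>
    rw [pow_succ', Module.End.mul_apply, pow_succ]
    have h1 : (X ^ n) 1 ≤ c ^ n • (1 : Obs) := fun s e => by
      rw [Pi.smul_apply, Pi.smul_apply, Pi.one_apply, Pi.one_apply, smul_eq_mul, mul_one]
      exact ih s e
    refine (leg_pow_mono 2 h1 s e).trans ?_
    rw [map_smul, Pi.smul_apply, Pi.smul_apply, smul_eq_mul]
    gcongr
    exact leg_not_goodLeg_sq_le hw i s e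

end Smoothing


/-! ### Recurrence of the walk with bounded waiting times -/

/-- The opposite direction. -/
def opp (e : Direction 2) : Direction 2 := (e.1, !e.2)

theorem opp_opp (e : Direction 2) : opp (opp e) = e := by simp [opp]

theorem opp_ne (e : Direction 2) : e ≠ opp e := fun h => by
  have := congrArg Prod.snd h
  simp [opp] at this

theorem opp_vec (e : Direction 2) : (opp e).vec = -e.vec := by
  obtain ⟨i, b⟩ := e
  cases b <;> simp [opp, Direction.vec, ← Pi.single_neg]

/-- The direction reversal, as an equivalence. -/
def oppEquiv : Direction 2 ≃ Direction 2 := ⟨opp, opp, opp_opp, opp_opp⟩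

/-- The bilinear form for which the transition operators are self-adjoint. -/
noncomputable def form (f g : Obs) : ℝ≥0∞ := ∑' s, ∑ e, f s e * turn g s (opp e)

theorem form_symm (f g : Obs) : form f g = form g f := by
  refine tsum_congr fun s => ?_
  simp only [turn_apply, Finset.mul_sum]
  rw [Finset.sum_comm]
  refine Finset.sum_congr rfl fun e _ => Finset.sum_congr rfl fun e' _ => ?_
  have h : e = opp e' ↔ e' = opp e :=
    ⟨fun h => by rw [h, opp_opp], fun h => by rw [h, opp_opp]⟩
  simp only [h]
  split_ifs
  · simp
  · ring

/-- Reversibility: a leg from s to s + t e in direction e is also a leg back in the opposite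
direction. The substitution of the end point for s and of `opp e` for e exchanges the two sides. -/
theorem form_free (w : ℕ → ℝ≥0∞) (f g : Obs) : form (free w f) g = form f (free w g) := by
  have key : ∀ f g : Obs, form (free w f) g =
      ∑' t : ℕ, ∑ e, ∑' s, w t * turn f (s + t • e.vec) e * turn g s (opp e) := by
    intro f g
    simp only [form, free_apply, ← ENNReal.tsum_mul_right]
    rw [Summable.tsum_finsetSum fun _ _ => ENNReal.summable,
      Summable.tsum_finsetSum fun _ _ => ENNReal.summable]
    exact Finset.sum_congr rfl fun e _ => ENNReal.tsum_comm
  rw [form_symm f, key, key]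
  refine tsum_congr fun t => ?_
  rw [← oppEquiv.sum_comp]
  refine Finset.sum_congr rfl fun e _ => ?_
  have ho : oppEquiv e = opp e := rfl
  rw [ho, ← (Equiv.addRight (t • e.vec)).tsum_eq]
  refine tsum_congr fun s => ?_
  rw [Equiv.coe_addRight, opp_opp, opp_vec, smul_neg, add_neg_cancel_right]
  ring

theorem form_free_pow (w : ℕ → ℝ≥0∞) (f g : Obs) (n : ℕ) :
    form ((free w ^ n) f) g = form f ((free w ^ n) g) := by
  induction n generalizing f with
  | zero => rfl
  | succ n ih =>
    rw [pow_succ, Module.End.mul_apply, ih, form_free, ← Module.End.mul_apply, ← pow_succ',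
      ← pow_succ]

theorem turn_ind (B : Set (Fin 2 → ℤ)) : turn (ind B) = ind B := by
  funext s e
  exact turn_const (B.indicator 1 s) s e

theorem form_ind_zero (f : Obs) : form (ind {0}) f = ∑ e, f 0 e := by
  rw [form_symm, form, tsum_eq_single 0]
  · simp only [turn_ind, ind_of_mem (Set.mem_singleton _), mul_one]
  · intro s hs
    simp only [turn_ind, ind_of_notMem (Set.notMem_singleton_iff.2 hs), mul_zero,
      Finset.sum_const_zero]

/-- Lower bound for the return probabilities by the sum of squares of the transition
probabilities. -/
theorem sum_sq_le_return (w : ℕ → ℝ≥0∞) (n : ℕ) (F : Finset (Fin 2 → ℤ)) (e : Direction 2) :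
    3⁻¹ * ∑ s ∈ F, (free w ^ n) (ind {0}) s e ^ 2 ≤ ∑ e, (free w ^ (2 * n)) (ind {0}) 0 e := by
  rw [← form_ind_zero, two_mul, pow_add, Module.End.mul_apply, ← form_free_pow]
  set u := (free w ^ n) (ind {0})
  refine le_trans ?_ (ENNReal.sum_le_tsum F)
  rw [Finset.mul_sum]
  refine Finset.sum_le_sum fun s _ => ?_
  refine le_trans ?_ (Finset.single_le_sum (f := fun e => u s e * turn u s (opp e))
    (fun _ _ => zero_le) (Finset.mem_univ e))
  rw [sq, mul_left_comm]
  gcongr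
  exact third_mul_le_turn u s (opp_ne e)

theorem sq_le_card_mul_sum_sq {ι : Type*} (F : Finset ι) (u : ι → ℝ≥0∞) :
    (∑ i ∈ F, u i) ^ 2 ≤ F.card * ∑ i ∈ F, u i ^ 2 := by
  by_cases h : ∃ i ∈ F, u i = ∞
  · obtain ⟨i, hi, hu⟩ := h
    have h1 : ∑ i ∈ F, u i ^ 2 = ∞ := ENNReal.sum_eq_top.2 ⟨i, hi, by simp [hu]⟩
    have h2 : (F.card : ℝ≥0∞) ≠ 0 := by
      simpa using Finset.ne_empty_of_mem hi
    rw [h1, ENNReal.mul_top h2]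
    exact le_top
  · push Not at h
    have h1 : ∀ i ∈ F, u i = ((u i).toNNReal : ℝ≥0∞) := fun i hi =>
      (ENNReal.coe_toNNReal (h i hi)).symm
    have h2 : ∑ i ∈ F, u i = ((∑ i ∈ F, (u i).toNNReal : NNReal) : ℝ≥0∞) := by
      rw [ENNReal.ofNNReal_finsetSum]
      exact Finset.sum_congr rfl h1
    have h3 : ∑ i ∈ F, u i ^ 2 = ((∑ i ∈ F, (u i).toNNReal ^ 2 : NNReal) : ℝ≥0∞) := by
      rw [ENNReal.ofNNReal_finsetSum]
      exact Finset.sum_congr rfl fun i hi => by rw [ENNReal.coe_pow, ← h1 i hi]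
    rw [h2, h3]
    have := sq_sum_le_card_mul_sum_sq (s := F) (f := fun i => (u i).toNNReal)
    exact_mod_cast this

/-! #### Second moments -/

section Moment

/-- A quadratic function of position and direction, which is almost harmonic for a suitable `c`. -/
noncomputable def quad (c : ℝ) (s : Fin 2 → ℤ) (e : Direction 2) : ℝ :=
  (s 0 + c * e.vec 0) ^ 2 + (s 1 + c * e.vec 1) ^ 2

theorem quad_nonneg (c : ℝ) (s : Fin 2 → ℤ) (e : Direction 2) : 0 ≤ quad c s e := by
  unfold quad; positivity

theorem vec_sq (e : Direction 2) : (e.vec 0 : ℝ) ^ 2 + (e.vec 1 : ℝ) ^ 2 = 1 := by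
  obtain ⟨i, b⟩ := e
  fin_cases i <;> cases b <;> simp [Direction.vec]

/-- The average of `quad` over the next direction. -/
noncomputable def quadTurn (c : ℝ) (s : Fin 2 → ℤ) (e : Direction 2) : ℝ :=
  (s 0 : ℝ) ^ 2 + (s 1 : ℝ) ^ 2 + c ^ 2 - 2 / 3 * c * (s 0 * e.vec 0 + s 1 * e.vec 1)

theorem sum_quad (c : ℝ) (s : Fin 2 → ℤ) (e : Direction 2) :
    ∑ e', (if e' = e then 0 else quad c s e') = 3 * quadTurn c s e := by
  rw [Fintype.sum_prod_type]
  obtain ⟨i, b⟩ := e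
  simp only [Fin.sum_univ_two, Fintype.sum_bool, quad, quadTurn]
  fin_cases i <;> cases b <;> simp [Direction.vec] <;> ring

theorem quadTurn_nonneg (c : ℝ) (s : Fin 2 → ℤ) (e : Direction 2) : 0 ≤ quadTurn c s e := by
  have h := sum_quad c s e
  have : 0 ≤ ∑ e', (if e' = e then 0 else quad c s e') :=
    Finset.sum_nonneg fun e' _ => by split_ifs <;> simp [quad_nonneg]
  linarith

theorem turn_quad (c : ℝ) (s : Fin 2 → ℤ) (e : Direction 2) :
    turn (fun s e => ENNReal.ofReal (quad c s e)) s e = ENNReal.ofReal (quadTurn c s e) := by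
  rw [turn_apply]
  have h1 : ∀ e', (if e' = e then 0 else ENNReal.ofReal (quad c s e')) =
      ENNReal.ofReal (if e' = e then 0 else quad c s e') := fun e' => by split_ifs <;> simp
  simp only [h1]
  rw [← ENNReal.ofReal_sum_of_nonneg fun e' _ => by split_ifs <;> simp [quad_nonneg], sum_quad,
    ENNReal.ofReal_mul (by norm_num), ← mul_assoc]
  norm_num
  rw [ENNReal.inv_mul_cancel (by norm_num) (by norm_num), one_mul]

variable {w : ℕ → ℝ≥0∞} {L : ℕ}

/-- The mean of a waiting time bounded by `L`. -/
noncomputable def mean (w : ℕ → ℝ≥0∞) (L : ℕ) : ℝ := ∑ t ∈ Finset.range (L + 1), (w t).toReal * t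

theorem sum_toReal (hw : ∑' t, w t = 1) (hL : ∀ t, L < t → w t = 0) :
    ∑ t ∈ Finset.range (L + 1), (w t).toReal = 1 := by
  rw [← ENNReal.toReal_sum]
  · rw [← ENNReal.toReal_one, ← hw, tsum_eq_sum (s := Finset.range (L + 1))]
    intro t ht
    exact hL t (by simpa using ht)
  · intro t _ h
    have := ENNReal.le_tsum (f := w) t
    rw [h, hw] at this
    simp at this

/-- The next direction has mean -e/3, so s + c e has mean s + (m - c/3) e after one leg, where m is
the mean length. For c = 3m/4 this is a martingale, the terms linear in s cancel, and the increment
of the square is E t² - m²/2, hence at most L². -/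
theorem free_quad_le (hw : ∑' t, w t = 1) (hL : ∀ t, L < t → w t = 0) (s : Fin 2 → ℤ)
    (e : Direction 2) :
    free w (fun s e => ENNReal.ofReal (quad (3 / 4 * mean w L) s e)) s e ≤
      ENNReal.ofReal (quad (3 / 4 * mean w L) s e) + (L ^ 2 : ℕ) := by
  set m := mean w L with hm
  have hwt : ∀ t, w t = ENNReal.ofReal (w t).toReal := fun t => by
    rw [ENNReal.ofReal_toReal]
    intro h
    have := ENNReal.le_tsum (f := w) t
    rw [h, hw] at this
    simp at this
  rw [free_apply, tsum_eq_sum (s := Finset.range (L + 1))]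
  swap
  · intro t ht
    rw [hL t (by simpa using ht), zero_mul]
  have h1 : ∀ t, w t * turn (fun s e => ENNReal.ofReal (quad (3 / 4 * m) s e)) (s + t • e.vec) e =
      ENNReal.ofReal ((w t).toReal * quadTurn (3 / 4 * m) (s + t • e.vec) e) := fun t => by
    rw [turn_quad, ENNReal.ofReal_mul ENNReal.toReal_nonneg, ← hwt]
  simp only [h1]
  rw [← ENNReal.ofReal_sum_of_nonneg fun t _ =>
    mul_nonneg ENNReal.toReal_nonneg (quadTurn_nonneg _ _ _), ← ENNReal.ofReal_natCast,
    ← ENNReal.ofReal_add (quad_nonneg _ _ _) (by positivity)]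
  refine ENNReal.ofReal_le_ofReal ?_
  have hv := vec_sq e
  set x : ℝ := ((s 0 : ℤ) : ℝ)
  set y : ℝ := ((s 1 : ℤ) : ℝ)
  set p : ℝ := ((e.vec 0 : ℤ) : ℝ)
  set q : ℝ := ((e.vec 1 : ℤ) : ℝ)
  have hQ : ∀ t : ℕ, quadTurn (3 / 4 * m) (s + t • e.vec) e =
      (x ^ 2 + y ^ 2 + (3 / 4 * m) ^ 2 - 1 / 2 * m * (x * p + y * q)) +
        (2 * (x * p + y * q) - 1 / 2 * m) * t + (t : ℝ) ^ 2 := fun t => by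
    have h2 : ∀ i, (((s + t • e.vec) i : ℤ) : ℝ) = s i + t * e.vec i := fun i => by
      simp
    rw [quadTurn, h2, h2]
    linear_combination ((t : ℝ) ^ 2 - 1 / 2 * m * t) * hv
  have hm0 : 0 ≤ m := Finset.sum_nonneg fun t _ => by positivity
  have hmom : ∑ t ∈ Finset.range (L + 1), (w t).toReal * (t : ℝ) ^ 2 ≤ (L : ℝ) ^ 2 := by
    calc ∑ t ∈ Finset.range (L + 1), (w t).toReal * (t : ℝ) ^ 2
        ≤ ∑ t ∈ Finset.range (L + 1), (w t).toReal * (L : ℝ) ^ 2 := by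
          refine Finset.sum_le_sum fun t ht => ?_
          have : t ≤ L := by simpa [Nat.lt_succ_iff] using ht
          gcongr
      _ = _ := by rw [← Finset.sum_mul, sum_toReal hw hL, one_mul]
  have hsum : ∑ t ∈ Finset.range (L + 1),
      (w t).toReal * quadTurn (3 / 4 * m) (s + t • e.vec) e =
      (x ^ 2 + y ^ 2 + (3 / 4 * m) ^ 2 - 1 / 2 * m * (x * p + y * q)) +
        (2 * (x * p + y * q) - 1 / 2 * m) * m +
        ∑ t ∈ Finset.range (L + 1), (w t).toReal * (t : ℝ) ^ 2 := by
    have hgen : ∀ A B : ℝ, ∑ t ∈ Finset.range (L + 1), (w t).toReal * (A + B * t + (t : ℝ) ^ 2) =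
        A + B * m + ∑ t ∈ Finset.range (L + 1), (w t).toReal * (t : ℝ) ^ 2 := fun A B => by
      simp only [mul_add, Finset.sum_add_distrib]
      rw [← Finset.sum_mul, sum_toReal hw hL, one_mul, hm, mean, Finset.mul_sum]
      congr 2
      exact Finset.sum_congr rfl fun t _ => by ring
    simp only [hQ]
    exact hgen _ _
  rw [hsum]
  push_cast
  unfold quad
  nlinarith [hv, sq_nonneg m]

/-- Chebyshev's inequality for `quad`: since `c ≤ L`, outside the box of radius `L + M` its value is
at least M². The `n + 1` accounts for the n increments and the initial value c². -/
theorem free_pow_compl_box_moment_le (hw : ∑' t, w t = 1) (hL : ∀ t, L < t → w t = 0) (n M : ℕ)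
    (e : Direction 2) :
    ((M ^ 2 : ℕ) : ℝ≥0∞) * (free w ^ n) (ind (box ((L + M : ℕ) : ℤ))ᶜ) 0 e ≤
      ((n + 1) * L ^ 2 : ℕ) := by
  set c := 3 / 4 * mean w L with hc
  have hc0 : 0 ≤ c := by
    refine mul_nonneg (by norm_num) (Finset.sum_nonneg fun t _ => by positivity)
  have hcL : c ≤ L := by
    have h1 : mean w L ≤ L := by
      calc mean w L ≤ ∑ t ∈ Finset.range (L + 1), (w t).toReal * L := by
            refine Finset.sum_le_sum fun t ht => ?_
            have : t ≤ L := by simpa [Nat.lt_succ_iff] using ht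
            gcongr
        _ = _ := by rw [← Finset.sum_mul, sum_toReal hw hL, one_mul]
    have : (0 : ℝ) ≤ L := by positivity
    rw [hc]
    linarith
  have h1 : ∀ s e, (free w ^ n) (fun s e => ENNReal.ofReal (quad c s e)) s e ≤
      ENNReal.ofReal (quad c s e) + n * (L ^ 2 : ℕ) := by
    induction n with
    | zero => simp
    | succ n ih =>
      intro s e
      rw [pow_succ', Module.End.mul_apply]
      refine (leg_mono (g := (fun s e => ENNReal.ofReal (quad c s e)) +
        fun _ _ => (n * (L ^ 2 : ℕ) : ℝ≥0∞)) (fun s e => ih s e) s e).trans ?_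
      rw [map_add, Pi.add_apply, Pi.add_apply, free_const hw]
      refine (add_le_add (free_quad_le hw hL s e) le_rfl).trans (le_of_eq ?_)
      push_cast
      ring
  have h2 : ((M ^ 2 : ℕ) : ℝ≥0∞) • ind (box ((L + M : ℕ) : ℤ))ᶜ ≤
      fun s e => ENNReal.ofReal (quad c s e) := by
    intro s e
    by_cases hs : s ∈ box ((L + M : ℕ) : ℤ)
    · rw [Pi.smul_apply, Pi.smul_apply, ind_of_notMem (by simpa using hs), smul_zero]
      exact zero_le
    · rw [Pi.smul_apply, Pi.smul_apply, ind_of_mem (by simpa using hs), smul_eq_mul, mul_one,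
        ← ENNReal.ofReal_natCast]
      refine ENNReal.ofReal_le_ofReal ?_
      have h3 : ∃ i, ((L + M : ℕ) : ℤ) < |s i| := by
        by_contra h
        push Not at h
        exact hs ⟨h 0, h 1⟩
      obtain ⟨i, hi⟩ := h3
      have hv : |(e.vec i : ℝ)| ≤ 1 := by
        rw [← sq_le_one_iff_abs_le_one]
        have := vec_sq e
        fin_cases i
        · change (e.vec 0 : ℝ) ^ 2 ≤ 1
          linarith [sq_nonneg (e.vec 1 : ℝ)]
        · change (e.vec 1 : ℝ) ^ 2 ≤ 1
          linarith [sq_nonneg (e.vec 0 : ℝ)]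
      have hi' : (L : ℝ) + M < |(s i : ℝ)| := by exact_mod_cast hi
      have h4 : (M : ℝ) ≤ |s i + c * e.vec i| := by
        have h5 := abs_sub_abs_le_abs_sub (s i : ℝ) (-(c * e.vec i))
        rw [abs_neg, abs_mul, abs_of_nonneg hc0, sub_neg_eq_add] at h5
        have h6 : c * |(e.vec i : ℝ)| ≤ c := mul_le_of_le_one_right hc0 hv
        linarith
      have h5 : (M : ℝ) ^ 2 ≤ (s i + c * e.vec i) ^ 2 := by
        rw [← sq_abs (s i + c * e.vec i : ℝ)]
        gcongr
      push_cast
      refine h5.trans ?_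
      unfold quad
      fin_cases i
      · exact le_add_of_nonneg_right (sq_nonneg _)
      · exact le_add_of_nonneg_left (sq_nonneg _)
  have h3 := leg_pow_mono (w := w) (A := fun _ _ _ => True) n h2 0 e
  rw [map_smul, Pi.smul_apply, Pi.smul_apply, smul_eq_mul] at h3
  refine h3.trans ((h1 0 e).trans ?_)
  have h4 : quad c 0 e ≤ ((L ^ 2 : ℕ) : ℝ) := by
    have hv := vec_sq e
    have : quad c 0 e = c ^ 2 := by
      simp only [quad, Pi.zero_apply, Int.cast_zero, zero_add]
      linear_combination c ^ 2 * hv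
    rw [this]
    push_cast
    gcongr
  refine (add_le_add (ENNReal.ofReal_le_ofReal h4) le_rfl).trans (le_of_eq ?_)
  rw [ENNReal.ofReal_natCast]
  push_cast
  ring

end Moment

/-! ### Lower bounds for return probabilities and divergence of the Green function -/

section Divergence

variable {w : ℕ → ℝ≥0∞} {L : ℕ}

/-- Translation replaces the end points in the box for the start 0 by starting points in the box for
the end point 0. -/
theorem free_pow_box_le_sum (w : ℕ → ℝ≥0∞) (n R : ℕ) (e : Direction 2) :
    (free w ^ n) (ind (box R)) 0 e ≤
      ∑ s ∈ Finset.Icc (fun _ => -(R : ℤ)) (fun _ => (R : ℤ)), (free w ^ n) (ind {0}) s e := by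
  have h1 : ind (box R) ≤
      ∑ s ∈ Finset.Icc (fun _ => -(R : ℤ)) (fun _ => (R : ℤ)), shift s (ind {0}) := by
    intro y e'
    by_cases hy : y ∈ box R
    · rw [ind_of_mem hy, Finset.sum_apply, Finset.sum_apply]
      have hmem : -y ∈ Finset.Icc (fun _ : Fin 2 => -(R : ℤ)) (fun _ => (R : ℤ)) := by
        rw [Finset.mem_Icc]
        have h0 := abs_le.1 hy.1
        have h1 := abs_le.1 hy.2
        constructor <;> intro i <;> fin_cases i <;> simp <;> linarith
      refine le_trans ?_ (Finset.single_le_sum (f := fun s => shift s (ind {0}) y e')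
        (fun _ _ => zero_le) hmem)
      rw [shift_apply, ind_of_mem (by simp)]
    · rw [ind_of_notMem hy]; exact zero_le
  refine (leg_pow_mono n h1 0 e).trans (le_of_eq ?_)
  rw [map_sum, Finset.sum_apply, Finset.sum_apply]
  refine Finset.sum_congr rfl fun s _ => ?_
  have h2 := LinearMap.congr_fun ((free_shift w s).pow_left n).eq (ind {0})
  rw [Module.End.mul_apply, Module.End.mul_apply] at h2
  rw [h2, shift_apply, zero_add]

/-- After n legs at least half of the mass lies within distance of order L√n, a set `F` of at most
196 L²(n + 1) points. Cauchy-Schwarz and `sum_sq_le_return` give the bound, with 2352 = 3 * 4 * 196.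
-/
theorem le_return (hw : ∑' t, w t = 1) (hL : ∀ t, L < t → w t = 0) (hL0 : 0 < L) (n : ℕ) :
    ((2352 * L ^ 2 * (n + 1) : ℕ) : ℝ≥0∞)⁻¹ ≤ ∑ e, (free w ^ (2 * n)) (ind {0}) 0 e := by
  set k := Nat.sqrt n + 1 with hk
  have hk1 : n + 1 ≤ k ^ 2 := by
    rw [sq]
    exact Nat.lt_succ_sqrt n
  have hk2 : k ^ 2 ≤ 4 * (n + 1) := by
    have h1 := Nat.sqrt_le' n
    have h2 := Nat.sqrt_le_self n
    rw [hk]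
    nlinarith
  set R := L + 2 * L * k
  set e : Direction 2 := (0, true)
  set F : Finset (Fin 2 → ℤ) := Finset.Icc (fun _ => -(R : ℤ)) (fun _ => (R : ℤ))
  have hF : F.card ≤ 49 * L ^ 2 * (4 * (n + 1)) := by
    have h1 : F.card = (2 * R + 1) ^ 2 := by
      simp only [F, Pi.card_Icc, Int.card_Icc, Finset.prod_const, Finset.card_univ,
        Fintype.card_fin]
      congr 1
      omega
    have h2 : 2 * R + 1 ≤ 7 * L * k := by
      simp only [R]
      nlinarith [Nat.mul_le_mul hL0 (Nat.le_add_left 1 (Nat.sqrt n))]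
    calc F.card ≤ (7 * L * k) ^ 2 := by rw [h1]; gcongr
      _ = 49 * L ^ 2 * k ^ 2 := by ring
      _ ≤ _ := by gcongr
  have htail : (free w ^ n) (ind (box R)ᶜ) 0 e ≤ 2⁻¹ := by
    have h1 := free_pow_compl_box_moment_le hw hL n (2 * L * k) e
    have h2 : (((n + 1) * L ^ 2 : ℕ) : ℝ≥0∞) ≤ ((2 * L * k) ^ 2 : ℕ) * 2⁻¹ := by
      rw [← div_eq_mul_inv, ENNReal.le_div_iff_mul_le (by simp) (by simp)]
      have : (n + 1) * L ^ 2 * 2 ≤ (2 * L * k) ^ 2 := by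
        nlinarith [Nat.mul_le_mul_right (L ^ 2) hk1]
      exact_mod_cast this
    have hpos : (((2 * L * k) ^ 2 : ℕ) : ℝ≥0∞) ≠ 0 := by
      have : (2 * L * k) ^ 2 ≠ 0 := by positivity
      exact_mod_cast this
    exact (ENNReal.mul_le_mul_iff_right hpos (ENNReal.natCast_ne_top _)).1 (h1.trans h2)
  have hbox : 2⁻¹ ≤ (free w ^ n) (ind (box R)) 0 e := by
    have h1 : ind (box (R : ℤ)) + ind (box (R : ℤ))ᶜ = 1 := by
      funext s e
      simp only [ind, Pi.add_apply, Pi.one_apply]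
      exact congrFun (Set.indicator_self_add_compl (box (R : ℤ)) (1 : (Fin 2 → ℤ) → ℝ≥0∞)) s
    have h2 : (free w ^ n) 1 0 e = 1 := by
      have : (free w ^ n) 1 = 1 := by
        clear * - hw
        induction n with
        | zero => rfl
        | succ n ih => rw [pow_succ, Module.End.mul_apply, free_one hw, ih]
      rw [this]; rfl
    rw [← h1, map_add, Pi.add_apply, Pi.add_apply] at h2
    have h3 : (2⁻¹ : ℝ≥0∞) + 2⁻¹ = 1 := ENNReal.inv_two_add_inv_two
    rw [← ENNReal.add_le_add_iff_right (a := 2⁻¹) (by simp), h3, ← h2]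
    gcongr
  have hsq := sq_le_card_mul_sum_sq F fun s => (free w ^ n) (ind {0}) s e
  have hsum : 2⁻¹ ≤ ∑ s ∈ F, (free w ^ n) (ind {0}) s e :=
    hbox.trans (free_pow_box_le_sum w n R e)
  have hret := sum_sq_le_return w n F e
  set V := ∑ s ∈ F, (free w ^ n) (ind {0}) s e ^ 2
  set ret := ∑ e, (free w ^ (2 * n)) (ind {0}) 0 e
  have hne : ((2352 * L ^ 2 * (n + 1) : ℕ) : ℝ≥0∞) ≠ 0 := by
    have : 2352 * L ^ 2 * (n + 1) ≠ 0 := by positivity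
    exact_mod_cast this
  rw [ENNReal.inv_le_iff_le_mul (fun _ => hne) (fun h => absurd h (ENNReal.natCast_ne_top _))]
  have h4 : (4 : ℝ≥0∞)⁻¹ ≤ (49 * L ^ 2 * (4 * (n + 1)) : ℕ) * V := by
    calc (4 : ℝ≥0∞)⁻¹ = 2⁻¹ ^ 2 := by
          rw [← ENNReal.inv_pow]; norm_num
      _ ≤ _ := (pow_le_pow_left' hsum 2).trans (hsq.trans (by gcongr))
  calc (1 : ℝ≥0∞) = 12 * (3⁻¹ * 4⁻¹) := by
        rw [← ENNReal.mul_inv (by simp) (by simp)]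
        norm_num
        rw [ENNReal.mul_inv_cancel (by norm_num) (by norm_num)]
    _ ≤ 12 * (3⁻¹ * ((49 * L ^ 2 * (4 * (n + 1)) : ℕ) * V)) := by gcongr
    _ = ((2352 * L ^ 2 * (n + 1) : ℕ) : ℝ≥0∞) * (3⁻¹ * V) := by push_cast; ring
    _ ≤ _ := by gcongr

/-- The expected occupation of a box by a walk with bounded waiting times is infinite. -/
theorem exists_le_green (hw : ∑' t, w t = 1) (hL : ∀ t, L < t → w t = 0) (hL0 : 0 < L) (r C : ℕ) :
    ∃ N, (C : ℝ≥0∞) ≤ green w r N := by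
  -- The harmonic series diverges, and only the even numbers of legs are used.
  obtain ⟨M, hM⟩ := (Real.tendsto_sum_range_one_div_nat_succ_atTop.eventually_ge_atTop
    ((2352 * L ^ 2 * C : ℕ) : ℝ)).exists
  refine ⟨2 * M, ?_⟩
  have h1 : ∑ n ∈ Finset.range M, ∑ e, (free w ^ (2 * n)) (ind {0}) 0 e ≤ green w r (2 * M) := by
    rw [green, Finset.sum_comm]
    refine Finset.sum_le_sum fun e _ => ?_
    have hsub : ind {0} ≤ ind (box r) := ind_mono (by simp [box])
    refine le_trans ?_ (occ_mono_right _ hsub 0 e)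
    rw [occ_apply, ← Finset.sum_image (f := fun n => (free w ^ n) (ind {0}) 0 e)
      (g := fun n => 2 * n) (fun a _ b _ h => by simpa using h)]
    refine Finset.sum_le_sum_of_subset fun i hi => ?_
    obtain ⟨n, hn, rfl⟩ := Finset.mem_image.1 hi
    rw [Finset.mem_range] at *
    omega
  refine le_trans ?_ h1
  refine le_trans ?_ (Finset.sum_le_sum fun n _ => le_return hw hL hL0 n)
  have hpos : 0 < 2352 * L ^ 2 := by positivity
  have h2 : ∀ n : ℕ, ((2352 * L ^ 2 * (n + 1) : ℕ) : ℝ≥0∞)⁻¹ =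
      ENNReal.ofReal (((2352 * L ^ 2 : ℕ) : ℝ)⁻¹ * (1 / (n + 1))) := fun n => by
    rw [one_div, ← mul_inv, ENNReal.ofReal_inv_of_pos (by positivity)]
    congr 1
    rw [← Nat.cast_succ, ← Nat.cast_mul, ENNReal.ofReal_natCast]
  simp only [h2]
  rw [← ENNReal.ofReal_sum_of_nonneg fun n _ => by positivity, ← Finset.mul_sum,
    ← ENNReal.ofReal_natCast]
  refine ENNReal.ofReal_le_ofReal ?_
  have hpos' : (0 : ℝ) < ((2352 * L ^ 2 : ℕ) : ℝ) := by exact_mod_cast hpos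
  rw [← div_eq_inv_mul, le_div_iff₀ hpos']
  refine le_trans (le_of_eq ?_) hM
  push_cast
  ring

end Divergence


/-! ### The trajectory -/

/-- The position at the start of leg `n`. -/
def pos (D : ℕ → Direction 2) (T : ℕ → ℕ) (n : ℕ) : Fin 2 → ℤ :=
  ∑ i ∈ Finset.range n, T i • (D i).vec

theorem pos_succ (D : ℕ → Direction 2) (T : ℕ → ℕ) (n : ℕ) :
    pos D T (n + 1) = pos D T n + T n • (D n).vec := Finset.sum_range_succ _ _

theorem pos_congr {D D' : ℕ → Direction 2} {T T' : ℕ → ℕ} {n : ℕ}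
    (h : ∀ i < n, D i = D' i ∧ T i = T' i) : pos D T n = pos D' T' n :=
  Finset.sum_congr rfl fun i hi => by
    rw [(h i (Finset.mem_range.1 hi)).1, (h i (Finset.mem_range.1 hi)).2]

theorem startTime_succ (T : ℕ → ℕ) (i : ℕ) : startTime T (i + 1) = startTime T i + T i :=
  Finset.sum_range_succ _ _

theorem startTime_mono (T : ℕ → ℕ) : Monotone (startTime T) :=
  monotone_nat_of_le_succ fun i => by rw [startTime_succ]; omega

theorem legAt_eq {T : ℕ → ℕ} {i s : ℕ} (h₁ : startTime T i ≤ s) (h₂ : s < startTime T (i + 1)) :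
    legAt T s = i := by
  refine le_antisymm (Nat.sInf_le h₂) (le_csInf ⟨i, h₂⟩ fun k hk => ?_)
  by_contra hlt
  push Not at hlt
  have := startTime_mono T (show k + 1 ≤ i by omega)
  have hk' : s < startTime T (k + 1) := hk
  omega

theorem walk_startTime_add (D : ℕ → Direction 2) (T : ℕ → ℕ) (i j : ℕ) (hj : j ≤ T i) :
    walk D T (startTime T i + j) = pos D T i + j • (D i).vec := by
  induction i generalizing j with
  | zero =>
    induction j with
    | zero => simp [startTime, walk, pos]
    | succ j ih =>
      rw [← add_assoc, walk, ih (by omega), legAt_eq (i := 0) (by omega)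
        (by rw [startTime_succ]; omega), succ_nsmul, add_assoc]
  | succ i ihi =>
    induction j with
    | zero =>
      rw [add_zero, startTime_succ, ihi _ le_rfl, pos_succ]
      simp
    | succ j ih =>
      rw [← add_assoc, walk, ih (by omega), legAt_eq (i := i + 1) (by omega)
        (by rw [startTime_succ T (i + 1)]; omega), succ_nsmul, add_assoc]

theorem turnLocation_eq (D : ℕ → Direction 2) (T : ℕ → ℕ) (i : ℕ) :
    turnLocation D T i = pos D T (i + 1) := by
  rw [turnLocation, startTime_succ, walk_startTime_add D T i _ le_rfl, pos_succ]

/-- `Crosses` requires the origin to be met strictly before the end of the leg, so `legAt` recovers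
the leg from the time and different legs give different times. -/
theorem infinite_zeros {D : ℕ → Direction 2} {T : ℕ → ℕ}
    (h : ∀ n, ∃ i ≥ n, Crosses (pos D T i) (D i) (T i)) : {m : ℕ | walk D T m = 0}.Infinite := by
  have h1 : {i | Crosses (pos D T i) (D i) (T i)}.Infinite :=
    Set.infinite_of_forall_exists_gt fun n => by
      obtain ⟨i, hi, hc⟩ := h (n + 1)
      exact ⟨i, hc, hi⟩
  have h2 : ∀ i ∈ {i | Crosses (pos D T i) (D i) (T i)}, ∃ m, legAt T m = i ∧ walk D T m = 0 := by
    rintro i ⟨j, hj, hz⟩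
    refine ⟨startTime T i + j, legAt_eq (by omega) (by rw [startTime_succ]; omega), ?_⟩
    rw [walk_startTime_add D T i j hj.le, hz]
  intro hfin
  refine h1 ((hfin.image (legAt T)).subset fun i hi => ?_)
  obtain ⟨m, hm, hm0⟩ := h2 i hi
  exact ⟨m, hm0, hm⟩

/-! ### The Markov property -/

section Markov

variable {Ω : Type*} [MeasurableSpace Ω] {P : Measure Ω} {μ : PMF ℕ} {D : ℕ → Ω → Direction 2}
  {T : ℕ → Ω → ℕ}

theorem measure_eq_tsum_wait (hT : ∀ i, Measurable (T i)) (k : ℕ) {S : Set Ω}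
    (hS : MeasurableSet S) : P S = ∑' t, P (S ∩ {ω | T k ω = t}) := by
  rw [← measure_iUnion]
  · congr 1
    ext ω
    simp
  · intro t t' htt'
    refine Set.disjoint_left.2 fun ω h h' => htt' (h.2.symm.trans h'.2)
  · exact fun t => hS.inter (hT k (measurableSet_singleton t))

theorem measurableSet_prefix (hD : ∀ i, Measurable (D i)) (hT : ∀ i, Measurable (T i)) (n : ℕ)
    (e : ℕ → Direction 2) (t : ℕ → ℕ) :
    MeasurableSet {ω | ∀ i < n, D i ω = e i ∧ T i ω = t i} := by
  have : {ω | ∀ i < n, D i ω = e i ∧ T i ω = t i} =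
      ⋂ i, ⋂ (_ : i < n), ({ω | D i ω = e i} ∩ {ω | T i ω = t i}) := by
    ext ω; simp
  rw [this]
  exact MeasurableSet.iInter fun i => MeasurableSet.iInter fun _ =>
    (hD i (measurableSet_singleton _)).inter (hT i (measurableSet_singleton _))

/-- Given the past, the next direction is uniform among those different from the current one. -/
theorem measure_prefix_dir (h : IsDirReinforced μ P D T) (n : ℕ) (e : ℕ → Direction 2)
    (t : ℕ → ℕ) :
    P ({ω | ∀ i < n + 1, D i ω = e i ∧ T i ω = t i} ∩ {ω | D (n + 1) ω = e (n + 1)}) =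
      P {ω | ∀ i < n + 1, D i ω = e i ∧ T i ω = t i} *
        (if e (n + 1) = e n then 0 else 3⁻¹) := by
  have hS : MeasurableSet ({ω | ∀ i < n + 1, D i ω = e i ∧ T i ω = t i} ∩
      {ω | D (n + 1) ω = e (n + 1)}) :=
    (measurableSet_prefix h.measurable_dir h.measurable_wait _ _ _).inter
      (h.measurable_dir _ (measurableSet_singleton _))
  rw [measure_eq_tsum_wait h.measurable_wait (n + 1) hS]
  have h1 : ∀ s, P ({ω | ∀ i < n + 1, D i ω = e i ∧ T i ω = t i} ∩
      {ω | D (n + 1) ω = e (n + 1)} ∩ {ω | T (n + 1) ω = s}) =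
      P {ω | ∀ i < n + 1, D i ω = e i ∧ T i ω = t i} *
        (if e (n + 1) = e n then 0 else 3⁻¹) * μ s := by
    intro s
    have h2 := h.law_succ n e (Function.update t (n + 1) s)
    have h3 : {ω | ∀ i ≤ n + 1, D i ω = e i ∧ T i ω = Function.update t (n + 1) s i} =
        {ω | ∀ i < n + 1, D i ω = e i ∧ T i ω = t i} ∩
          {ω | D (n + 1) ω = e (n + 1)} ∩ {ω | T (n + 1) ω = s} := by
      ext ω
      simp only [Set.mem_inter_iff, Set.mem_ofPred_eq]
      constructor
      · intro hω
        have := hω (n + 1) le_rfl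
        rw [Function.update_self] at this
        refine ⟨⟨fun i hi => ?_, this.1⟩, this.2⟩
        have := hω i hi.le
        rwa [Function.update_of_ne hi.ne] at this
      · rintro ⟨⟨hω, h4⟩, h5⟩ i hi
        rcases hi.lt_or_eq with hlt | rfl
        · rw [Function.update_of_ne hlt.ne]
          exact hω i hlt
        · rw [Function.update_self]
          exact ⟨h4, h5⟩
    have h4 : {ω | ∀ i ≤ n, D i ω = e i ∧ T i ω = Function.update t (n + 1) s i} =
        {ω | ∀ i < n + 1, D i ω = e i ∧ T i ω = t i} := by
      ext ω
      simp only [Set.mem_ofPred_eq]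
      refine forall_congr' fun i => ?_
      rw [Nat.lt_succ_iff]
      refine imp_congr_right fun hi => ?_
      rw [Function.update_of_ne (by omega)]
    rw [h3, h4, Function.update_self] at h2
    rw [h2, ← mul_assoc]
    norm_num
  simp only [h1]
  rw [ENNReal.tsum_mul_left, μ.tsum_coe, mul_one]

/-- The waiting time is independent of the past and of the current direction. -/
theorem measure_prefix_wait (h : IsDirReinforced μ P D T) (n : ℕ) (e : ℕ → Direction 2)
    (t : ℕ → ℕ) :
    P {ω | ∀ i < n + 1, D i ω = e i ∧ T i ω = t i} =
      P ({ω | ∀ i < n, D i ω = e i ∧ T i ω = t i} ∩ {ω | D n ω = e n}) * μ (t n) := by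
  cases n with
  | zero =>
    have := h.law_zero (e 0) (t 0)
    simpa using this
  | succ n =>
    have h1 := h.law_succ n e t
    rw [measure_prefix_dir h]
    simp only [← Nat.lt_succ_iff] at h1
    rw [h1, ← mul_assoc]
    norm_num

/-- The directions and waiting times of the first `n` legs. -/
def history (D : ℕ → Ω → Direction 2) (T : ℕ → Ω → ℕ) (n : ℕ) (ω : Ω) : Fin n → Direction 2 × ℕ :=
  fun i => (D i ω, T i ω)

theorem measurable_history (hD : ∀ i, Measurable (D i)) (hT : ∀ i, Measurable (T i)) (n : ℕ) :
    Measurable (history D T n) :=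
  measurable_pi_lambda _ fun i => (hD i).prodMk (hT i)

theorem measure_history (h : IsDirReinforced μ P D T) (n : ℕ) (p : Fin n → Direction 2 × ℕ)
    (e e' : Direction 2) (t : ℕ) :
    P {ω | history D T n ω = p ∧ D n ω = e ∧ T n ω = t ∧ D (n + 1) ω = e'} =
      P {ω | history D T n ω = p ∧ D n ω = e} * (μ t * (if e' = e then 0 else 3⁻¹)) := by
  -- The finite history and the two prescribed directions are extended to infinite sequences; the
  -- values after the indices in question play no role.
  set es : ℕ → Direction 2 := fun i => if hi : i < n then (p ⟨i, hi⟩).1 else if i = n then e else e'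
    with hes
  set ts : ℕ → ℕ := fun i => if hi : i < n then (p ⟨i, hi⟩).2 else t with hts
  have h1 := measure_prefix_dir h n es ts
  rw [measure_prefix_wait h n es ts] at h1
  have hen : es n = e := by simp [hes]
  have hen1 : es (n + 1) = e' := by simp [hes]
  have htn : ts n = t := by simp [hts]
  have hpre : ∀ ω, history D T n ω = p ↔ ∀ i < n, D i ω = es i ∧ T i ω = ts i := by
    intro ω
    rw [funext_iff, Fin.forall_iff]
    refine forall_congr' fun i => forall_congr' fun hi => ?_
    rw [Prod.ext_iff]
    simp only [history, hes, hts, dif_pos hi]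
  have hA : {ω | history D T n ω = p ∧ D n ω = e} =
      {ω | ∀ i < n, D i ω = es i ∧ T i ω = ts i} ∩ {ω | D n ω = es n} := by
    ext ω
    simp only [Set.mem_ofPred_eq, Set.mem_inter_iff, hpre, hen]
  have hB : {ω | history D T n ω = p ∧ D n ω = e ∧ T n ω = t ∧ D (n + 1) ω = e'} =
      {ω | ∀ i < n + 1, D i ω = es i ∧ T i ω = ts i} ∩ {ω | D (n + 1) ω = es (n + 1)} := by
    ext ω
    simp only [Set.mem_ofPred_eq, Set.mem_inter_iff, hpre, hen1, Nat.forall_lt_succ_right, hen, htn]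
    tauto
  rw [hA, hB, h1, hen, hen1, htn, mul_assoc]

theorem lintegral_comp_countable {X : Type*} [MeasurableSpace X] [Countable X]
    [MeasurableSingletonClass X] {Y : Ω → X} (hY : Measurable Y) (g : X → ℝ≥0∞) :
    ∫⁻ ω, g (Y ω) ∂P = ∑' x, g x * P {ω | Y ω = x} := by
  rw [← lintegral_map (measurable_of_countable g) hY, lintegral_countable']
  refine tsum_congr fun x => ?_
  rw [Measure.map_apply hY (measurableSet_singleton x)]
  rfl

theorem lintegral_markov (h : IsDirReinforced μ P D T) (n : ℕ)
    (g : (Fin n → Direction 2 × ℕ) → Direction 2 → ℕ → Direction 2 → ℝ≥0∞) :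
    ∫⁻ ω, g (history D T n ω) (D n ω) (T n ω) (D (n + 1) ω) ∂P =
      ∫⁻ ω, ∑' t, μ t * (3⁻¹ * ∑ e', if e' = D n ω then 0 else
        g (history D T n ω) (D n ω) t e') ∂P := by
  have hX := measurable_history h.measurable_dir h.measurable_wait n
  have h1 := lintegral_comp_countable (P := P)
    (hX.prodMk ((h.measurable_dir n).prodMk ((h.measurable_wait n).prodMk
      (h.measurable_dir (n + 1))))) fun x => g x.1 x.2.1 x.2.2.1 x.2.2.2
  have h2 := lintegral_comp_countable (P := P) (hX.prodMk (h.measurable_dir n))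
    fun x => ∑' t, μ t * (3⁻¹ * ∑ e', if e' = x.2 then 0 else g x.1 x.2 t e')
  simp only at h1 h2
  rw [h1, h2, ENNReal.tsum_prod', ENNReal.tsum_prod']
  refine tsum_congr fun p => ?_
  rw [ENNReal.tsum_prod']
  refine tsum_congr fun e => ?_
  rw [ENNReal.tsum_prod', ← ENNReal.tsum_mul_right]
  refine tsum_congr fun t => ?_
  rw [tsum_fintype, Finset.mul_sum, Finset.mul_sum, Finset.sum_mul]
  refine Finset.sum_congr rfl fun e' _ => ?_
  simp only [Prod.mk.injEq]
  rw [measure_history h]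
  split_ifs
  · simp
  · ring

/-- `n` legs with restrictions `A 0, …, A (n - 1)`. -/
noncomputable def legs (w : ℕ → ℝ≥0∞) (A : ℕ → (Fin 2 → ℤ) → Direction 2 → ℕ → Prop) :
    ℕ → Module.End ℝ≥0∞ Obs
  | 0 => 1
  | n + 1 => legs w A n * leg w (A n)

-- The bridge from the process to the operators: integrating out the last leg by the Markov property
-- applies `leg` once to `f`.
open scoped Classical in
theorem lintegral_legs (h : IsDirReinforced μ P D T)
    (A : ℕ → (Fin 2 → ℤ) → Direction 2 → ℕ → Prop) (n : ℕ) (f : Obs) :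
    ∫⁻ ω, (if ∀ i < n, A i (pos (D · ω) (T · ω) i) (D i ω) (T i ω) then
        f (pos (D · ω) (T · ω) n) (D n ω) else 0) ∂P =
      ∑ e, P {ω | D 0 ω = e} * legs μ A n f 0 e := by
  induction n generalizing f with
  | zero =>
    have h1 := lintegral_comp_countable (P := P) (h.measurable_dir 0) (f 0)
    simp only [not_lt_zero, false_imp_iff, implies_true, if_true, pos, Finset.range_zero,
      Finset.sum_empty]
    rw [h1, tsum_fintype]
    exact Finset.sum_congr rfl fun e _ => mul_comm _ _
  | succ n ih =>
    rw [legs, Module.End.mul_apply, ← ih]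
    -- The path is rebuilt from the history, with arbitrary values from index `n` on, so that the
    -- integrand has the form required by `lintegral_markov`.
    set dir : (Fin n → Direction 2 × ℕ) → ℕ → Direction 2 :=
      fun p i => if hi : i < n then (p ⟨i, hi⟩).1 else (0, true) with hdir
    set wait : (Fin n → Direction 2 × ℕ) → ℕ → ℕ :=
      fun p i => if hi : i < n then (p ⟨i, hi⟩).2 else 0 with hwait
    have hpre : ∀ ω, ∀ i < n, dir (history D T n ω) i = D i ω ∧ wait (history D T n ω) i = T i ω :=
      fun ω i hi => by simp [hdir, hwait, history, hi]
    have hpos : ∀ ω, ∀ i ≤ n, pos (dir (history D T n ω)) (wait (history D T n ω)) i =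
        pos (D · ω) (T · ω) i := fun ω i hi => pos_congr fun j hj => hpre ω j (by omega)
    have hall : ∀ ω, (∀ i < n, A i (pos (dir (history D T n ω)) (wait (history D T n ω)) i)
        (dir (history D T n ω) i) (wait (history D T n ω) i)) ↔
        ∀ i < n, A i (pos (D · ω) (T · ω) i) (D i ω) (T i ω) := fun ω =>
      forall_congr' fun i => forall_congr' fun hi => by
        rw [hpos ω i hi.le, (hpre ω i hi).1, (hpre ω i hi).2]
    have hm := lintegral_markov h n fun p e t e' =>
      if (∀ i < n, A i (pos (dir p) (wait p) i) (dir p i) (wait p i)) ∧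
          A n (pos (dir p) (wait p) n) e t then
        f (pos (dir p) (wait p) n + t • e.vec) e' else 0
    simp only [hall, hpos _ n le_rfl] at hm
    calc _ = _ := by
          refine lintegral_congr fun ω => ?_
          rw [pos_succ]
          simp only [Nat.forall_lt_succ_right]
      _ = _ := hm
      _ = _ := by
          refine lintegral_congr fun ω => ?_
          by_cases hω : ∀ i < n, A i (pos (D · ω) (T · ω) i) (D i ω) (T i ω)
          · rw [if_pos hω, leg_apply]
            refine tsum_congr fun t => ?_
            rw [turn_apply]
            by_cases ht : A n (pos (D · ω) (T · ω) n) (D n ω) t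
            · rw [if_pos ht]
              refine congrArg (fun x => μ t * (3⁻¹ * x)) (Finset.sum_congr rfl fun e' _ => ?_)
              rcases eq_or_ne e' (D n ω) with he | he
              · rw [if_pos he, if_pos he]
              · rw [if_neg he, if_neg he, if_pos ⟨hω, ht⟩]
            · simp [ht]
          · simp [hω]

theorem legs_eq (w : ℕ → ℝ≥0∞) (B : (Fin 2 → ℤ) → Direction 2 → ℕ → Prop) (n m : ℕ) :
    legs w (fun i s e t => n ≤ i → B s e t) (n + m) = free w ^ n * leg w B ^ m := by
  have h0 : ∀ k ≤ n, legs w (fun i s e t => n ≤ i → B s e t) k = free w ^ k := by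
    intro k hk
    induction k with
    | zero => rfl
    | succ k ih =>
      have h1 : ∀ s e t, (n ≤ k → B s e t) = True := fun s e t => by
        simp only [eq_iff_iff, iff_true]
        omega
      rw [legs, ih (by omega), pow_succ]
      simp only [h1]
  induction m with
  | zero => rw [add_zero, h0 n le_rfl, pow_zero, mul_one]
  | succ m ih =>
    have h1 : ∀ s e t, (n ≤ n + m → B s e t) = B s e t := fun s e t => by simp
    rw [← add_assoc, legs, ih, pow_succ, mul_assoc]
    simp only [h1]

theorem measurableSet_exists_leg (h : IsDirReinforced μ P D T)
    (B : (Fin 2 → ℤ) → Direction 2 → ℕ → Prop) (n m : ℕ) :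
    MeasurableSet {ω | ∃ i, n ≤ i ∧ i < n + m ∧ B (pos (D · ω) (T · ω) i) (D i ω) (T i ω)} := by
  have h1 : ∀ i, MeasurableSet {ω | B (pos (D · ω) (T · ω) i) (D i ω) (T i ω)} := by
    intro i
    have hm : Measurable fun ω => (pos (D · ω) (T · ω) i, D i ω, T i ω) := by
      refine Measurable.prodMk ?_ ((h.measurable_dir i).prodMk (h.measurable_wait i))
      unfold pos
      refine Finset.measurable_fun_sum _ fun j _ => ?_
      exact (measurable_of_countable (fun x : Direction 2 × ℕ => x.2 • x.1.vec)).comp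
        ((h.measurable_dir j).prodMk (h.measurable_wait j))
    exact hm (Set.to_countable
      {x : (Fin 2 → ℤ) × Direction 2 × ℕ | B x.1 x.2.1 x.2.2}).measurableSet
  have h2 : {ω | ∃ i, n ≤ i ∧ i < n + m ∧ B (pos (D · ω) (T · ω) i) (D i ω) (T i ω)} =
      ⋃ i, ⋃ (_ : n ≤ i ∧ i < n + m), {ω | B (pos (D · ω) (T · ω) i) (D i ω) (T i ω)} := by
    ext ω; simp [and_assoc]
  rw [h2]
  exact MeasurableSet.iUnion fun i => MeasurableSet.iUnion fun _ => h1 i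

theorem measure_forall_legs [IsProbabilityMeasure P] (h : IsDirReinforced μ P D T)
    (B : (Fin 2 → ℤ) → Direction 2 → ℕ → Prop) (n m : ℕ) :
    P {ω | ∃ i, n ≤ i ∧ i < n + m ∧ B (pos (D · ω) (T · ω) i) (D i ω) (T i ω)}ᶜ =
      ∑ e, P {ω | D 0 ω = e} * (free μ ^ n) ((leg μ (fun s e t => ¬ B s e t) ^ m) 1) 0 e := by
  classical
  have h1 := lintegral_legs h (fun i s e t => n ≤ i → ¬ B s e t) (n + m) 1
  simp only [legs_eq, Module.End.mul_apply] at h1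
  rw [← h1, ← lintegral_indicator_one (measurableSet_exists_leg h B n m).compl]
  refine lintegral_congr fun ω => ?_
  have hiff : ω ∈ {ω | ∃ i, n ≤ i ∧ i < n + m ∧ B (pos (D · ω) (T · ω) i) (D i ω) (T i ω)}ᶜ ↔
      ∀ i < n + m, n ≤ i → ¬ B (pos (D · ω) (T · ω) i) (D i ω) (T i ω) := by
    simp only [Set.mem_compl_iff, Set.mem_ofPred_eq, not_exists, not_and]
    exact forall_congr' fun i => ⟨fun h a b => h b a, fun h a b => h b a⟩
  by_cases hω : ∀ i < n + m, n ≤ i → ¬ B (pos (D · ω) (T · ω) i) (D i ω) (T i ω)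
  · rw [Set.indicator_of_mem (hiff.2 hω), if_pos hω]
    rfl
  · rw [Set.indicator_of_notMem (mt hiff.1 hω), if_neg hω]

theorem sum_measure_dir [IsProbabilityMeasure P] (h : IsDirReinforced μ P D T) :
    ∑ e, P {ω | D 0 ω = e} = 1 := by
  have h1 := lintegral_comp_countable (P := P) (h.measurable_dir 0) 1
  rw [tsum_fintype] at h1
  simpa using h1.symm

theorem measure_exists_leg [IsProbabilityMeasure P] (h : IsDirReinforced μ P D T)
    (B : (Fin 2 → ℤ) → Direction 2 → ℕ → Prop) (n m : ℕ) {c : ℝ≥0∞}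
    (hc : ∀ e, (free μ ^ n) (hit μ B m) 0 e ≤ c) :
    P {ω | ∃ i, n ≤ i ∧ i < n + m ∧ B (pos (D · ω) (T · ω) i) (D i ω) (T i ω)} ≤ c := by
  set S := {ω | ∃ i, n ≤ i ∧ i < n + m ∧ B (pos (D · ω) (T · ω) i) (D i ω) (T i ω)} with hS
  have h1 := measure_forall_legs h B n m
  rw [← hS] at h1
  have h2 : ∀ e, (free μ ^ n) (hit μ B m) 0 e +
      (free μ ^ n) ((leg μ (fun s e t => ¬ B s e t) ^ m) 1) 0 e = 1 := by
    intro e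
    rw [← Pi.add_apply, ← Pi.add_apply, ← map_add, hit_add_avoid μ.tsum_coe]
    have : (free μ ^ n) 1 = 1 := by
      clear * -
      induction n with
      | zero => rfl
      | succ n ih => rw [pow_succ, Module.End.mul_apply, free_one μ.tsum_coe, ih]
    rw [this]; rfl
  have h3 : 1 ≤ c + P Sᶜ := by
    calc (1 : ℝ≥0∞) = ∑ e, P {ω | D 0 ω = e} * ((free μ ^ n) (hit μ B m) 0 e +
          (free μ ^ n) ((leg μ (fun s e t => ¬ B s e t) ^ m) 1) 0 e) := by
          simp only [h2, mul_one, sum_measure_dir h]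
      _ ≤ ∑ e, (P {ω | D 0 ω = e} * c + P {ω | D 0 ω = e} *
          (free μ ^ n) ((leg μ (fun s e t => ¬ B s e t) ^ m) 1) 0 e) := by
          refine Finset.sum_le_sum fun e _ => ?_
          rw [mul_add]
          gcongr
          exact hc e
      _ = _ := by
          rw [Finset.sum_add_distrib, ← Finset.sum_mul, sum_measure_dir h, one_mul, ← h1]
  have h4 := prob_add_prob_compl (μ := P) (measurableSet_exists_leg h B n m)
  rw [← hS] at h4
  rw [← h4] at h3
  exact (ENNReal.add_le_add_iff_right (measure_ne_top P _)).1 h3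

end Markov


/-! ### The waiting time law -/

/-- The weights `w`, with the missing mass put at `0`. -/
noncomputable def fill (w : ℕ → ℝ≥0∞) (t : ℕ) : ℝ≥0∞ := w t + if t = 0 then 1 - ∑' s, w s else 0

theorem tsum_fill {w : ℕ → ℝ≥0∞} (hw : ∑' t, w t ≤ 1) : ∑' t, fill w t = 1 := by
  simp only [fill]
  rw [ENNReal.tsum_add, tsum_ite_eq, add_tsub_cancel_of_le hw]

theorem fill_of_pos {w : ℕ → ℝ≥0∞} {t : ℕ} (ht : 0 < t) : fill w t = w t := by
  simp [fill, ht.ne']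

theorem fill_zero {w : ℕ → ℝ≥0∞} (h : w 0 = 0) : fill w 0 = 1 - ∑' s, w s := by
  simp [fill, h]

/-- A stage of the construction: the largest length `len` and the weights `wt` of the legs
introduced so far, and a number `time` of legs during which no longer legs are to be expected. -/
structure Stage where
  len : ℕ
  time : ℕ
  wt : ℕ → ℝ≥0∞

namespace Stage

/-- The inverse of the mass of the group of lengths which is introduced next. -/
def rarity (k : ℕ) (σ : Stage) : ℕ := 2 ^ (k + 3) * σ.time

/-- A quarter of the number of lengths in the group which is introduced next. -/
def size (k : ℕ) (σ : Stage) : ℕ := 10 ^ 9 * 16 ^ k * σ.rarity k ^ 2 * (σ.len + 1)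

/-- The weight of each length in the group which is introduced next. -/
noncomputable def weight (k : ℕ) (σ : Stage) : ℝ≥0∞ :=
  ((σ.rarity k * (4 * σ.size k) : ℕ) : ℝ≥0∞)⁻¹

/-- The weights of all lengths after the introduction of the next group. -/
noncomputable def nextWt (k : ℕ) (σ : Stage) (t : ℕ) : ℝ≥0∞ :=
  σ.wt t + if σ.len < t ∧ t ≤ σ.len + 4 * σ.size k then σ.weight k else 0

/-- The number of legs after which a prescribed occupation of a box is to be expected. -/
noncomputable def span (k : ℕ) (σ : Stage) : ℕ :=
  sInf {N | ((4 * 10 ^ 5 * σ.size k * σ.rarity k ^ 2 : ℕ) : ℝ≥0∞) ≤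
    green (fill (σ.nextWt k)) (σ.size k) N}

end Stage

/-- The stages of the construction. -/
noncomputable def stage : ℕ → Stage
  | 0 => ⟨0, 1, 0⟩
  | k + 1 => ⟨(stage k).len + 4 * (stage k).size k, (stage k).time + (stage k).span k + 1,
      (stage k).nextWt k⟩

/-- The largest length before group `k`. -/
noncomputable def len (k : ℕ) : ℕ := (stage k).len
/-- The number of legs before the phase of group `k`. -/
noncomputable def time (k : ℕ) : ℕ := (stage k).time
/-- The inverse mass of group `k`. -/
noncomputable def rarity (k : ℕ) : ℕ := (stage k).rarity k
/-- A quarter of the cardinality of group `k`. -/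
noncomputable def size (k : ℕ) : ℕ := (stage k).size k
/-- The weight of the lengths in group `k`. -/
noncomputable def weight (k : ℕ) : ℝ≥0∞ := (stage k).weight k
/-- The number of legs in the phase of group `k`. -/
noncomputable def span (k : ℕ) : ℕ := (stage k).span k
/-- The weights of the lengths in the groups before `k`. -/
noncomputable def partialWt (k : ℕ) : ℕ → ℝ≥0∞ := (stage k).wt

theorem len_zero : len 0 = 0 := rfl
theorem len_succ (k : ℕ) : len (k + 1) = len k + 4 * size k := rfl
theorem time_zero : time 0 = 1 := rfl
theorem time_succ (k : ℕ) : time (k + 1) = time k + span k + 1 := rfl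
theorem rarity_eq (k : ℕ) : rarity k = 2 ^ (k + 3) * time k := rfl
theorem size_eq (k : ℕ) : size k = 10 ^ 9 * 16 ^ k * rarity k ^ 2 * (len k + 1) := rfl
theorem weight_eq (k : ℕ) : weight k = ((rarity k * (4 * size k) : ℕ) : ℝ≥0∞)⁻¹ := rfl

/-- The weight at `t` due to group `k`. -/
noncomputable def groupWt (k t : ℕ) : ℝ≥0∞ := if len k < t ∧ t ≤ len (k + 1) then weight k else 0

theorem partialWt_succ (k t : ℕ) : partialWt (k + 1) t = partialWt k t + groupWt k t := rfl

theorem partialWt_eq (k t : ℕ) : partialWt k t = ∑ j ∈ Finset.range k, groupWt j t := by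
  induction k with
  | zero => rfl
  | succ k ih => rw [partialWt_succ, ih, Finset.sum_range_succ]

theorem span_eq (k : ℕ) : span k = sInf {N | ((4 * 10 ^ 5 * size k * rarity k ^ 2 : ℕ) : ℝ≥0∞) ≤
    green (fill (partialWt (k + 1))) (size k) N} := rfl

/-- The total weights, without the mass at `0`. -/
noncomputable def totalWt (t : ℕ) : ℝ≥0∞ := ∑' k, groupWt k t

theorem time_pos (k : ℕ) : 0 < time k := by
  cases k with
  | zero => simp [time_zero]
  | succ k => rw [time_succ]; omega

theorem time_strictMono : StrictMono time :=
  strictMono_nat_of_lt_succ fun k => by rw [time_succ]; omega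

theorem rarity_pos (k : ℕ) : 0 < rarity k := by
  rw [rarity_eq]
  exact Nat.mul_pos (by positivity) (time_pos k)

theorem size_pos (k : ℕ) : 0 < size k := by
  rw [size_eq]
  have := rarity_pos k
  positivity

theorem len_strictMono : StrictMono len :=
  strictMono_nat_of_lt_succ fun k => by rw [len_succ]; have := size_pos k; omega

theorem rarity_mono : Monotone rarity := fun j k h => by
  rw [rarity_eq, rarity_eq]
  exact Nat.mul_le_mul (Nat.pow_le_pow_right (by norm_num) (by omega)) (time_strictMono.monotone h)

theorem size_mono : Monotone size := fun j k h => by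
  rw [size_eq, size_eq]
  have h1 := rarity_mono h
  have h2 := len_strictMono.monotone h
  have h3 : 16 ^ j ≤ 16 ^ k := Nat.pow_le_pow_right (by norm_num) h
  gcongr

theorem weight_anti : Antitone weight := fun j k h => by
  rw [weight_eq, weight_eq, ENNReal.inv_le_inv]
  have h1 := rarity_mono h
  have h2 := size_mono h
  exact_mod_cast Nat.mul_le_mul h1 (Nat.mul_le_mul_left 4 h2)

theorem time_le_rarity (k : ℕ) : time k ≤ rarity k := by
  rw [rarity_eq]
  exact Nat.le_mul_of_pos_left _ (by positivity)

theorem sq_mul_len_le_size (k : ℕ) : rarity k ^ 2 * (len k + 1) ≤ size k := by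
  rw [size_eq, mul_assoc]
  exact Nat.le_mul_of_pos_left _ (by positivity)

theorem len_le_size (k : ℕ) : len k ≤ size k := by
  have h := sq_mul_len_le_size k
  have := rarity_pos k
  nlinarith [Nat.le_mul_of_pos_left (len k + 1) (show 0 < rarity k ^ 2 by positivity)]

theorem time_mul_len_le_size (k : ℕ) : time k * len k ≤ size k := by
  refine le_trans ?_ (sq_mul_len_le_size k)
  have h1 := time_le_rarity k
  have h2 := rarity_pos k
  refine Nat.mul_le_mul (h1.trans ?_) (Nat.le_succ _)
  nlinarith

theorem exists_group {t : ℕ} (ht : 0 < t) : ∃ k, len k < t ∧ t ≤ len (k + 1) := by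
  have h : ∃ k, t ≤ len (k + 1) := ⟨t, (len_strictMono.id_le t).trans
    (len_strictMono.monotone t.le_succ)⟩
  classical
  refine ⟨Nat.find h, ?_, Nat.find_spec h⟩
  rcases Nat.eq_zero_or_pos (Nat.find h) with h0 | h0
  · rw [h0, len_zero]; exact ht
  · have := Nat.find_min h (m := Nat.find h - 1) (by omega)
    rw [Nat.sub_add_cancel h0] at this
    omega

theorem groupWt_eq_zero_of_lt {j k t : ℕ} (h : j < k) (ht : len k < t) : groupWt j t = 0 := by
  have := len_strictMono.monotone (show j + 1 ≤ k by omega)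
  exact if_neg fun h' => by omega

theorem groupWt_eq_zero_of_le {j k t : ℕ} (h : k ≤ j) (ht : t ≤ len k) : groupWt j t = 0 := by
  have := len_strictMono.monotone h
  exact if_neg fun h' => by omega

theorem totalWt_eq_weight {k t : ℕ} (h₁ : len k < t) (h₂ : t ≤ len (k + 1)) :
    totalWt t = weight k := by
  rw [totalWt, tsum_eq_single k, groupWt, if_pos ⟨h₁, h₂⟩]
  intro j hj
  rcases lt_or_gt_of_ne hj with h | h
  · exact groupWt_eq_zero_of_lt h h₁
  · exact groupWt_eq_zero_of_le h h₂

theorem totalWt_zero : totalWt 0 = 0 :=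
  ENNReal.tsum_eq_zero.2 fun j => groupWt_eq_zero_of_le (Nat.zero_le j) (by simp)

theorem totalWt_eq_partialWt {k t : ℕ} (ht : t ≤ len k) : totalWt t = partialWt k t := by
  rw [totalWt, partialWt_eq, tsum_eq_sum (s := Finset.range k) fun j hj =>
    groupWt_eq_zero_of_le (by simpa using hj) ht]

theorem partialWt_eq_zero {k t : ℕ} (ht : len k < t) : partialWt k t = 0 := by
  rw [partialWt_eq]
  exact Finset.sum_eq_zero fun j hj => groupWt_eq_zero_of_lt (Finset.mem_range.1 hj) ht

theorem partialWt_zero (k : ℕ) : partialWt k 0 = 0 := by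
  rw [← totalWt_eq_partialWt (Nat.zero_le _), totalWt_zero]

theorem weight_le_totalWt {k t : ℕ} (h₀ : 0 < t) (ht : t ≤ len (k + 1)) : weight k ≤ totalWt t := by
  obtain ⟨j, h₁, h₂⟩ := exists_group h₀
  rw [totalWt_eq_weight h₁ h₂]
  refine weight_anti ?_
  by_contra h
  have := len_strictMono.monotone (show k + 1 ≤ j by omega)
  omega

theorem totalWt_le_weight {k t : ℕ} (ht : len k < t) : totalWt t ≤ weight k := by
  obtain ⟨j, h₁, h₂⟩ := exists_group (Nat.zero_lt_of_lt ht)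
  rw [totalWt_eq_weight h₁ h₂]
  refine weight_anti ?_
  by_contra h
  have := len_strictMono.monotone (show j + 1 ≤ k by omega)
  omega

theorem natCast_mul_weight (k n : ℕ) (c : ℕ) (h : 4 * size k = n * c) :
    (n : ℝ≥0∞) * weight k = ((rarity k * c : ℕ) : ℝ≥0∞)⁻¹ := by
  have hs := size_pos k
  have hn : 0 < n := Nat.pos_of_ne_zero fun h0 => by rw [h0] at h; omega
  have hr := rarity_pos k
  rw [weight_eq, h, mul_left_comm, Nat.cast_mul,
    ENNReal.mul_inv (Or.inr (ENNReal.natCast_ne_top _)) (Or.inl (ENNReal.natCast_ne_top _)),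
    ← mul_assoc,
    ENNReal.mul_inv_cancel (by exact_mod_cast hn.ne') (by simp), one_mul]

theorem tsum_groupWt (k : ℕ) : ∑' t, groupWt k t = (rarity k : ℝ≥0∞)⁻¹ := by
  rw [tsum_eq_sum (s := Finset.Ioc (len k) (len (k + 1)))]
  · rw [Finset.sum_congr rfl (g := fun _ => weight k)]
    · rw [Finset.sum_const, Nat.card_Ioc, nsmul_eq_mul, len_succ, Nat.add_sub_cancel_left,
        natCast_mul_weight k _ 1 (by simp), mul_one]
    · intro t ht
      rw [groupWt, if_pos (Finset.mem_Ioc.1 ht)]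
  · intro t ht
    rw [groupWt, if_neg (mt Finset.mem_Ioc.2 ht)]

/-- The mass of the groups from `k` on. -/
noncomputable def tailMass (k : ℕ) : ℝ≥0∞ := ∑' j, (rarity (j + k) : ℝ≥0∞)⁻¹

/-- By the union bound this controls the chance that one of the first `time k` legs belongs to a
group from `k` on. The factor 2^(k + 3) in `rarity` makes the series geometric, since `time`
increases. -/
theorem time_mul_tailMass_le (k : ℕ) : time k * tailMass k ≤ 2⁻¹ ^ (k + 2) := by
  rw [tailMass, ← ENNReal.tsum_mul_left]
  have h1 : ∀ j : ℕ, (time k : ℝ≥0∞) * (rarity (j + k) : ℝ≥0∞)⁻¹ ≤ 2⁻¹ ^ (k + 3) * 2⁻¹ ^ j := by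
    intro j
    have ht : (time k : ℝ≥0∞) ≠ 0 := by exact_mod_cast (time_pos k).ne'
    have h2 : ((2 ^ (k + 3) * 2 ^ j : ℕ) : ℝ≥0∞) * time k ≤ rarity (j + k) := by
      rw [rarity_eq, show j + k + 3 = (k + 3) + j by ring, pow_add 2 (k + 3) j]
      have := time_strictMono.monotone (show k ≤ j + k by omega)
      exact_mod_cast Nat.mul_le_mul_left _ this
    calc (time k : ℝ≥0∞) * (rarity (j + k) : ℝ≥0∞)⁻¹
        ≤ time k * (((2 ^ (k + 3) * 2 ^ j : ℕ) : ℝ≥0∞) * time k)⁻¹ := by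
          gcongr
      _ = ((2 ^ (k + 3) * 2 ^ j : ℕ) : ℝ≥0∞)⁻¹ := by
          rw [ENNReal.mul_inv (Or.inr (by simp)) (Or.inr ht), mul_left_comm,
            ENNReal.mul_inv_cancel ht (by simp), mul_one]
      _ = _ := by
          push_cast
          rw [ENNReal.mul_inv (by simp) (by simp), ENNReal.inv_pow, ENNReal.inv_pow]
  refine (ENNReal.tsum_le_tsum h1).trans (le_of_eq ?_)
  rw [ENNReal.tsum_mul_left, ENNReal.tsum_geometric, ENNReal.one_sub_inv_two, inv_inv,
    pow_succ _ (k + 2), mul_assoc, ENNReal.inv_mul_cancel (by norm_num) (by norm_num), mul_one]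

theorem tsum_totalWt_tail_le (k : ℕ) : ∑' t, (if len k < t then totalWt t else 0) ≤ tailMass k := by
  have h1 : ∀ t, (if len k < t then totalWt t else 0) ≤ ∑' j, groupWt (j + k) t := by
    intro t
    split_ifs with ht
    · rw [totalWt, ← ENNReal.summable.sum_add_tsum_nat_add' (k := k), Finset.sum_eq_zero, zero_add]
      exact fun j hj => groupWt_eq_zero_of_lt (Finset.mem_range.1 hj) ht
    · exact zero_le
  refine (ENNReal.tsum_le_tsum h1).trans (le_of_eq ?_)
  rw [ENNReal.tsum_comm, tailMass]
  simp only [tsum_groupWt]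

theorem tsum_totalWt (k : ℕ) : ∑' t, totalWt t = ∑' t, partialWt k t + tailMass k := by
  have h1 : ∀ t, totalWt t = partialWt k t + ∑' j, groupWt (j + k) t := fun t => by
    rw [partialWt_eq, totalWt, ENNReal.summable.sum_add_tsum_nat_add']
  simp only [h1]
  rw [ENNReal.tsum_add]
  congr 1
  rw [ENNReal.tsum_comm, tailMass]
  simp only [tsum_groupWt]

theorem tsum_totalWt_le : ∑' t, totalWt t ≤ 2⁻¹ := by
  have h := time_mul_tailMass_le 0
  rw [time_zero, Nat.cast_one, one_mul] at h
  have h0 : ∑' t, partialWt 0 t = 0 := by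
    simp [partialWt_eq]
  rw [tsum_totalWt 0, h0, zero_add]
  exact h.trans ((pow_le_pow_right_of_le_one' (by norm_num) (by norm_num)).trans (pow_one _).le)

theorem tsum_partialWt_le (k : ℕ) : ∑' t, partialWt k t ≤ 2⁻¹ := by
  refine le_trans ?_ tsum_totalWt_le
  rw [tsum_totalWt k]
  exact le_self_add

/-- The waiting time law. -/
noncomputable def law : PMF ℕ := ⟨fill totalWt, by
  rw [← tsum_fill (tsum_totalWt_le.trans (by norm_num))]
  exact ENNReal.summable.hasSum⟩

theorem law_apply (t : ℕ) : law t = fill totalWt t := rfl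

theorem law_of_pos {t : ℕ} (ht : 0 < t) : law t = totalWt t := fill_of_pos ht

theorem tsum_law : ∑' t, law t = 1 := law.tsum_coe

theorem half_le_fill {w : ℕ → ℝ≥0∞} (h : ∑' t, w t ≤ 2⁻¹) : 2⁻¹ ≤ fill w 0 := by
  rw [fill, if_pos rfl]
  refine le_add_left ?_
  rw [← ENNReal.one_sub_inv_two]
  gcongr

theorem half_le_law : 2⁻¹ ≤ law 0 := half_le_fill tsum_totalWt_le

theorem law_zero_lt_one : law 0 < 1 := by
  have h1 : law 0 + weight 0 ≤ 1 := by
    rw [← tsum_law, ← totalWt_eq_weight (k := 0) (t := 1) (by simp [len_zero])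
      (by rw [len_succ]; have := size_pos 0; omega), ← law_of_pos one_pos]
    simpa using ENNReal.sum_le_tsum (f := law) {0, 1}
  refine lt_of_lt_of_le (ENNReal.lt_add_right ?_ ?_) h1
  · exact law.apply_ne_top 0
  · rw [weight_eq]
    exact ENNReal.inv_ne_zero.2 (ENNReal.natCast_ne_top _)

/-- The law obtained from the groups up to `k`. -/
noncomputable def stageLaw (k : ℕ) : ℕ → ℝ≥0∞ := fill (partialWt (k + 1))

theorem tsum_stageLaw (k : ℕ) : ∑' t, stageLaw k t = 1 :=
  tsum_fill ((tsum_partialWt_le _).trans (by norm_num))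

theorem stageLaw_eq_zero {k t : ℕ} (ht : len (k + 1) < t) : stageLaw k t = 0 := by
  rw [stageLaw, fill_of_pos (Nat.zero_lt_of_lt ht), partialWt_eq_zero ht]

theorem law_le_stageLaw {k t : ℕ} (ht : t ≤ len (k + 1)) : law t ≤ stageLaw k t := by
  rcases Nat.eq_zero_or_pos t with rfl | h0
  · rw [law_apply, stageLaw, fill_zero totalWt_zero, fill_zero (partialWt_zero _),
      tsum_totalWt (k + 1)]
    gcongr
    exact le_self_add
  · rw [law_of_pos h0, stageLaw, fill_of_pos h0, totalWt_eq_partialWt ht]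

/-- For positive lengths the stage law is either equal to the law or 0. At 0 it exceeds the law by
`tailMass (k + 1)`, and this is at most twice that mass times `stageLaw k 0 ≥ 1/2`. -/
theorem mul_stageLaw_le_law (k t : ℕ) : (1 - 2 * tailMass (k + 1)) * stageLaw k t ≤ law t := by
  rcases Nat.eq_zero_or_pos t with rfl | h0
  · rw [law_apply, stageLaw, fill_zero totalWt_zero, fill_zero (partialWt_zero _),
      tsum_totalWt (k + 1)]
    have hx := tsum_partialWt_le (k + 1)
    have hxy := tsum_totalWt_le
    rw [tsum_totalWt (k + 1)] at hxy
    generalize ∑' t, partialWt (k + 1) t = x at *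
    have hy : tailMass (k + 1) ≤ 2⁻¹ := le_trans le_add_self hxy
    generalize tailMass (k + 1) = y at *
    have hz : (1 : ℝ≥0∞) - x ≤ 1 := tsub_le_self
    have hz2 : (2 : ℝ≥0∞)⁻¹ ≤ 1 - x := by
      rw [← ENNReal.one_sub_inv_two]
      gcongr
    rw [← tsub_tsub, ENNReal.sub_mul fun _ _ => (hz.trans_lt ENNReal.one_lt_top).ne, one_mul]
    refine tsub_le_tsub_left ?_ _
    calc y = 2 * y * 2⁻¹ := by
          rw [mul_right_comm, ENNReal.mul_inv_cancel (by norm_num) (by norm_num), one_mul]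
      _ ≤ _ := by gcongr
  · rcases le_or_gt t (len (k + 1)) with ht | ht
    · rw [law_of_pos h0, stageLaw, fill_of_pos h0, totalWt_eq_partialWt ht]
      exact mul_le_of_le_one_left' tsub_le_self
    · rw [stageLaw_eq_zero ht, mul_zero]
      exact zero_le

/-! ### The occupation of the boxes -/

/-- The prescribed occupation. -/
noncomputable def goal (k : ℕ) : ℕ := 4 * 10 ^ 5 * size k * rarity k ^ 2

theorem span_spec (k : ℕ) : (goal k : ℝ≥0∞) ≤ green (stageLaw k) (size k) (span k) := by
  have h := exists_le_green (tsum_stageLaw k) (fun t ht => stageLaw_eq_zero ht)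
    (Nat.zero_lt_of_lt (len_strictMono k.lt_succ_self)) (size k) (goal k)
  have := Nat.sInf_mem h
  rw [span_eq]
  exact this

theorem four_mul_size_le_goal (k : ℕ) : 4 * size k ≤ goal k := by
  have h1 := rarity_pos k
  have h2 : 0 < rarity k ^ 2 := by positivity
  rw [goal]
  nlinarith [Nat.le_mul_of_pos_right (4 * 10 ^ 5 * size k) h2]

theorem green_le (w : ℕ → ℝ≥0∞) (hw : ∑' t, w t = 1) (r : ℤ) (N : ℕ) :
    green w r N ≤ (4 * N : ℕ) := by
  refine (Finset.sum_le_card_nsmul _ _ _ fun e _ => occ_ind_le hw _ N 0 e).trans (le_of_eq ?_)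
  simp only [Finset.card_univ, Fintype.card_prod, Fintype.card_fin, Fintype.card_bool, nsmul_eq_mul]
  push_cast
  norm_num

theorem size_le_span (k : ℕ) : size k ≤ span k := by
  have h1 := (span_spec k).trans (green_le _ (tsum_stageLaw k) _ _)
  have h2 : goal k ≤ 4 * span k := by exact_mod_cast h1
  have h3 := four_mul_size_le_goal k
  omega

/-- By minimality of `span k` the goal is not reached one leg earlier, and the last leg adds at most
4, one for each initial direction. -/
theorem green_stageLaw_le (k : ℕ) : green (stageLaw k) (size k) (span k) ≤ goal k + 4 := by
  have hpos : 0 < span k := (size_pos k).trans_le (size_le_span k)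
  obtain ⟨n, hn⟩ : ∃ n, span k = n + 1 := ⟨span k - 1, by omega⟩
  rw [hn]
  refine (green_succ_le (tsum_stageLaw k) _ n).trans ?_
  gcongr
  have : n ∉ {N | (goal k : ℝ≥0∞) ≤ green (stageLaw k) (size k) N} :=
    Nat.notMem_of_lt_sInf (by
      change n < span k
      omega)
  exact (not_le.1 this).le

/-- Makes the error term of `occ_box_le_add` at most 1: `rarity (k + 1)` exceeds `span k`, and `size
(k + 1)` contains the square of this rarity and the factor `len (k + 1) + 1`. -/
theorem span_sq_mul_le (k : ℕ) :
    span k * (span k * (2 * size k + 1)) ≤ rarity (k + 1) * (4 * size (k + 1)) := by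
  have h1 : span k ≤ rarity (k + 1) := le_trans (by rw [time_succ]; omega) (time_le_rarity (k + 1))
  have h2 := sq_mul_len_le_size (k + 1)
  have h3 : 2 * size k + 1 ≤ len (k + 1) + 1 := by rw [len_succ]; omega
  have h4 := rarity_pos (k + 1)
  calc span k * (span k * (2 * size k + 1))
      ≤ rarity (k + 1) * (rarity (k + 1) * (len (k + 1) + 1)) := by gcongr
    _ = rarity (k + 1) ^ 2 * (len (k + 1) + 1) := by ring
    _ ≤ size (k + 1) := h2
    _ ≤ rarity (k + 1) * (4 * size (k + 1)) := by nlinarith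

theorem green_law_le (k : ℕ) : green law (size k) (span k) ≤ 2 * goal k := by
  have h1 : ∀ e : Direction 2, occ law (fun _ _ _ => True) (span k) (ind (box (size k))) 0 e ≤
      occ (stageLaw k) (fun _ _ _ => True) (span k) (ind (box (size k))) 0 e + 1 := by
    intro e
    refine (occ_box_le_add tsum_law (tsum_stageLaw k) (L := len (k + 1)) (d := weight (k + 1))
      (fun t ht => law_le_stageLaw ht) (fun t ht => ?_) (size k) (span k) 0 e).trans ?_
    · rw [law_of_pos (Nat.zero_lt_of_lt ht)]
      exact totalWt_le_weight ht
    · gcongr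
      have h2 := rarity_pos (k + 1)
      have h3 := size_pos (k + 1)
      rw [mul_left_comm, mul_comm, weight_eq, ← div_eq_mul_inv]
      refine ENNReal.div_le_of_le_mul ?_
      rw [one_mul]
      exact_mod_cast span_sq_mul_le k
  have h2 : green law (size k) (span k) ≤ green (stageLaw k) (size k) (span k) + 4 := by
    refine (Finset.sum_le_sum fun e _ => h1 e).trans ?_
    rw [Finset.sum_add_distrib, green]
    simp only [Finset.sum_const, Finset.card_univ, Fintype.card_prod, Fintype.card_fin,
      Fintype.card_bool, nsmul_eq_mul, mul_one]
    norm_num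
  refine h2.trans ((add_le_add (green_stageLaw_le k) le_rfl).trans ?_)
  rw [add_assoc, two_mul]
  gcongr
  have h3 := size_pos k
  have h4 := rarity_pos k
  have h5 : 8 ≤ goal k := by
    have : 0 < size k * rarity k ^ 2 := by positivity
    rw [goal, mul_assoc]
    omega
  have h6 : (8 : ℝ≥0∞) ≤ goal k := by exact_mod_cast h5
  exact le_trans (by norm_num) h6

theorem one_sub_mul_le_pow (x : ℝ≥0∞) (n : ℕ) : 1 - n * x ≤ (1 - x) ^ n := by
  induction n with
  | zero => simp
  | succ n ih =>
    rcases le_or_gt 1 x with hx | hx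
    · have : (1 : ℝ≥0∞) ≤ (n + 1 : ℕ) * x := by
        push_cast
        rw [add_mul, one_mul]
        exact hx.trans le_add_self
      rw [tsub_eq_zero_of_le this]
      exact zero_le
    · rw [pow_succ]
      refine le_trans ?_ (mul_le_mul_left ih (1 - x))
      rw [ENNReal.mul_sub fun _ _ => (tsub_le_self.trans_lt ENNReal.one_lt_top).ne, mul_one]
      push_cast
      rw [add_mul, one_mul, ← tsub_tsub]
      gcongr
      exact mul_le_of_le_one_left' tsub_le_self

/-- Passing from the stage law to the law costs at most a factor `1 - 2 * tailMass (k + 1)` per leg,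
and over `span k` legs at least half survives because `span k ≤ time (k + 1)`. -/
theorem le_green_law (k : ℕ) : ((2 * 10 ^ 5 * size k * rarity k ^ 2 : ℕ) : ℝ≥0∞) ≤
    green law (size k) (span k) := by
  refine le_trans ?_ (pow_mul_green_le tsub_le_self (mul_stageLaw_le_law k) (size k) (span k))
  have h1 : (2⁻¹ : ℝ≥0∞) ≤ (1 - 2 * tailMass (k + 1)) ^ span k := by
    refine le_trans ?_ (one_sub_mul_le_pow _ _)
    rw [← ENNReal.one_sub_inv_two]
    refine tsub_le_tsub_left ?_ _
    calc (span k : ℝ≥0∞) * (2 * tailMass (k + 1)) ≤ time (k + 1) * (2 * tailMass (k + 1)) := by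
          gcongr
          rw [time_succ]; omega
      _ = 2 * (time (k + 1) * tailMass (k + 1)) := by ring
      _ ≤ 2 * 2⁻¹ ^ (k + 1 + 2) := by
          gcongr
          exact time_mul_tailMass_le (k + 1)
      _ ≤ 2 * 2⁻¹ ^ 2 := by
          gcongr 2 * ?_
          exact pow_le_pow_right_of_le_one' (by norm_num) (by omega)
      _ = 2⁻¹ := by
          rw [sq, ← mul_assoc, ENNReal.mul_inv_cancel (by norm_num) (by norm_num), one_mul]
  calc ((2 * 10 ^ 5 * size k * rarity k ^ 2 : ℕ) : ℝ≥0∞) = 2⁻¹ * goal k := by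
        rw [goal, show 4 * 10 ^ 5 * size k * rarity k ^ 2 =
          2 * (2 * 10 ^ 5 * size k * rarity k ^ 2) by ring, Nat.cast_mul 2, Nat.cast_ofNat,
          ← mul_assoc, ENNReal.inv_mul_cancel (by norm_num) (by norm_num), one_mul]
    _ ≤ _ := mul_le_mul' h1 (span_spec k)


/-! ### The phases of the walk: passing through the origin -/

theorem le_hit_law (k : ℕ) {s : Fin 2 → ℤ} (hs : s ∈ box (size k)) (e : Direction 2) :
    1536⁻¹ ≤ hit law Crosses (span k + 1) s e := by
  have ha := size_pos k
  have hb := rarity_pos k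
  have hweight : weight k ≤ 2⁻¹ := by
    rw [weight_eq, ENNReal.inv_le_inv]
    have : 2 ≤ rarity k * (4 * size k) := by nlinarith
    exact_mod_cast this
  have hd : ∀ t ≤ 2 * size k, weight k ≤ law t := by
    intro t ht
    rcases Nat.eq_zero_or_pos t with rfl | h0
    · exact hweight.trans half_le_law
    · rw [law_of_pos h0]
      exact weight_le_totalWt h0 (by rw [len_succ]; omega)
  -- The upper half of group `k`, with `2 * size k` lengths, consists of lengths above `2 * size k`.
  have hq : ((rarity k * 2 : ℕ) : ℝ≥0∞)⁻¹ ≤ ∑' t, if 2 * size k < t then law t else 0 := by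
    rw [← natCast_mul_weight k (2 * size k) 2 (by ring)]
    refine le_trans (le_of_eq ?_)
      (ENNReal.sum_le_tsum (Finset.Ioc (len k + 2 * size k) (len (k + 1))))
    rw [Finset.sum_congr rfl (g := fun _ => weight k), Finset.sum_const, Nat.card_Ioc,
      nsmul_eq_mul]
    · congr 2
      rw [len_succ]; omega
    · intro t ht
      rw [Finset.mem_Ioc] at ht
      rw [if_pos (by omega), law_of_pos (by omega), totalWt_eq_weight (by omega) ht.2]
  set η : ℝ≥0∞ := ((864 * size k * rarity k ^ 2 : ℕ) : ℝ≥0∞)⁻¹ with hη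
  have hη' : 2⁻¹ * (3⁻¹ * (2⁻¹ * (3⁻¹ * (weight k * (3⁻¹ * ((rarity k * 2 : ℕ) : ℝ≥0∞)⁻¹))))) =
      η := by
    have h2 : (2 : ℝ≥0∞)⁻¹ = ((2 : ℕ) : ℝ≥0∞)⁻¹ := by norm_num
    have h3 : (3 : ℝ≥0∞)⁻¹ = ((3 : ℕ) : ℝ≥0∞)⁻¹ := by norm_num
    have hinv : ∀ m n : ℕ, (m : ℝ≥0∞)⁻¹ * (n : ℝ≥0∞)⁻¹ = ((m * n : ℕ) : ℝ≥0∞)⁻¹ := fun m n => by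
      rw [Nat.cast_mul, ENNReal.mul_inv (Or.inr (ENNReal.natCast_ne_top _))
        (Or.inl (ENNReal.natCast_ne_top _))]
    rw [weight_eq, h2, h3]
    simp only [hinv]
    rw [hη]
    congr 2
    ring
  refine le_hit_of_le_green tsum_law half_le_law ha (η := η) (fun s hs e => ?_) ?_ hs e
  · rw [← hη']
    exact le_hit_crosses tsum_law half_le_law hd hq (by exact_mod_cast hs) e
  · have hpos : 0 < 864 * size k * rarity k ^ 2 := by positivity
    -- The constant in `goal` is chosen for this: 864 * 192 = 165888.
    have h1 : 864 * size k * rarity k ^ 2 * 192 ≤ 2 * 10 ^ 5 * size k * rarity k ^ 2 := by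
      have : 0 ≤ size k * rarity k ^ 2 := Nat.zero_le _
      nlinarith
    calc (192 : ℝ≥0∞) = η * ((864 * size k * rarity k ^ 2 * 192 : ℕ) : ℝ≥0∞) := by
          rw [Nat.cast_mul (864 * size k * rarity k ^ 2), ← mul_assoc, hη,
            ENNReal.inv_mul_cancel (by exact_mod_cast hpos.ne') (ENNReal.natCast_ne_top _), one_mul,
            Nat.cast_ofNat]
      _ ≤ η * ((2 * 10 ^ 5 * size k * rarity k ^ 2 : ℕ) : ℝ≥0∞) :=
          mul_le_mul_right (by exact_mod_cast h1) η
      _ ≤ _ := mul_le_mul_right (le_green_law k) η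

/-- One leg which does not pass through the origin. -/
noncomputable abbrev avoid : Module.End ℝ≥0∞ Obs := leg law fun s e t => ¬ Crosses s e t

theorem avoid_pow_span_le (k : ℕ) :
    (avoid ^ (span k + 1)) 1 ≤ (1 - 1536⁻¹ : ℝ≥0∞) • (1 : Obs) + ind (box (size k))ᶜ := by
  intro s e
  have h1 := congrFun (congrFun (hit_add_avoid (A := Crosses) tsum_law (span k + 1)) s) e
  simp only [Pi.add_apply, Pi.one_apply, Pi.smul_apply, smul_eq_mul, mul_one] at h1 ⊢
  by_cases hs : s ∈ box (size k)
  · refine le_add_right (ENNReal.le_sub_of_add_le_left (by simp) ?_)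
    rw [← h1]
    gcongr
    exact le_hit_law k hs e
  · rw [ind_of_mem (by simpa using hs)]
    refine le_add_left ?_
    rw [← h1]
    exact le_add_self

/-- Without lengths above `len k`, the first `time k` legs cover at most `time k * len k ≤ size k`.
-/
theorem escape_le (k : ℕ) (e : Direction 2) :
    (free law ^ time k) (ind (box (size k))ᶜ) 0 e ≤ 2⁻¹ ^ (k + 2) := by
  have h1 : ∑' t, (if len k < t then law t else 0) ≤ tailMass k := by
    refine le_trans (le_of_eq (tsum_congr fun t => ?_)) (tsum_totalWt_tail_le k)
    split_ifs with h
    · exact law_of_pos (Nat.zero_lt_of_lt h)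
    · rfl
  refine le_trans ?_ ((free_pow_compl_box_le tsum_law h1 (time k) 0 0 (by simp [box]) e).trans
    (time_mul_tailMass_le k))
  refine leg_pow_mono _ (ind_mono (Set.compl_subset_compl.2 fun s hs => ?_)) 0 e
  have : (0 : ℤ) + time k * len k ≤ size k := by
    rw [zero_add]
    exact_mod_cast time_mul_len_le_size k
  exact ⟨hs.1.trans this, hs.2.trans this⟩

theorem time_le_time_add (k j : ℕ) : time k ≤ time (k + j) :=
  time_strictMono.monotone (Nat.le_add_right k j)

/-- Each phase multiplies the probability of avoidance by `1 - 1/1536`, up to the escape error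
2^(-(k+j+2)). The additional summand on the left absorbs these errors in the induction, because 1/4
+ 1/2 is at most the ratio. -/
theorem avoid_phases_le (k j : ℕ) (e : Direction 2) :
    (free law ^ time k) ((avoid ^ (time (k + j) - time k)) 1) 0 e + 2⁻¹ ^ (k + j) ≤
      2 * (1 - 1536⁻¹) ^ j := by
  induction j with
  | zero =>
    rw [add_zero, Nat.sub_self, pow_zero, pow_zero, mul_one]
    exact (add_le_add (leg_pow_le_const tsum_law _ (fun _ _ => le_rfl) _ 0 e)
      (pow_le_one' (by norm_num) _)).trans_eq one_add_one_eq_two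
  | succ j ih =>
    set r : ℝ≥0∞ := 1 - 1536⁻¹ with hr
    have hle := time_le_time_add k j
    have h1 : time (k + (j + 1)) - time k = (time (k + j) - time k) + (span (k + j) + 1) := by
      rw [← add_assoc, time_succ]
      omega
    have h2 : (free law ^ time k) ((avoid ^ (time (k + (j + 1)) - time k)) 1) 0 e ≤
        r * (free law ^ time k) ((avoid ^ (time (k + j) - time k)) 1) 0 e +
          2⁻¹ ^ (k + j + 2) := by
      rw [h1, pow_add, Module.End.mul_apply]
      refine (leg_pow_mono _ (leg_pow_mono _ (avoid_pow_span_le (k + j))) 0 e).trans ?_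
      rw [map_add, map_smul, map_add, map_smul, Pi.add_apply, Pi.add_apply, Pi.smul_apply,
        Pi.smul_apply, smul_eq_mul]
      refine add_le_add le_rfl (le_trans ?_ (escape_le (k + j) e))
      have h3 : free law ^ time (k + j) =
          free law ^ time k * free law ^ (time (k + j) - time k) := by
        rw [← pow_add]
        congr 1
        omega
      rw [h3, Module.End.mul_apply]
      refine leg_pow_mono _ ?_ 0 e
      generalize time (k + j) - time k = n
      induction n with
      | zero => exact le_rfl
      | succ n ihn =>
        rw [pow_succ', pow_succ', Module.End.mul_apply, Module.End.mul_apply]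
        exact (leg_le_free _ _ _).trans (leg_mono ihn)
    have hr34 : 2⁻¹ ^ 2 + 2⁻¹ ≤ r := by
      refine ENNReal.le_sub_of_add_le_left (by simp) ?_
      have h3 : (1536 : ℝ≥0∞)⁻¹ ≤ 2⁻¹ ^ 2 := by
        rw [← ENNReal.inv_pow, ENNReal.inv_le_inv]
        norm_num
      calc (1536 : ℝ≥0∞)⁻¹ + (2⁻¹ ^ 2 + 2⁻¹) ≤ 2⁻¹ ^ 2 + (2⁻¹ ^ 2 + 2⁻¹) := by gcongr
        _ = 2⁻¹ * (2⁻¹ + 2⁻¹) + 2⁻¹ := by ring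
        _ = 1 := by rw [ENNReal.inv_two_add_inv_two, mul_one, ENNReal.inv_two_add_inv_two]
    calc (free law ^ time k) ((avoid ^ (time (k + (j + 1)) - time k)) 1) 0 e +
          2⁻¹ ^ (k + (j + 1))
        ≤ r * (free law ^ time k) ((avoid ^ (time (k + j) - time k)) 1) 0 e +
          2⁻¹ ^ (k + j + 2) + 2⁻¹ ^ (k + (j + 1)) := by gcongr
      _ = r * (free law ^ time k) ((avoid ^ (time (k + j) - time k)) 1) 0 e +
          (2⁻¹ ^ 2 + 2⁻¹) * 2⁻¹ ^ (k + j) := by ring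
      _ ≤ r * (free law ^ time k) ((avoid ^ (time (k + j) - time k)) 1) 0 e +
          r * 2⁻¹ ^ (k + j) := by gcongr
      _ = r * ((free law ^ time k) ((avoid ^ (time (k + j) - time k)) 1) 0 e +
          2⁻¹ ^ (k + j)) := by ring
      _ ≤ r * (2 * r ^ j) := by gcongr
      _ = 2 * r ^ (j + 1) := by ring

/-! ### The phases of the walk: visits at the turns -/

/-- The number of legs before visits are controlled by the smoothing due to group `k`. -/
noncomputable def turnTime (k : ℕ) : ℕ := 2 * (8 ^ k * time k)

theorem turnTime_strictMono : StrictMono turnTime := fun j k h => by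
  have h1 := time_strictMono h
  have h2 : 8 ^ j ≤ 8 ^ k := Nat.pow_le_pow_right (by norm_num) h.le
  have h3 : 0 < 8 ^ k := by positivity
  unfold turnTime
  have : 8 ^ j * time j < 8 ^ k * time k := by nlinarith
  omega

theorem turnTime_succ_le (k : ℕ) : turnTime (k + 1) ≤ 48 * 8 ^ k * span k := by
  have h1 : time k ≤ span k := by
    refine le_trans ?_ (size_le_span k)
    have h2 := sq_mul_len_le_size k
    have h3 := time_le_rarity k
    have h4 := rarity_pos k
    nlinarith [Nat.le_mul_of_pos_right (rarity k ^ 2) (Nat.succ_pos (len k))]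
  have h2 := time_pos k
  unfold turnTime
  rw [time_succ, pow_succ]
  have h3 : time k + span k + 1 ≤ 3 * span k := by omega
  calc 2 * (8 ^ k * 8 * (time k + span k + 1)) ≤ 2 * (8 ^ k * 8 * (3 * span k)) := by gcongr
    _ = _ := by ring

theorem compl_group_add (k : ℕ) :
    (∑' t, if len k < t ∧ t ≤ len (k + 1) then 0 else law t) + (rarity k : ℝ≥0∞)⁻¹ = 1 := by
  rw [← tsum_groupWt, ← ENNReal.tsum_add, ← tsum_law]
  refine tsum_congr fun t => ?_
  by_cases h : len k < t ∧ t ≤ len (k + 1)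
  · rw [if_pos h, groupWt, if_pos h, zero_add, law_of_pos (Nat.zero_lt_of_lt h.1),
      totalWt_eq_weight h.1 h.2]
  · rw [if_neg h, groupWt, if_neg h, add_zero]

/-- With x = 1/(3b) the base is 1 - x, and Bernoulli's inequality gives (1 - x)^n (1 + n x) ≤ (1 -
x²)^n ≤ 1. -/
theorem pow_le_inv_of_add_eq_one {ρ : ℝ≥0∞} {b : ℕ} (hb : 0 < b) (h : ρ + (b : ℝ≥0∞)⁻¹ = 1)
    (n : ℕ) : (3⁻¹ * (ρ + 2)) ^ n * n ≤ 3 * b := by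
  have hρ : ρ ≠ ∞ := fun h' => by rw [h'] at h; simp at h
  lift ρ to NNReal using hρ
  have hbne : (b : NNReal) ≠ 0 := by exact_mod_cast hb.ne'
  have h1 : ρ + (b : NNReal)⁻¹ = 1 := by
    have : ((ρ + (b : NNReal)⁻¹ : NNReal) : ℝ≥0∞) = ((1 : NNReal) : ℝ≥0∞) := by
      rw [ENNReal.coe_add, ENNReal.coe_inv hbne, ENNReal.coe_one, ← h]
      norm_num
    exact_mod_cast this
  have h2 : (ρ : ℝ) + (b : ℝ)⁻¹ = 1 := by
    simpa using congrArg NNReal.toReal h1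
  have hb' : (0 : ℝ) < b := by exact_mod_cast hb
  set x : ℝ := (3 * b : ℝ)⁻¹ with hx
  have hx0 : 0 < x := by positivity
  have hc : 3⁻¹ * ((ρ : ℝ) + 2) = 1 - x := by
    rw [hx, mul_inv]; linarith
  have hc0 : 0 ≤ 1 - x := by rw [← hc]; positivity
  have h3 : (1 - x) ^ n * (1 + n * x) ≤ 1 := by
    calc (1 - x) ^ n * (1 + n * x) ≤ (1 - x) ^ n * (1 + x) ^ n := by
          gcongr
          exact one_add_mul_le_pow (by linarith) n
      _ = (1 - x ^ 2) ^ n := by rw [← mul_pow]; ring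
      _ ≤ 1 := pow_le_one₀ (by nlinarith) (by nlinarith)
  have h4 : (3⁻¹ * ((ρ : ℝ) + 2)) ^ n * n ≤ 3 * b := by
    rw [hc]
    have h5 : (1 - x) ^ n * (n * x) ≤ 1 := by
      have : 0 ≤ (1 - x) ^ n := by positivity
      nlinarith
    have h6 : x * (3 * b) = 1 := inv_mul_cancel₀ (by positivity)
    calc (1 - x) ^ n * n = (1 - x) ^ n * (n * x) * (3 * b) := by
          rw [mul_assoc, mul_assoc (n : ℝ), h6, mul_one]
      _ ≤ 1 * (3 * b) := by gcongr
      _ = _ := one_mul _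
  have h5 : (3⁻¹ * (ρ + 2)) ^ n * n ≤ 3 * (b : NNReal) := by exact_mod_cast h4
  have h6 : (3 : ℝ≥0∞)⁻¹ = ((3⁻¹ : NNReal) : ℝ≥0∞) := by
    rw [ENNReal.coe_inv (by norm_num)]; norm_num
  rw [h6]
  exact_mod_cast h5

/-- `turnTime k` consists of 8^k * `time k` pairs of legs. Compared with 3 * `rarity k` = 24 * 2^k *
`time k` this leaves 24 * 4^(-k), which is more than needed. -/
theorem missing_le (k : ℕ) (i : Fin 2) (s : Fin 2 → ℤ) (e : Direction 2) :
    (leg law (fun s e t => ¬ GoodLeg i (len k) (len (k + 1)) s e t) ^ turnTime k) 1 s e ≤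
      24 * 2⁻¹ ^ k := by
  refine (leg_not_goodLeg_pow_le tsum_law i _ s e).trans ?_
  have h1 := pow_le_inv_of_add_eq_one (rarity_pos k) (compl_group_add k) (8 ^ k * time k)
  set c := (3⁻¹ * ((∑' t, if len k < t ∧ t ≤ len (k + 1) then 0 else law t) + 2)) ^ (8 ^ k * time k)
  have ht := time_pos k
  have h2 : c * (2 ^ k : ℕ) * ((4 ^ k * time k : ℕ) : ℝ≥0∞) ≤
      24 * ((2 ^ k * time k : ℕ) : ℝ≥0∞) := by
    calc c * (2 ^ k : ℕ) * ((4 ^ k * time k : ℕ) : ℝ≥0∞) = c * (8 ^ k * time k : ℕ) := by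
          rw [mul_assoc, ← Nat.cast_mul, ← mul_assoc, ← mul_pow]
          norm_num
      _ ≤ 3 * rarity k := h1
      _ = _ := by
        rw [rarity_eq, pow_add]
        push_cast
        ring
  have h3 : c * (2 ^ k : ℕ) ≤ 24 := by
    have hpos : ((4 ^ k * time k : ℕ) : ℝ≥0∞) ≠ 0 := by
      have : 4 ^ k * time k ≠ 0 := by positivity
      exact_mod_cast this
    refine (ENNReal.mul_le_mul_iff_left hpos (ENNReal.natCast_ne_top _)).1 (h2.trans ?_)
    gcongr
    norm_num
  rw [← ENNReal.inv_pow, ← div_eq_mul_inv, ENNReal.le_div_iff_mul_le (by simp) (by simp)]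
  simpa using h3

theorem free_pow_hit_startsAt_le (x : Fin 2 → ℤ) (k : ℕ) (e : Direction 2) :
    (free law ^ turnTime k) (hit law (StartsAt x) (turnTime (k + 1) - turnTime k)) 0 e ≤
      49 * 2⁻¹ ^ k := by
  have ha := size_pos k
  have hocc : ∀ s e, occ law (fun _ _ _ => True) (turnTime (k + 1) - turnTime k)
      (shift (-x) (ind (box (len (k + 1))))) s e ≤
      ((48 * 8 ^ k * (100 * (2 * goal k)) : ℕ) : ℝ≥0∞) := by
    intro s e
    have h1 : turnTime (k + 1) - turnTime k ≤ 48 * 8 ^ k * span k :=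
      (Nat.sub_le _ _).trans (turnTime_succ_le k)
    refine (occ_mono_left h1 _ s e).trans ?_
    have h2 : shift (-x) (ind (box (len (k + 1)))) ≤
        shift (-x) (ind (box ((5 : ℕ) * (size k : ℤ)))) := by
      refine shift_mono _ (ind_mono fun s hs => ?_)
      have h3 : (len (k + 1) : ℤ) ≤ (5 : ℕ) * (size k : ℤ) := by
        have := len_le_size k
        have h4 : len (k + 1) ≤ 5 * size k := by rw [len_succ]; omega
        exact_mod_cast h4
      exact ⟨hs.1.trans h3, hs.2.trans h3⟩
    refine (occ_mono_right _ h2 s e).trans ?_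
    have h3 : ∀ s e, occ law (fun _ _ _ => True) (span k)
        (shift (-x) (ind (box ((5 : ℕ) * (size k : ℤ))))) s e ≤
        ((100 * (2 * goal k) : ℕ) : ℝ≥0∞) := by
      intro s e
      refine (occ_box_le_green tsum_law (-x) (by exact_mod_cast ha) 5 (by norm_num)
        (span k) s e).trans ?_
      refine (mul_le_mul_right (green_law_le k) _).trans (le_of_eq ?_)
      push_cast
      ring
    refine (occ_mul_le tsum_law h3 (48 * 8 ^ k) s e).trans (le_of_eq ?_)
    push_cast
    ring
  refine (free_pow_hit_le tsum_law (len_strictMono k.lt_succ_self) (d := weight k)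
    (fun t h1 h2 => ?_) hocc (fun i s e => missing_le k i s e) 0 e).trans ?_
  · rw [law_of_pos (Nat.zero_lt_of_lt h1), totalWt_eq_weight h1 h2]
  · have h1 : ((48 * 8 ^ k * (100 * (2 * goal k)) : ℕ) : ℝ≥0∞) /
        ((len (k + 1) - len k : ℕ) : ℝ≥0∞) ^ 2 ≤ 2⁻¹ ^ k := by
      rw [len_succ, Nat.add_sub_cancel_left]
      refine ENNReal.div_le_of_le_mul ?_
      rw [← ENNReal.inv_pow, mul_comm (2 ^ k)⁻¹, ← div_eq_mul_inv,
        ENNReal.le_div_iff_mul_le (by simp) (by simp)]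
      -- Here the occupation, linear in `size k`, meets the square of the number of lengths in the
      -- group. The factor 10^9 * 16^k * `rarity k` ^ 2 in `size k` pays for `goal k`, for the 8^k
      -- in the number of legs and for the desired 2^(-k).
      have h2 : 48 * 8 ^ k * (100 * (2 * goal k)) * 2 ^ k ≤ (4 * size k) ^ 2 := by
        have h3 : 10 ^ 9 * 16 ^ k * rarity k ^ 2 ≤ size k := by
          rw [size_eq]
          exact Nat.le_mul_of_pos_right _ (Nat.succ_pos _)
        calc 48 * 8 ^ k * (100 * (2 * goal k)) * 2 ^ k
            = 384 * (10 ^ 7 * (8 * 2) ^ k * rarity k ^ 2) * size k := by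
              rw [goal, mul_pow]; ring
          _ ≤ 16 * (10 ^ 9 * 16 ^ k * rarity k ^ 2) * size k := by
              norm_num
              gcongr ?_ * _
              nlinarith [Nat.zero_le (16 ^ k * rarity k ^ 2)]
          _ ≤ 16 * size k * size k := by gcongr
          _ = _ := by ring
      exact_mod_cast h2
    calc _ ≤ 2⁻¹ ^ k + 24 * 2⁻¹ ^ k + 24 * (2⁻¹ : ℝ≥0∞) ^ k := by gcongr
      _ = _ := by ring

/-! ### Almost sure recurrence and finiteness of the turns at a point -/

section Conclusion

variable {Ω : Type*} [MeasurableSpace Ω] {P : Measure Ω} [IsProbabilityMeasure P]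
  {D : ℕ → Ω → Direction 2} {T : ℕ → Ω → ℕ}

theorem ae_exists_crosses (h : IsDirReinforced law P D T) (k : ℕ) :
    ∀ᵐ ω ∂P, ∃ i ≥ time k, Crosses (pos (D · ω) (T · ω) i) (D i ω) (T i ω) := by
  rw [ae_iff]
  have h1 : ∀ j, P {ω | ¬ ∃ i ≥ time k, Crosses (pos (D · ω) (T · ω) i) (D i ω) (T i ω)} ≤
      2 * (1 - 1536⁻¹) ^ j := by
    intro j
    have h2 := measure_forall_legs h Crosses (time k) (time (k + j) - time k)
    refine le_trans (measure_mono fun ω hω => ?_) (h2.trans_le ?_)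
    · rintro ⟨i, hi, _, hc⟩
      exact hω ⟨i, hi, hc⟩
    · calc _ ≤ ∑ e, P {ω | D 0 ω = e} * (2 * (1 - 1536⁻¹) ^ j) := by
            refine Finset.sum_le_sum fun e _ => ?_
            gcongr
            exact le_trans le_self_add (avoid_phases_le k j e)
        _ = _ := by rw [← Finset.sum_mul, sum_measure_dir h, one_mul]
  have hr : (1 - 1536⁻¹ : ℝ≥0∞) < 1 := ENNReal.sub_lt_self (by simp) (by simp) (by simp)
  have h2 := ENNReal.Tendsto.const_mul (ENNReal.tendsto_pow_atTop_nhds_zero_of_lt_one hr)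
    (Or.inr (show (2 : ℝ≥0∞) ≠ ∞ by simp))
  rw [mul_zero] at h2
  exact le_antisymm (ge_of_tendsto' h2 h1) zero_le

theorem ae_infinite_zeros (h : IsDirReinforced law P D T) :
    ∀ᵐ ω ∂P, {m : ℕ | walk (fun i => D i ω) (fun i => T i ω) m = 0}.Infinite := by
  filter_upwards [ae_all_iff.2 fun k => ae_exists_crosses h k] with ω hω
  refine infinite_zeros fun n => ?_
  obtain ⟨i, hi, hc⟩ := hω n
  exact ⟨i, (time_strictMono.id_le n).trans hi, hc⟩

/-- Borel-Cantelli over the blocks of legs between consecutive values of `turnTime`. -/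
theorem ae_finite_turns (h : IsDirReinforced law P D T) (x : Fin 2 → ℤ) :
    ∀ᵐ ω ∂P, {i : ℕ | turnLocation (fun i => D i ω) (fun i => T i ω) i = x}.Finite := by
  set E : ℕ → Set Ω := fun k => {ω | ∃ i, turnTime k ≤ i ∧
    i < turnTime k + (turnTime (k + 1) - turnTime k) ∧
    StartsAt x (pos (D · ω) (T · ω) i) (D i ω) (T i ω)} with hE
  have h1 : ∑' k, P (E k) ≠ ∞ := by
    refine ne_top_of_le_ne_top ?_ (ENNReal.tsum_le_tsum fun k =>
      measure_exists_leg h (StartsAt x) (turnTime k) (turnTime (k + 1) - turnTime k)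
        fun e => free_pow_hit_startsAt_le x k e)
    rw [ENNReal.tsum_mul_left, ENNReal.tsum_geometric, ENNReal.one_sub_inv_two, inv_inv]
    finiteness
  filter_upwards [ae_finite_setOfPred_mem h1] with ω hω
  -- Turn `i` takes place at the start of leg `i + 1`, so it is the index `i + 1` that has to be
  -- located in a block.
  have h2 : {i : ℕ | turnLocation (fun i => D i ω) (fun i => T i ω) i = x} ⊆
      Set.Iio (turnTime 0) ∪ ⋃ k ∈ {k | ω ∈ E k}, Set.Iio (turnTime (k + 1)) := by
    intro i hi
    rw [Set.mem_ofPred_eq, turnLocation_eq] at hi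
    rcases lt_or_ge (i + 1) (turnTime 0) with h0 | h0
    · exact Or.inl (show i < _ by omega)
    · right
      classical
      have hex : ∃ k, i + 1 < turnTime (k + 1) :=
        ⟨i + 1, (Nat.lt_succ_self _).trans_le (turnTime_strictMono.id_le _)⟩
      have hlow : turnTime (Nat.find hex) ≤ i + 1 := by
        rcases Nat.eq_zero_or_pos (Nat.find hex) with hz | hz
        · rw [hz]; exact h0
        · have := Nat.find_min hex (m := Nat.find hex - 1) (by omega)
          rw [Nat.sub_add_cancel hz] at this
          omega
      have hup := Nat.find_spec hex
      refine Set.mem_biUnion (x := Nat.find hex) ?_ (show i < _ by omega)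
      exact ⟨i + 1, hlow, by omega, hi⟩
  exact ((Set.finite_Iio _).union (hω.biUnion fun k _ => Set.finite_Iio _)).subset h2

end Conclusion

end DirWalk

theorem theorem4 :
    ∃ μ : PMF ℕ, μ 0 < 1 ∧
      ∀ (Ω : Type*) [MeasurableSpace Ω] (P : Measure Ω) [IsProbabilityMeasure P]
        (D : ℕ → Ω → DirWalk.Direction 2) (T : ℕ → Ω → ℕ),
        DirWalk.IsDirReinforced μ P D T →
          (∀ᵐ ω ∂P, {m : ℕ | DirWalk.walk (fun i => D i ω) (fun i => T i ω) m = 0}.Infinite) ∧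
          (∀ x : Fin 2 → ℤ, ∀ᵐ ω ∂P,
            {i : ℕ | DirWalk.turnLocation (fun i => D i ω) (fun i => T i ω) i = x}.Finite) :=
  ⟨DirWalk.law, DirWalk.law_zero_lt_one, fun _ _ _ _ _ _ h =>
    ⟨DirWalk.ae_infinite_zeros h, DirWalk.ae_finite_turns h⟩⟩
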